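/- **Setting.** Let $k\ge 1$, $n\in\mathbb N$, $R>0$; for $\epsilon=(\epsilon_0,\dots,\epsilon_{k-1})\in\mathbb C^k$ put $p_\epsilon(x)=x^{k+1}+\epsilon_{k-1}x^{k-1}+\dots+\epsilon_1x+\epsilon_0$. Let $\Sigma_0\subset\mathbb C^k$ be the set of $\epsilon$ for which $p_\epsilon$ has only simple zeroes, $\mathbb D_\rho=\{\epsilon:|\epsilon_j|<\rho^{k+1-j}\}$, with $\rho>0$ so small that for $\epsilon\in\mathbb D_\rho$ all zeroes of $p_\epsilon$ satisfy $|x|<R/2$. Write $r\cdot\epsilon=(r^{k+1-j}\epsilon_j)_j$. Indices $j\in\{0,\dots,k-1\}$ are cyclic modulo $k$. *DS domains.* Let $\widetilde S$ be a connected component of the complement, in $\Sigma_0$, of the closure of the set of $\epsilon$ for which $\dot x=p_\epsilon(x)$ (real time) has a trajectory coming from and returning to $\infty$ in finite time. A (widened) DS domain is a contractible Hausdorff space $S$ with a local homeomorphism $\pi:S\to\Sigma_0\cap\mathbb D_\rho$, to which the maps $\epsilon\mapsto r\cdot\epsilon$, $0<r\le1$, lift continuously along each orbit, with a continuous section of $\pi$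 over such an $\widetilde S\cap\mathbb D_\rho$ (its core), a permutation $\sigma$ of the indices, and for each $u\in S$, with $\epsilon=\pi(u)$, a covering of $\{|x|<R,\ p_\epsilon(x)\ne0\}$ by open simply connected sectors $\Omega_j^+,\Omega_j^-$ as follows. Sectors of equal sign and different index are disjoint; the intersections $\Omega^+_i\cap\Omega^-_j$ are disjoint unions of those connected open sets $\Omega_j^U\subset\Omega_j^+\cap\Omega_{j-1}^-$, $\Omega_j^L\subset\Omega_j^+\cap\Omega_j^-$, $\Omega_j^G\subset\Omega_j^+\cap\Omega_{\sigma(j)}^-$ whose labels fit. On $|x|=3R/4$ the closed arcs of argument $[\frac{2\pi j}k,\frac{(2j+1)\pi}k]$ and $[\frac{(2j+1)\pi}k,\frac{2(j+1)\pi}k]$ lie in $\Omega_j^+$ and $\Omega_j^-$, their initial points in $\Omega_j^U$ and $\Omega_j^L$. There are zeroes $\alpha_j,\omega_j$ of $p_\epsilon$, exhausting the zeroes, with $\alpha_j=\alpha_{\sigma(j)+1}$, $\omega_j=\omega_{\sigma(j)}$, and slopes $\beta_{x_*}\in(-\frac\pi2,\frac\pi2)$ of the zeroes $x_*$, such that $\Omega_j^U$,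 $\Omega_j^G$ contain half-trajectories of $\dot x=-e^{i\beta_{\alpha_j}}p_\epsilon(x)$ tending to $\alpha_j$, and $\Omega_j^L$, $\Omega_j^G$ contain half-trajectories of $\dot x=e^{i\beta_{\omega_j}}p_\epsilon(x)$ tending to $\omega_j$. The sectors, their intersections, and $\alpha_j,\omega_j$ vary continuously with $u$; over the core, the separatrix of $\dot x=p_\epsilon(x)$ going to $\infty$ in the direction $e^{2\pi ij/k}$ comes from $\alpha_j$, and the one coming from $\infty$ in the direction $e^{(2j+1)\pi i/k}$ tends to $\omega_j$. "Analytic on $S$" means: locally an analytic function of $\epsilon=\pi(u)$; limits at $\epsilon=0$ are limits as $\pi(u)\to0$. *Data.* (a) Diagonal matrices $\Lambda_0(\epsilon),\dots,\Lambda_k(\epsilon)$ analytic on $\mathbb D_\rho$, the diagonal entries of $\Lambda_0(0)$ having strictly decreasing real parts; let $\lambda_i(x,\epsilon)$ be the diagonal entries of $\Lambda(x,\epsilon)=\sum_m\Lambda_m(\epsilon)x^m$. (b) A family $(S_s)_s$ of DS domains, and for each $s$ matrices $C_j^U(u)$ upper triangular, $C_j^L(u)$ lower triangular ($u\in S_s$),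 analytic on $S_s$, with limits $C^U_{j,0},C^L_{j,0}$ at $\epsilon=0$ that do not depend on $s$; their diagonal parts are the identity except that of $C_0^U(u)$, which is $\exp(-2\pi i\Lambda_k(\epsilon))$. The gate matrices $C_j^G(u)$ are the diagonal matrices for which the diagonal parts of $C^U_j,C^L_j$ together with $C_j^G$ are the transition matrices of diagonal fundamental solutions $F_j^\pm$, on $\Omega_j^\pm$, of $p_\epsilon y'=\Lambda(x,\epsilon)y$, i.e. $F_j^+=F_{j-1}^-\mathrm{diag}(C_j^U)$ on $\Omega_j^U$, $F_j^-=F_j^+\mathrm{diag}(C_j^L)$ on $\Omega_j^L$, $F^-_{\sigma(j)}=F_j^+C_j^G$ on $\Omega_j^G$. The slopes are small enough that, at each zero $x_*$ of $p_\epsilon$, the numbers $\mathrm{Re}(e^{i\beta_{x_*}}\lambda_i(x_*,\epsilon))$ are strictly decreasing in $i$. (c) A matrix $M_\infty$ with nonzero entries and distinct eigenvalues, such that $M_\infty M(0)^{-1}$ has distinct eigenvalues, where $M(0)=(C_{k-1,0}^L)^{-1}(C_{k-1,0}^U)^{-1}\cdots(C_{0,0}^L)^{-1}(C_{0,0}^U)^{-1}$.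 (d) $n-1$ off-diagonal positions $(i,l)$ with exponents $m\in\{1,\dots,k+1\}$, such that an invertible diagonal matrix $\mathrm{diag}(d_i)$ with $d_i=d_l$ for all these positions is scalar. *Compatibility Condition.* There are invertible matrices $\Gamma_s(u)$, analytic on $S_s$ and tending to the identity at $\epsilon=0$, such that whenever $u\in S_s$, $u'\in S_{s'}$ lie over the same $\epsilon$ (also if $s=s'$), the monodromy representations $\mathcal M_u,\mathcal M_{u'}$ of the flat bundles on $\{|x|<R,\ p_\epsilon\neq0\}$, glued from trivial ones on the sectors by the constant matrices $C^U,C^L,C^G$, with base point $3R/4$ and the frame over $\Omega_{k-1}^-$, satisfy $\mathcal M_u=G\,\mathcal M_{u'}G^{-1}$ with $G=\Gamma_s(u)^{-1}\Gamma_{s'}(u')$. *Normalized realizations.* A system $$y'=\left(\frac{A_0+A_1x+\dots+A_kx^k}{p_\epsilon(x)}+\frac{\widehat A}{x-R}\right)y=B(x)\,y$$ is normalized if $A_0$ is diagonal and the coefficients of $x^m$ in the entries $(i,l)$ of $p_\epsilon(x)(x-R)B(x)$, for the positions and exponents in (d), equal $1$. It has formal normal form $p_\epsilon y'=\Lambda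 y$ if the characteristic polynomial of $\sum_m A_mx^m$ is congruent to that of $\Lambda(x,\epsilon)$ modulo $p_\epsilon(x)$. The monodromy around $\infty$ is taken along the loop based at $3R/4$ that goes up a vertical segment to $3R/4+2iR$, once counterclockwise around a circle centered at $0$, and back. Fix a normalized system $E_0$ at $\epsilon=0$ with $A_0=\Lambda_0(0)$, formal normal form given by $\Lambda(x,0)$, Stokes matrices $C^U_{j,0},C^L_{j,0}$ and monodromy $M_\infty$ around $\infty$ (in the basis of solutions over the last sector). A normalized realization $\mathcal E_{S_s}$ over $\mathbb{CP}^1$ is a family of normalized systems, with coefficients analytic on $S_s$ and tending to those of $E_0$ at $\epsilon=0$, with formal normal form $p_\epsilon y'=\Lambda y$, and such that for every $u\in S_s$ there are fundamental solutions $X_j^\pm$ on $\Omega_j^\pm$ with the following properties: the $i$-th column is $O(e^{\lambda_i(x_*,\epsilon)t})$, along the half-trajectories of slope $\beta_{x_*}$ in the sector ($t$ being the complex time, $dt=dx/p_\epsilon$), at each of the two zeroes $x_*$ adherent to it ($\alpha_j,\omega_j$ for $\Omega_j^+$; $\alpha_{j+1},\omega_j$ for $\Omega_j^-$); $X_j^+=X_{j-1}^-C_j^U$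 on $\Omega_j^U$, $X_j^-=X_j^+C_j^L$ on $\Omega_j^L$, $X_{\sigma(j)}^-=X_j^+C_j^G$ on $\Omega_j^G$; and the monodromy of $X_{k-1}^-$ around $\infty$ is $\Gamma_s(u)^{-1}M_\infty\Gamma_s(u)$. **Theorem.** Suppose that the Compatibility Condition holds, and let $\mathcal E_{S_s}$, $\mathcal E_{S_{s'}}$ be normalized realizations over $S_s$ and $S_{s'}$. Then they are equal on $S_s\cap S_{s'}$: if $u\in S_s$ and $u'\in S_{s'}$ lie over the same $\epsilon$, the systems $\mathcal E_{S_s}$ at $u$ and $\mathcal E_{S_{s'}}$ at $u'$ have the same coefficients $A_0,\dots,A_k,\widehat A$. -/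

import Mathlib

open Filter Topology Set

noncomputable section

namespace UnfoldedSystems

/-! ### The polynomial vector field and its parameters -/

/-- The generic unfolding `x^(k+1) + ε_(k-1) x^(k-1) + ⋯ + ε_1 x + ε_0` of `x^(k+1)`. -/
def pPoly {k : ℕ} (ε : Fin k → ℂ) : Polynomial ℂ :=
  Polynomial.X ^ (k + 1) + ∑ j : Fin k, Polynomial.C (ε j) * Polynomial.X ^ (j : ℕ)

/-- The value `p_ε(x)`. -/
def pVal {k : ℕ} (ε : Fin k → ℂ) (x : ℂ) : ℂ := (pPoly ε).eval x

/-- The weighted rescaling of the parameters, under which the zeroes of `p_ε` are multiplied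
by `r`. -/
def rescale {k : ℕ} (r : ℝ) (ε : Fin k → ℂ) : Fin k → ℂ :=
  fun j => (r : ℂ) ^ (k + 1 - (j : ℕ)) * ε j

/-- The polydisk `{ε : max_j |ε_j|^(1/(k+1-j)) < ρ}`. -/
def polydisk (k : ℕ) (ρ : ℝ) : Set (Fin k → ℂ) :=
  {ε | ∀ j : Fin k, ‖ε j‖ < ρ ^ (k + 1 - (j : ℕ))}

/-- The complement of the discriminant locus: all zeroes of `p_ε` are simple. -/
def sigmaZero (k : ℕ) : Set (Fin k → ℂ) := {ε | (pPoly ε).Separable}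

/-- The vector field `dx/dt = p_ε(x)` (real time) has a homoclinic connection at infinity: a real
trajectory which comes from infinity and returns to infinity in finite time. -/
def HasHomoclinic {k : ℕ} (ε : Fin k → ℂ) : Prop :=
  ∃ a b : ℝ, a < b ∧ ∃ x : ℝ → ℂ,
    (∀ t ∈ Ioo a b, HasDerivAt x (pVal ε (x t)) t) ∧
    Tendsto (fun t => ‖x t‖) (𝓝[>] a) atTop ∧ Tendsto (fun t => ‖x t‖) (𝓝[<] b) atTop

/-- The unextended Douady-Sentenac domains: the connected components of the complement, in
`sigmaZero k`, of the closure of the locus of homoclinic connections. -/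
def IsOpenDSDomain {k : ℕ} (D : Set (Fin k → ℂ)) : Prop :=
  ∃ ε ∈ sigmaZero k \ closure {ε | HasHomoclinic ε},
    D = connectedComponentIn (sigmaZero k \ closure {ε | HasHomoclinic ε}) ε

/-- The separatrix which reaches infinity in the direction `exp (2 π i j / k)` emerges from the
singular point `a`. -/
def IsAlphaAttached {k : ℕ} (ε : Fin k → ℂ) (j : Fin k) (a : ℂ) : Prop :=
  ∃ x : ℝ → ℂ, (∀ t < 0, HasDerivAt x (pVal ε (x t)) t) ∧ Tendsto x atBot (𝓝 a) ∧
    Tendsto (fun t => ‖x t‖) (𝓝[<] 0) atTop ∧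
    Tendsto (fun t => x t / (‖x t‖ : ℂ)) (𝓝[<] 0)
      (𝓝 (Complex.exp ((2 * Real.pi * (j : ℕ) / k : ℝ) * Complex.I)))

/-- The separatrix which leaves infinity in the direction `exp (π i (2 j + 1) / k)` lands at the
singular point `b`. -/
def IsOmegaAttached {k : ℕ} (ε : Fin k → ℂ) (j : Fin k) (b : ℂ) : Prop :=
  ∃ x : ℝ → ℂ, (∀ t > 0, HasDerivAt x (pVal ε (x t)) t) ∧ Tendsto x atTop (𝓝 b) ∧
    Tendsto (fun t => ‖x t‖) (𝓝[>] 0) atTop ∧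
    Tendsto (fun t => x t / (‖x t‖ : ℂ)) (𝓝[>] 0)
      (𝓝 (Complex.exp ((Real.pi * (2 * (j : ℕ) + 1) / k : ℝ) * Complex.I)))

/-! ### Sectors -/

/-- A half-line of time with slope `b`, run to `t = -∞`, inside the set `W`, and along which `x`
tends to the singular point `a`. -/
structure IsAlphaRay {k : ℕ} (ε : Fin k → ℂ) (W : Set ℂ) (b : ℝ) (a : ℂ) (c : ℝ → ℂ) : Prop where
  mem : ∀ s, 0 ≤ s → c s ∈ W
  flow : ∀ s, 0 ≤ s → HasDerivAt c (-Complex.exp (b * Complex.I) * pVal ε (c s)) s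
  lim : Tendsto c atTop (𝓝 a)

/-- A half-line of time with slope `b`, run to `t = +∞`, inside the set `W`, and along which `x`
tends to the singular point `a`. -/
structure IsOmegaRay {k : ℕ} (ε : Fin k → ℂ) (W : Set ℂ) (b : ℝ) (a : ℂ) (c : ℝ → ℂ) : Prop where
  mem : ∀ s, 0 ≤ s → c s ∈ W
  flow : ∀ s, 0 ≤ s → HasDerivAt c (Complex.exp (b * Complex.I) * pVal ε (c s)) s
  lim : Tendsto c atTop (𝓝 a)

/-- A covering of the punctured disk `{|x| < R, p_ε(x) ≠ 0}` by `2k` generalized sectors, in the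
pattern given by the pairing `σ`. Indices are cyclic and start from `0`: in counterclockwise order
the sectors are `plus 0`, `minus 0`, `plus 1`, `minus 1`, …, `minus (k - 1)`, and the last one is
also `minus (0 - 1)`. The singular points adherent to `plus j` are `alpha j` and `omega j`; those
adherent to `minus j` are `alpha (j + 1)` and `omega j`. The pieces `interU`, `interL`, `interG`
are the intersection sectors. -/
structure SectorDecomposition (k : ℕ) [NeZero k] (R : ℝ) (σ : Equiv.Perm (Fin k))
    (ε : Fin k → ℂ) where
  plus : Fin k → Set ℂ
  minus : Fin k → Set ℂ
  interU : Fin k → Set ℂ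
  interL : Fin k → Set ℂ
  interG : Fin k → Set ℂ
  isOpen_plus : ∀ j, IsOpen (plus j)
  isOpen_minus : ∀ j, IsOpen (minus j)
  isOpen_interU : ∀ j, IsOpen (interU j)
  isOpen_interL : ∀ j, IsOpen (interL j)
  isOpen_interG : ∀ j, IsOpen (interG j)
  simplyConnected_plus : ∀ j, SimplyConnectedSpace (plus j)
  simplyConnected_minus : ∀ j, SimplyConnectedSpace (minus j)
  isConnected_interU : ∀ j, IsConnected (interU j)
  isConnected_interL : ∀ j, IsConnected (interL j)
  isConnected_interG : ∀ j, IsConnected (interG j)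
  cover : (⋃ j, plus j) ∪ (⋃ j, minus j) = {x | ‖x‖ < R ∧ pVal ε x ≠ 0}
  plus_disjoint : ∀ i j, i ≠ j → Disjoint (plus i) (plus j)
  minus_disjoint : ∀ i j, i ≠ j → Disjoint (minus i) (minus j)
  plus_inter_minus : ∀ i j, plus i ∩ minus j =
    {x | (j = i - 1 ∧ x ∈ interU i) ∨ (j = i ∧ x ∈ interL i) ∨ (j = σ i ∧ x ∈ interG i)}
  disjoint_UL : ∀ j, Disjoint (interU j) (interL j)
  disjoint_UG : ∀ j, Disjoint (interU j) (interG j)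
  disjoint_LG : ∀ j, Disjoint (interL j) (interG j)
  /-- On the circle of radius `3R/4` the sectors are in their standard position. -/
  circle_plus : ∀ j : Fin k, ∀ θ ∈ Icc (2 * Real.pi * (j : ℕ) / k) (Real.pi * (2 * (j : ℕ) + 1) / k),
    ((3 * R / 4 : ℝ) : ℂ) * Complex.exp (θ * Complex.I) ∈ plus j
  circle_minus : ∀ j : Fin k,
    ∀ θ ∈ Icc (Real.pi * (2 * (j : ℕ) + 1) / k) (2 * Real.pi * ((j : ℕ) + 1) / k),
    ((3 * R / 4 : ℝ) : ℂ) * Complex.exp (θ * Complex.I) ∈ minus j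
  circle_interU : ∀ j : Fin k,
    ((3 * R / 4 : ℝ) : ℂ) * Complex.exp ((2 * Real.pi * (j : ℕ) / k : ℝ) * Complex.I) ∈ interU j
  circle_interL : ∀ j : Fin k,
    ((3 * R / 4 : ℝ) : ℂ) * Complex.exp ((Real.pi * (2 * (j : ℕ) + 1) / k : ℝ) * Complex.I)
      ∈ interL j
  alpha : Fin k → ℂ
  omega : Fin k → ℂ
  alpha_zero : ∀ j, pVal ε (alpha j) = 0
  omega_zero : ∀ j, pVal ε (omega j) = 0
  exhaust : ∀ x, pVal ε x = 0 → (∃ j, alpha j = x) ∨ (∃ j, omega j = x)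
  alpha_gate : ∀ j, alpha j = alpha (σ j + 1)
  omega_gate : ∀ j, omega j = omega (σ j)
  /-- The slope, in time, along which a singular point is approached. -/
  slope : ℂ → ℝ
  slope_lt : ∀ x, pVal ε x = 0 → |slope x| < Real.pi / 2
  ray_interU : ∀ j, ∃ c, IsAlphaRay ε (interU j) (slope (alpha j)) (alpha j) c
  ray_interL : ∀ j, ∃ c, IsOmegaRay ε (interL j) (slope (omega j)) (omega j) c
  ray_interG_alpha : ∀ j, ∃ c, IsAlphaRay ε (interG j) (slope (alpha j)) (alpha j) c
  ray_interG_omega : ∀ j, ∃ c, IsOmegaRay ε (interG j) (slope (omega j)) (omega j) c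

/-- An (extended) DS domain over the polydisk of radius `ρ`: a contractible space `carrier` which
is étale over the complement of the discriminant locus (its projection may overlap itself),
contains an unextended DS domain `core`, is invariant under the rescaling by `r ≤ 1`, and carries
a family of sectors with a fixed pairing `σ`, which depends continuously on the point and whose
attachment of the separatrices to the singular points is, over `core`, that of the vector field
`p_ε`. -/
structure DSDomain (k : ℕ) [NeZero k] (R ρ : ℝ) where
  carrier : Type
  [top : TopologicalSpace carrier]
  [t2 : T2Space carrier]
  [contractible : ContractibleSpace carrier]
  proj : carrier → (Fin k → ℂ)
  isLocalHomeomorph : IsLocalHomeomorph proj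
  proj_mem : ∀ u, proj u ∈ sigmaZero k ∩ polydisk k ρ
  radial : ∀ u, ∃ c : ℝ → carrier, ContinuousOn c (Ioc 0 1) ∧ c 1 = u ∧
    ∀ r ∈ Ioc (0 : ℝ) 1, proj (c r) = rescale r (proj u)
  core : Set (Fin k → ℂ)
  isOpenDSDomain_core : IsOpenDSDomain core
  lift : (Fin k → ℂ) → carrier
  continuousOn_lift : ContinuousOn lift (core ∩ polydisk k ρ)
  proj_lift : ∀ ε ∈ core ∩ polydisk k ρ, proj (lift ε) = ε
  σ : Equiv.Perm (Fin k)
  sec : ∀ u, SectorDecomposition k R σ (proj u)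
  isOpen_plus : ∀ j, IsOpen {q : carrier × ℂ | q.2 ∈ (sec q.1).plus j}
  isOpen_minus : ∀ j, IsOpen {q : carrier × ℂ | q.2 ∈ (sec q.1).minus j}
  isOpen_interU : ∀ j, IsOpen {q : carrier × ℂ | q.2 ∈ (sec q.1).interU j}
  isOpen_interL : ∀ j, IsOpen {q : carrier × ℂ | q.2 ∈ (sec q.1).interL j}
  isOpen_interG : ∀ j, IsOpen {q : carrier × ℂ | q.2 ∈ (sec q.1).interG j}
  continuous_alpha : ∀ j, Continuous fun u => (sec u).alpha j
  continuous_omega : ∀ j, Continuous fun u => (sec u).omega j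
  core_alpha : ∀ ε ∈ core ∩ polydisk k ρ, ∀ j, IsAlphaAttached ε j ((sec (lift ε)).alpha j)
  core_omega : ∀ ε ∈ core ∩ polydisk k ρ, ∀ j, IsOmegaAttached ε j ((sec (lift ε)).omega j)

attribute [instance] DSDomain.top

/-- The filter of neighbourhoods of `ε = 0` in a DS domain. -/
def DSDomain.nearZero {k : ℕ} [NeZero k] {R ρ : ℝ} (S : DSDomain k R ρ) : Filter S.carrier :=
  comap S.proj (𝓝 0)

/-- A matrix function on a DS domain is analytic if its entries are locally analytic functions
of `ε`. -/
def DSDomain.IsAnalytic {k n : ℕ} [NeZero k] {R ρ : ℝ} (S : DSDomain k R ρ)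
    (f : S.carrier → Matrix (Fin n) (Fin n) ℂ) : Prop :=
  ∀ u i l, ∃ g : (Fin k → ℂ) → ℂ, AnalyticAt ℂ g (S.proj u) ∧
    ∀ᶠ v in 𝓝 u, f v i l = g (S.proj v)

/-! ### Formal invariants and Stokes data -/

/-- The formal invariants: `coeff m ε i` is the `i`-th diagonal entry of `Λ_m(ε)`, `0 ≤ m ≤ k`. -/
structure FormalInvariants (k n : ℕ) (ρ : ℝ) where
  coeff : Fin (k + 1) → (Fin k → ℂ) → Fin n → ℂ
  analytic : ∀ m i, AnalyticOnNhd ℂ (fun ε => coeff m ε i) (polydisk k ρ)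
  ordered : StrictAnti fun i => (coeff 0 0 i).re

/-- The `i`-th diagonal entry of `Λ_0(ε) + Λ_1(ε) x + ⋯ + Λ_k(ε) x^k`, as a polynomial in `x`. -/
def FormalInvariants.lamPoly {k n : ℕ} {ρ : ℝ} (Λ : FormalInvariants k n ρ) (ε : Fin k → ℂ)
    (i : Fin n) : Polynomial ℂ :=
  ∑ m : Fin (k + 1), Polynomial.C (Λ.coeff m ε i) * Polynomial.X ^ (m : ℕ)

/-- The value at `x` of the `i`-th diagonal entry of `Λ_0(ε) + Λ_1(ε) x + ⋯ + Λ_k(ε) x^k`. -/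
def FormalInvariants.lam {k n : ℕ} {ρ : ℝ} (Λ : FormalInvariants k n ρ) (ε : Fin k → ℂ)
    (i : Fin n) (x : ℂ) : ℂ := (Λ.lamPoly ε i).eval x

/-- `F` is, on `W`, (the diagonal of) a diagonal fundamental matrix solution of the formal normal
form `p_ε(x) y' = (Λ_0(ε) + ⋯ + Λ_k(ε) x^k) y`. -/
def FormalInvariants.IsDiagSolution {k n : ℕ} {ρ : ℝ} (Λ : FormalInvariants k n ρ)
    (ε : Fin k → ℂ) (W : Set ℂ) (F : ℂ → Fin n → ℂ) : Prop :=
  ∀ x ∈ W, ∀ i, F x i ≠ 0 ∧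
    HasDerivAt (fun z => F z i) (Λ.lam ε i x / pVal ε x * F x i) x

/-- Normalized generalized Stokes matrices `CU`, `CL` and the concomitant gate matrices `CG` on a
DS domain, with limits `CU0`, `CL0` at `ε = 0`. -/
structure StokesData {k n : ℕ} [NeZero k] {R ρ : ℝ} (S : DSDomain k R ρ)
    (Λ : FormalInvariants k n ρ) (CU0 CL0 : Fin k → Matrix (Fin n) (Fin n) ℂ) where
  CU : S.carrier → Fin k → Matrix (Fin n) (Fin n) ℂ
  CL : S.carrier → Fin k → Matrix (Fin n) (Fin n) ℂ
  CG : S.carrier → Fin k → Matrix (Fin n) (Fin n) ℂ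
  analytic_CU : ∀ j, S.IsAnalytic fun u => CU u j
  analytic_CL : ∀ j, S.IsAnalytic fun u => CL u j
  tendsto_CU : ∀ j, Tendsto (fun u => CU u j) S.nearZero (𝓝 (CU0 j))
  tendsto_CL : ∀ j, Tendsto (fun u => CL u j) S.nearZero (𝓝 (CL0 j))
  upper : ∀ u j i l, l < i → CU u j i l = 0
  lower : ∀ u j i l, i < l → CL u j i l = 0
  gate_diag : ∀ u j, (CG u j).IsDiag
  diag_CL : ∀ u j i, CL u j i i = 1
  diag_CU : ∀ u j i, j ≠ 0 → CU u j i i = 1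
  diag_CU_zero : ∀ u i, CU u 0 i i =
    Complex.exp (-(2 * Real.pi * Complex.I * Λ.coeff (Fin.last k) (S.proj u) i))
  /-- The diagonal parts of the Stokes matrices, together with the gate matrices, are the
  transition matrices of the formal normal form; this determines the gate matrices. -/
  gate : ∀ u, ∃ Fp Fm : Fin k → ℂ → Fin n → ℂ,
    (∀ j, Λ.IsDiagSolution (S.proj u) ((S.sec u).plus j) (Fp j)) ∧
    (∀ j, Λ.IsDiagSolution (S.proj u) ((S.sec u).minus j) (Fm j)) ∧
    (∀ j, ∀ x ∈ (S.sec u).interU j, ∀ i, Fp j x i = Fm (j - 1) x i * CU u j i i) ∧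
    (∀ j, ∀ x ∈ (S.sec u).interL j, ∀ i, Fm j x i = Fp j x i * CL u j i i) ∧
    (∀ j, ∀ x ∈ (S.sec u).interG j, ∀ i, Fm (S.σ j) x i = Fp j x i * CG u j i i)
  /-- The slopes are small enough for the order of the growth rates to be kept. -/
  slopes : ∀ u x, pVal (S.proj u) x = 0 →
    StrictAnti fun i => (Complex.exp ((S.sec u).slope x * Complex.I) * Λ.lam (S.proj u) i x).re

/-- The eigenvalues of the matrix are pairwise distinct. -/
def HasDistinctEigenvalues {n : ℕ} (M : Matrix (Fin n) (Fin n) ℂ) : Prop := M.charpoly.roots.Nodup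

/-- The product `(CL_k)⁻¹ (CU_k)⁻¹ ⋯ (CL_1)⁻¹ (CU_1)⁻¹`, the monodromy around all the zeroes of
`p_ε`. -/
def totalMonodromy {k n : ℕ} (CU CL : Fin k → Matrix (Fin n) (Fin n) ℂ) :
    Matrix (Fin n) (Fin n) ℂ :=
  ((List.finRange k).reverse.map fun j => (CL j)⁻¹ * (CU j)⁻¹).prod

/-- `M` is the monodromy, along the loop `γ` based at `3R/4`, of the bundle with flat connection
obtained by gluing trivial connections on the sectors by the (generalized) Stokes matrices and
the gate matrices. `Vp j`, `Vm j` are the coordinates, in the trivializations over the sectors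
`plus j`, `minus j`, of a flat frame of the bundle along `γ`. -/
def StokesData.IsMonodromy {k n : ℕ} [NeZero k] {R ρ : ℝ} {S : DSDomain k R ρ}
    {Λ : FormalInvariants k n ρ} {CU0 CL0 : Fin k → Matrix (Fin n) (Fin n) ℂ}
    (C : StokesData S Λ CU0 CL0) (u : S.carrier) (γ : ℝ → ℂ) (M : Matrix (Fin n) (Fin n) ℂ) :
    Prop :=
  ∃ Vp Vm : Fin k → ℝ → Matrix (Fin n) (Fin n) ℂ,
    (∀ j, ∀ t ∈ Icc (0 : ℝ) 1, γ t ∈ (S.sec u).plus j →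
      ∀ᶠ s in 𝓝[Icc 0 1] t, Vp j s = Vp j t) ∧
    (∀ j, ∀ t ∈ Icc (0 : ℝ) 1, γ t ∈ (S.sec u).minus j →
      ∀ᶠ s in 𝓝[Icc 0 1] t, Vm j s = Vm j t) ∧
    (∀ j, ∀ t ∈ Icc (0 : ℝ) 1, γ t ∈ (S.sec u).interU j → Vm (j - 1) t = C.CU u j * Vp j t) ∧
    (∀ j, ∀ t ∈ Icc (0 : ℝ) 1, γ t ∈ (S.sec u).interL j → Vp j t = C.CL u j * Vm j t) ∧
    (∀ j, ∀ t ∈ Icc (0 : ℝ) 1, γ t ∈ (S.sec u).interG j → Vp j t = C.CG u j * Vm (S.σ j) t) ∧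
    Vm (0 - 1) 0 = 1 ∧ Vm (0 - 1) 1 = M

/-- `γ`, on `[0,1]`, is a loop based at `3R/4` in the disk of radius `R` punctured at the zeroes
of `p_ε`. -/
structure IsLoop {k : ℕ} (R : ℝ) (ε : Fin k → ℂ) (γ : ℝ → ℂ) : Prop where
  cont : ContinuousOn γ (Icc 0 1)
  start : γ 0 = ((3 * R / 4 : ℝ) : ℂ)
  finish : γ 1 = ((3 * R / 4 : ℝ) : ℂ)
  mem : ∀ t ∈ Icc (0 : ℝ) 1, ‖γ t‖ < R ∧ pVal ε (γ t) ≠ 0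

/-- The Compatibility Condition for Stokes data given on a family of DS domains, with the
trivialization `Γ` of the cocycle: whenever `u`, `u'` are points, of two DS domains or of the same
one, over the same `ε`, the monodromy representations (based at `3R/4`) defined by the Stokes data
at `u` and at `u'` are conjugate by `G = Γ(u)⁻¹ Γ(u')`. -/
structure CompatibilityCondition {k n : ℕ} [NeZero k] {R ρ : ℝ} {ι : Type*}
    {Λ : FormalInvariants k n ρ} {CU0 CL0 : Fin k → Matrix (Fin n) (Fin n) ℂ}
    (S : ι → DSDomain k R ρ) (C : ∀ s, StokesData (S s) Λ CU0 CL0)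
    (Γ : ∀ s, (S s).carrier → Matrix (Fin n) (Fin n) ℂ) : Prop where
  analytic : ∀ s, (S s).IsAnalytic (Γ s)
  invertible : ∀ s u, IsUnit (Γ s u).det
  tendsto_one : ∀ s, Tendsto (Γ s) (S s).nearZero (𝓝 1)
  conj : ∀ s s' (u : (S s).carrier) (u' : (S s').carrier), (S s).proj u = (S s').proj u' →
    ∀ γ, IsLoop R ((S s).proj u) γ → ∀ M', (C s').IsMonodromy u' γ M' →
      (C s).IsMonodromy u γ (((Γ s u)⁻¹ * Γ s' u') * M' * ((Γ s u)⁻¹ * Γ s' u')⁻¹)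

/-! ### Rational systems -/

/-- The coefficients of a system
`y' = ((A_0 + A_1 x + ⋯ + A_k x^k) / p_ε(x) + Ahat / (x - R)) y`. -/
structure RationalSystem (k n : ℕ) where
  A : Fin (k + 1) → Matrix (Fin n) (Fin n) ℂ
  Ahat : Matrix (Fin n) (Fin n) ℂ

namespace RationalSystem

/-- The matrix of the system at the point `x`. -/
def B {k n : ℕ} (sys : RationalSystem k n) (R : ℝ) (ε : Fin k → ℂ) (x : ℂ) :
    Matrix (Fin n) (Fin n) ℂ :=
  (pVal ε x)⁻¹ • (∑ m : Fin (k + 1), x ^ (m : ℕ) • sys.A m) + (x - R)⁻¹ • sys.Ahat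

/-- `X` is, at the point `x`, an invertible matrix solution of the system. -/
def IsSolutionAt {k n : ℕ} (sys : RationalSystem k n) (R : ℝ) (ε : Fin k → ℂ)
    (X : ℂ → Matrix (Fin n) (Fin n) ℂ) (x : ℂ) : Prop :=
  IsUnit (X x).det ∧ ∀ i l, HasDerivAt (fun z => X z i l) ((sys.B R ε x * X x) i l) x

/-- The matrix `A_0 + A_1 x + ⋯ + A_k x^k` of polynomials in `x`. -/
def polyA {k n : ℕ} (sys : RationalSystem k n) : Matrix (Fin n) (Fin n) (Polynomial ℂ) :=
  fun i l => ∑ m : Fin (k + 1), Polynomial.C (sys.A m i l) * Polynomial.X ^ (m : ℕ)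

/-- The system has the formal normal form `p_ε(x) y' = (Λ_0(ε) + ⋯ + Λ_k(ε) x^k) y` at the zeroes
of `p_ε`: the eigenvalues of `A(x)` are the diagonal entries of `Λ(x)` modulo `p_ε(x)`. When the
zeroes are simple, this says that the residues have the right eigenvalues; at `ε = 0` (and when
`Λ_0` has distinct eigenvalues) it is the usual formal normal form of an irregular singularity. -/
def HasFormalNormalForm {k n : ℕ} {ρ : ℝ} (sys : RationalSystem k n) (Λ : FormalInvariants k n ρ)
    (ε : Fin k → ℂ) : Prop :=
  ∀ c : ℕ, pPoly ε ∣
    (sys.polyA.charpoly - ∏ i, (Polynomial.X - Polynomial.C (Λ.lamPoly ε i))).coeff c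

/-- The entry `(i, l)` of the polynomial matrix `p_ε(x) (x - R) B(x)`. -/
def numerator {k n : ℕ} (sys : RationalSystem k n) (R : ℝ) (ε : Fin k → ℂ) (i l : Fin n) :
    Polynomial ℂ :=
  (Polynomial.X - Polynomial.C (R : ℂ)) * sys.polyA i l + pPoly ε * Polynomial.C (sys.Ahat i l)

/-- `Y` is the analytic continuation along the path `γ`, on `[0,1]`, of a matrix solution. -/
def IsContinuation {k n : ℕ} (sys : RationalSystem k n) (R : ℝ) (ε : Fin k → ℂ) (γ : ℝ → ℂ)
    (Y : ℝ → Matrix (Fin n) (Fin n) ℂ) : Prop :=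
  ∀ t ∈ Icc (0 : ℝ) 1, ∃ Z : ℂ → Matrix (Fin n) (Fin n) ℂ,
    (∀ᶠ z in 𝓝 (γ t), sys.IsSolutionAt R ε Z z) ∧ ∀ᶠ s in 𝓝[Icc 0 1] t, Y s = Z (γ s)

end RationalSystem

/-- The loop around `R` and all the zeroes of `p_ε` (hence around infinity), based at `3R/4`: up
along a vertical segment, once counterclockwise along a circle centered at `0`, and back. -/
def loopInfty (R : ℝ) (t : ℝ) : ℂ :=
  if t ≤ 1 / 3 then 3 * R / 4 + 2 * R * Complex.I * (3 * t)
  else if t ≤ 2 / 3 then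
    (3 * R / 4 + 2 * R * Complex.I) * Complex.exp (2 * Real.pi * Complex.I * (3 * t - 1))
  else 3 * R / 4 + 2 * R * Complex.I * (3 - 3 * t)

/-- The monodromy along `loopInfty` of the matrix solution `X` (given near `3R/4`) is `M`. -/
def RationalSystem.HasMonodromyInfty {k n : ℕ} (sys : RationalSystem k n) (R : ℝ) (ε : Fin k → ℂ)
    (X : ℂ → Matrix (Fin n) (Fin n) ℂ) (M : Matrix (Fin n) (Fin n) ℂ) : Prop :=
  ∃ Y : ℝ → Matrix (Fin n) (Fin n) ℂ, sys.IsContinuation R ε (loopInfty R) Y ∧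
    Y 0 = X ((3 * R / 4 : ℝ) : ℂ) ∧ Y 1 = X ((3 * R / 4 : ℝ) : ℂ) * M

/-- The choice of `n - 1` monomials `x^m` in off-diagonal entries `(i, l)`, used for normalizing
a system under conjugation by diagonal matrices. -/
structure NormalizingMonomials (k n : ℕ) where
  row : Fin (n - 1) → Fin n
  col : Fin (n - 1) → Fin n
  expo : Fin (n - 1) → ℕ
  offDiag : ∀ q, row q ≠ col q
  expo_mem : ∀ q, expo q ∈ Finset.Icc 1 (k + 1)
  /-- Only the scalar diagonal matrices leave the coefficients of these monomials unchanged. -/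
  suitable : ∀ d : Fin n → ℂ, (∀ i, d i ≠ 0) → (∀ q, d (row q) = d (col q)) → ∀ i l, d i = d l

/-- The system is normalized: `A_0` is diagonal, and the chosen coefficients of the numerator
are `1`. -/
def RationalSystem.IsNormalized {k n : ℕ} (sys : RationalSystem k n) (R : ℝ) (ε : Fin k → ℂ)
    (T : NormalizingMonomials k n) : Prop :=
  (sys.A 0).IsDiag ∧ ∀ q, (sys.numerator R ε (T.row q) (T.col q)).coeff (T.expo q) = 1

/-! ### Realizations -/

/-- The circular sector `{0 < |x| < R, θ₁ < arg x < θ₂}`. -/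
def circSector (R θ₁ θ₂ : ℝ) : Set ℂ :=
  {x | ∃ r ∈ Ioo 0 R, ∃ θ ∈ Ioo θ₁ θ₂, x = (r : ℂ) * Complex.exp (θ * Complex.I)}

/-- The sectors at `ε = 0`, widened by the angle `η`. -/
def plusZero (k : ℕ) (R η : ℝ) (j : Fin k) : Set ℂ :=
  circSector R (2 * Real.pi * (j : ℕ) / k - η) (Real.pi * (2 * (j : ℕ) + 1) / k + η)

/-- The sectors at `ε = 0`, widened by the angle `η`. -/
def minusZero (k : ℕ) (R η : ℝ) (j : Fin k) : Set ℂ :=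
  circSector R (Real.pi * (2 * (j : ℕ) + 1) / k - η) (2 * Real.pi * ((j : ℕ) + 1) / k + η)

/-- The intersection sectors at `ε = 0`. -/
def interUZero (k : ℕ) (R η : ℝ) (j : Fin k) : Set ℂ :=
  circSector R (2 * Real.pi * (j : ℕ) / k - η) (2 * Real.pi * (j : ℕ) / k + η)

/-- The intersection sectors at `ε = 0`. -/
def interLZero (k : ℕ) (R η : ℝ) (j : Fin k) : Set ℂ :=
  circSector R (Real.pi * (2 * (j : ℕ) + 1) / k - η) (Real.pi * (2 * (j : ℕ) + 1) / k + η)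

/-- A normalized realization at `ε = 0`: a normalized rational system with leading term `Λ_0(0)`
at the irregular singular point `0`, formal normal form given by `Λ(0)`, Stokes matrices `CU`,
`CL` (for solutions `Xp j`, `Xm j` on the sectors that are asymptotic to the diagonal solutions
`Fp j`, `Fm j` of the formal normal form), and monodromy `Minf` around infinity. -/
structure IsRealizationAtZero {k n : ℕ} [NeZero k] {ρ : ℝ} (R : ℝ) (Λ : FormalInvariants k n ρ)
    (CU CL : Fin k → Matrix (Fin n) (Fin n) ℂ) (Minf : Matrix (Fin n) (Fin n) ℂ)
    (T : NormalizingMonomials k n) (sys : RationalSystem k n) : Prop where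
  leading : sys.A 0 = Matrix.diagonal (Λ.coeff 0 0)
  formal : sys.HasFormalNormalForm Λ 0
  normalized : sys.IsNormalized R 0 T
  stokes : ∃ η ∈ Ioo 0 (Real.pi / (2 * k)), ∃ Xp Xm : Fin k → ℂ → Matrix (Fin n) (Fin n) ℂ,
    ∃ Fp Fm : Fin k → ℂ → Fin n → ℂ, ∃ K : Fin n → ℂ, (∀ i, K i ≠ 0) ∧
    (∀ j, ∀ x ∈ plusZero k R η j, sys.IsSolutionAt R 0 (Xp j) x) ∧
    (∀ j, ∀ x ∈ minusZero k R η j, sys.IsSolutionAt R 0 (Xm j) x) ∧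
    (∀ j, Λ.IsDiagSolution 0 (plusZero k R η j) (Fp j)) ∧
    (∀ j, Λ.IsDiagSolution 0 (minusZero k R η j) (Fm j)) ∧
    (∀ j, ∀ x ∈ interUZero k R η j, ∀ i, Fp j x i = Fm (j - 1) x i * CU j i i) ∧
    (∀ j, ∀ x ∈ interLZero k R η j, ∀ i, Fm j x i = Fp j x i * CL j i i) ∧
    (∀ j, Tendsto (fun x => Xp j x * (Matrix.diagonal (Fp j x))⁻¹) (𝓝[plusZero k R η j] 0)
      (𝓝 (Matrix.diagonal K))) ∧
    (∀ j, Tendsto (fun x => Xm j x * (Matrix.diagonal (Fm j x))⁻¹) (𝓝[minusZero k R η j] 0)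
      (𝓝 (Matrix.diagonal K))) ∧
    (∀ j, ∀ x ∈ interUZero k R η j, Xp j x = Xm (j - 1) x * CU j) ∧
    (∀ j, ∀ x ∈ interLZero k R η j, Xm j x = Xp j x * CL j) ∧
    sys.HasMonodromyInfty R 0 (Xm (0 - 1)) Minf

/-- The solutions `X` on a sector `W` are adapted to the flags of growth rates at the two singular
points `a` (of `α`-type) and `b` (of `ω`-type) adherent to it: the `i`-th column grows at most as
`exp (λ_i(a) t)` when `t → -∞` and at most as `exp (λ_i(b) t)` when `t → +∞` along the lines of
the prescribed slopes. -/
def IsAdapted {k n : ℕ} {ρ : ℝ} (Λ : FormalInvariants k n ρ) (ε : Fin k → ℂ) (slope : ℂ → ℝ)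
    (W : Set ℂ) (a b : ℂ) (X : ℂ → Matrix (Fin n) (Fin n) ℂ) : Prop :=
  (∀ c, IsAlphaRay ε W (slope a) a c → ∀ i l, (fun s => X (c s) l i) =O[atTop]
    fun s : ℝ => Real.exp (-s * (Complex.exp (slope a * Complex.I) * Λ.lam ε i a).re)) ∧
  (∀ c, IsOmegaRay ε W (slope b) b c → ∀ i l, (fun s => X (c s) l i) =O[atTop]
    fun s : ℝ => Real.exp (s * (Complex.exp (slope b * Complex.I) * Λ.lam ε i b).re))

/-- The system `sys` at the point `u` of a DS domain has the generalized Stokes matrices and gate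
matrices given by `C`, and, in the basis of solutions over the last sector, the monodromy `M`
around infinity. -/
def StokesData.IsRealizedBy {k n : ℕ} [NeZero k] {R ρ : ℝ} {S : DSDomain k R ρ}
    {Λ : FormalInvariants k n ρ} {CU0 CL0 : Fin k → Matrix (Fin n) (Fin n) ℂ}
    (C : StokesData S Λ CU0 CL0) (u : S.carrier) (sys : RationalSystem k n)
    (M : Matrix (Fin n) (Fin n) ℂ) : Prop :=
  ∃ Xp Xm : Fin k → ℂ → Matrix (Fin n) (Fin n) ℂ,
    (∀ j, ∀ x ∈ (S.sec u).plus j, sys.IsSolutionAt R (S.proj u) (Xp j) x) ∧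
    (∀ j, ∀ x ∈ (S.sec u).minus j, sys.IsSolutionAt R (S.proj u) (Xm j) x) ∧
    (∀ j, IsAdapted Λ (S.proj u) (S.sec u).slope ((S.sec u).plus j)
      ((S.sec u).alpha j) ((S.sec u).omega j) (Xp j)) ∧
    (∀ j, IsAdapted Λ (S.proj u) (S.sec u).slope ((S.sec u).minus j)
      ((S.sec u).alpha (j + 1)) ((S.sec u).omega j) (Xm j)) ∧
    (∀ j, ∀ x ∈ (S.sec u).interU j, Xp j x = Xm (j - 1) x * C.CU u j) ∧
    (∀ j, ∀ x ∈ (S.sec u).interL j, Xm j x = Xp j x * C.CL u j) ∧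
    (∀ j, ∀ x ∈ (S.sec u).interG j, Xm (S.σ j) x = Xp j x * C.CG u j) ∧
    sys.HasMonodromyInfty R (S.proj u) (Xm (0 - 1)) M

/-- A normalized realization over the Riemann sphere, on a DS domain, of the formal invariants
`Λ` and the Stokes data `C`: a family of rational systems, depending analytically on the point of
the DS domain, with limit `E0` at `ε = 0`, and with monodromy `Γ(u)⁻¹ Minf Γ(u)` around
infinity. -/
structure IsNormalizedRealization {k n : ℕ} [NeZero k] {R ρ : ℝ} {S : DSDomain k R ρ}
    {Λ : FormalInvariants k n ρ} {CU0 CL0 : Fin k → Matrix (Fin n) (Fin n) ℂ}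
    (C : StokesData S Λ CU0 CL0) (Γ : S.carrier → Matrix (Fin n) (Fin n) ℂ)
    (Minf : Matrix (Fin n) (Fin n) ℂ) (T : NormalizingMonomials k n) (E0 : RationalSystem k n)
    (E : S.carrier → RationalSystem k n) : Prop where
  analytic_A : ∀ m, S.IsAnalytic fun u => (E u).A m
  analytic_Ahat : S.IsAnalytic fun u => (E u).Ahat
  tendsto_A : ∀ m, Tendsto (fun u => (E u).A m) S.nearZero (𝓝 (E0.A m))
  tendsto_Ahat : Tendsto (fun u => (E u).Ahat) S.nearZero (𝓝 E0.Ahat)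
  formal : ∀ u, (E u).HasFormalNormalForm Λ (S.proj u)
  normalized : ∀ u, (E u).IsNormalized R (S.proj u) T
  realized : ∀ u, C.IsRealizedBy u (E u) ((Γ u)⁻¹ * Minf * Γ u)

end UnfoldedSystems

end

/-!
Two normalized realizations with the same Stokes data are compared by a gauge transformation, which
is shown to be constant, then diagonal, then scalar.

Let `u`, `u'` lie over the same `ε`, and let `X`, `X'` be the solutions of the two systems
`y' = B y`, `y' = B' y` over the sectors. With `G = Γ(u)⁻¹ Γ(u')`, the matrix `H = X G X'⁻¹`,
defined near `3R/4`, satisfies the linear equation `H' = B H - H B'`. Since a frame of the bundle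
glued by the Stokes matrices is the same thing as a continuation of a solution, the conjugacy of the
monodromy representations says exactly that `H` does not change along loops in the punctured disk,
so that it is defined there (`exists_gauge_punctured_disk`); since the monodromies around infinity
are conjugate by `G` too, it extends to the complement of `R` and the zeroes of `p_ε`
(`exists_extension_of_loopInfty`). There the two systems have simple poles, also at infinity.
A single-valued solution of a Fuchsian equation `z h' = T(z) h` is a power `z ^ m` times a
holomorphic function whose value at `0` is an eigenvector of `T(0)` for `m`
(`fuchsian_order`). Hence `H` has limits at all the singular points, and is constant by Liouville's
theorem, if none of the operators `N ↦ Res(B) N - N Res(B')` has a nonzero integer as eigenvalue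
(`fuchsian_const`). A constant `H` conjugates all the coefficients; it is diagonal because `A_0` and
`A_0'` are diagonal matrices without common entries in different positions when `ε` is small, and it
is scalar by the choice of the normalizing monomials (`RationalSystem.IsNormalized.eq_of_gauge`).

The nonresonance is not available at `u` itself, but it is enough to have it close to one point of
the ray `r ↦ r · ε`: along the lift of the ray the coefficients of both families are real analytic
functions of `r`, so that they agree up to `r = 1` once they agree close to one value
(`DSDomain.IsAnalytic.eq_of_eventually_eq`).

* At `R` and at infinity, nonresonance holds for small `r` because it holds for the limit `E0` and
  is an open condition. For `E0`, the monodromy around infinity is `Minf` and the monodromy around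
  `R` is conjugate to `Minf M(0)⁻¹`; each eigenvalue of these is `exp (2πiμ)` for an eigenvalue `μ`
  of the residue (`exists_eigenvector_of_monodromy`), and they are distinct
  (`IsRealizationAtZero.isNonresonant`).
* At the zeroes `r a` of `p_{rε}`, the eigenvalues of the residues are the
  `λ_i(r a) / (r ^ k p_ε'(a))`. A resonance is a zero of the real analytic function
  `λ_i(r a) - λ_l(r a) - m r ^ k p_ε'(a)`, which for `i ≠ l` does not vanish at `r = 0`, so
  resonances are isolated in `r > 0` (`FormalInvariants.eventually_isNonresonantAt`).

Monodromy around infinity and around `R` is computed in the plane of `w = log x`, where solutions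
are developed over a simply connected domain (`logDomain`, `exists_logDevelopment`).
-/

namespace UnfoldedSystems

/-! ### Linear differential equations in the complex domain -/

section LinearODE

variable {V : Type*} [NormedAddCommGroup V] [NormedSpace ℂ V]

/-- Gronwall's inequality on the segments starting from a zero of the solution. -/
theorem eventually_eq_zero_of_linearODE {L : ℂ → V →L[ℂ] V} {x₀ : ℂ} {f : ℂ → V}
    (hL : ContinuousAt L x₀) (hf : ∀ᶠ x in 𝓝 x₀, HasDerivAt f (L x (f x)) x) (h0 : f x₀ = 0) :
    ∀ᶠ x in 𝓝 x₀, f x = 0 := by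
  have hb : ∀ᶠ x in 𝓝 x₀, ‖L x‖ < ‖L x₀‖ + 1 :=
    hL.norm.eventually (gt_mem_nhds (by linarith))
  obtain ⟨δ, hδ, hball⟩ := Metric.eventually_nhds_iff_ball.1 (hf.and hb)
  refine Metric.eventually_nhds_iff_ball.2 ⟨δ, hδ, fun y hy => ?_⟩
  have hmem : ∀ t ∈ Icc (0 : ℝ) 1, x₀ + (t : ℂ) * (y - x₀) ∈ Metric.ball x₀ δ := by
    intro t ht
    rw [mem_ball_iff_norm] at hy ⊢
    rw [add_sub_cancel_left, norm_mul, Complex.norm_real, Real.norm_of_nonneg ht.1]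
    exact (mul_le_of_le_one_left (norm_nonneg _) ht.2).trans_lt hy
  have hd : ∀ t ∈ Icc (0 : ℝ) 1, HasDerivAt (fun t : ℝ => f (x₀ + (t : ℂ) * (y - x₀)))
      ((y - x₀) • L (x₀ + (t : ℂ) * (y - x₀)) (f (x₀ + (t : ℂ) * (y - x₀)))) t := by
    intro t ht
    have h1 : HasDerivAt (fun t : ℝ => x₀ + (t : ℂ) * (y - x₀)) (y - x₀) t := by
      simpa using ((Complex.ofRealCLM.hasDerivAt (x := t)).mul_const (y - x₀)).const_add x₀
    exact (hball _ (hmem t ht)).1.scomp t h1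
  have := eq_zero_of_abs_deriv_le_mul_abs_self_of_eq_zero_right
    (K := ‖y - x₀‖ * (‖L x₀‖ + 1)) (a := 0) (b := 1)
    (fun t ht => (hd t ht).continuousAt.continuousWithinAt)
    (fun t ht => (hd t (Ico_subset_Icc_self ht)).hasDerivWithinAt) (by simpa using h0)
    (fun t ht => by
      rw [norm_smul, mul_assoc]
      gcongr
      refine ((L _).le_opNorm _).trans ?_
      gcongr
      exact (hball _ (hmem t (Ico_subset_Icc_self ht))).2.le) 1 (by simp)
  simpa using this

/-- Two holomorphic solutions of a linear differential equation on a connected open set which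
agree at one point are equal. -/
theorem linearODE_unique [CompleteSpace V] {L : ℂ → V →L[ℂ] V} {U : Set ℂ} (hU : IsOpen U)
    (hc : IsPreconnected U) (hL : ContinuousOn L U) {f g : ℂ → V}
    (hf : ∀ x ∈ U, HasDerivAt f (L x (f x)) x) (hg : ∀ x ∈ U, HasDerivAt g (L x (g x)) x)
    {x₀ : ℂ} (hx₀ : x₀ ∈ U) (h : f x₀ = g x₀) : EqOn f g U := by
  have ha : ∀ {f : ℂ → V}, (∀ x ∈ U, HasDerivAt f (L x (f x)) x) → AnalyticOnNhd ℂ f U :=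
    fun hf => DifferentiableOn.analyticOnNhd
      (fun x hx => (hf x hx).differentiableAt.differentiableWithinAt) hU
  refine (ha hf).eqOn_of_preconnected_of_eventuallyEq (ha hg) hc hx₀ ?_
  have := eventually_eq_zero_of_linearODE (f := fun x => f x - g x)
    (hL.continuousAt (hU.mem_nhds hx₀))
    (by
      filter_upwards [hU.mem_nhds hx₀] with x hx
      simpa using (hf x hx).fun_sub (hg x hx)) (by simp [h])
  filter_upwards [this] with x hx using sub_eq_zero.1 hx

/-- One Picard increment on a star-shaped set: integrating an `n`-th order bound once more. -/
theorem picard_step_bound {L : ℂ → V →L[ℂ] V} {K : Set ℂ} {x₀ : ℂ} {M C : ℝ}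
    (hK : ∀ y ∈ K, ∀ t ∈ Icc (0 : ℝ) 1, x₀ + (t : ℂ) * (y - x₀) ∈ K) (hM : ∀ y ∈ K, ‖L y‖ ≤ M)
    (n : ℕ) {g G : ℂ → V} (hg : ∀ y ∈ K, ‖g y‖ ≤ C * (M * ‖y - x₀‖) ^ n / n.factorial)
    (hG : ∀ y ∈ K, HasDerivAt G (L y (g y)) y) (hG0 : G x₀ = 0) :
    ∀ y ∈ K, ‖G y‖ ≤ C * (M * ‖y - x₀‖) ^ (n + 1) / (n + 1).factorial := by
  intro y hy
  have hd : ∀ t ∈ Icc (0 : ℝ) 1, HasDerivAt (fun t : ℝ => G (x₀ + (t : ℂ) * (y - x₀)))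
      ((y - x₀) • L (x₀ + (t : ℂ) * (y - x₀)) (g (x₀ + (t : ℂ) * (y - x₀)))) t := by
    intro t ht
    have h1 : HasDerivAt (fun t : ℝ => x₀ + (t : ℂ) * (y - x₀)) (y - x₀) t := by
      simpa using ((Complex.ofRealCLM.hasDerivAt (x := t)).mul_const (y - x₀)).const_add x₀
    exact (hG _ (hK y hy t ht)).scomp t h1
  have hB : ∀ t : ℝ, HasDerivAt
      (fun t : ℝ => C * (M * ‖y - x₀‖) ^ (n + 1) / (n + 1).factorial * t ^ (n + 1))
      (C * (M * ‖y - x₀‖) ^ (n + 1) / (n + 1).factorial * ((n + 1 : ℕ) * t ^ n)) t :=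
    fun t => (hasDerivAt_pow (n + 1) t).const_mul _
  have := image_norm_le_of_norm_deriv_right_le_deriv_boundary (a := 0) (b := 1)
    (fun t ht => (hd t ht).continuousAt.continuousWithinAt)
    (fun t ht => (hd t (Ico_subset_Icc_self ht)).hasDerivWithinAt) (by simp [hG0]) hB
    (fun t ht => by
      have ht' := Ico_subset_Icc_self ht
      have hz := hK y hy t ht'
      have hM0 : 0 ≤ M := (norm_nonneg _).trans (hM _ hz)
      have h2 := hg _ hz
      rw [add_sub_cancel_left, norm_mul, Complex.norm_real, Real.norm_of_nonneg ht'.1] at h2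
      calc _ ≤ ‖y - x₀‖ * (M * (C * (M * (t * ‖y - x₀‖)) ^ n / n.factorial)) := by
            rw [norm_smul]
            gcongr
            refine ((L _).le_opNorm _).trans ?_
            gcongr
            exact hM _ hz
        _ = _ := by
            rw [Nat.factorial_succ]
            push_cast
            field_simp
            ring) (x := 1) (by simp)
  simpa using this

/-- **Existence** of holomorphic solutions of linear differential equations on convex open sets. -/
theorem linearODE_exists [CompleteSpace V] {L : ℂ → V →L[ℂ] V} {U : Set ℂ} (hU : IsOpen U)
    (hc : Convex ℝ U) (hL : DifferentiableOn ℂ L U) {x₀ : ℂ} (hx₀ : x₀ ∈ U) (v₀ : V) :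
    ∃ f : ℂ → V, f x₀ = v₀ ∧ ∀ x ∈ U, HasDerivAt f (L x (f x)) x := by
  -- the Picard increments
  have step : ∀ g : {g : ℂ → V // DifferentiableOn ℂ g U},
      ∃ G : {g : ℂ → V // DifferentiableOn ℂ g U},
        G.1 x₀ = 0 ∧ ∀ x ∈ U, HasDerivAt G.1 (L x (g.1 x)) x := by
    intro g
    obtain ⟨G, hG⟩ := hc.exists_forall_hasDerivWithinAt (hL.clm_apply g.2)
    have hG' : ∀ x ∈ U, HasDerivAt G (L x (g.1 x)) x :=
      fun x hx => (hG x hx).hasDerivAt (hU.mem_nhds hx)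
    refine ⟨⟨fun x => G x - G x₀, fun x hx =>
      ((hG' x hx).sub_const _).differentiableAt.differentiableWithinAt⟩, by simp,
      fun x hx => (hG' x hx).sub_const _⟩
  choose P hP0 hP using step
  let g : ℕ → {g : ℂ → V // DifferentiableOn ℂ g U} :=
    fun n => Nat.rec ⟨fun _ => v₀, differentiableOn_const _⟩ (fun _ h => P h) n
  let g' : ℕ → ℂ → V := fun n => Nat.casesOn n (fun _ => 0) (fun m x => L x ((g m).1 x))
  have hg : ∀ n, ∀ x ∈ U, HasDerivAt (g n).1 (g' n x) x := by
    rintro (_ | n) x hx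
    · exact hasDerivAt_const x v₀
    · exact hP (g n) x hx
  have hval : ∀ n, (g (n + 1)).1 x₀ = 0 := fun n => hP0 (g n)
  have key : ∀ x ∈ U, HasDerivAt (fun x => ∑' n, (g n).1 x) (∑' n, g' n x) x ∧
      Summable (fun n => (g n).1 x) := by
    intro x hx
    obtain ⟨δ, hδ, hball⟩ := Metric.nhds_basis_closedBall.mem_iff.1 (hU.mem_nhds hx)
    let K : Set ℂ := (fun q : ℝ × ℂ => x₀ + (q.1 : ℂ) * (q.2 - x₀)) ''
      (Icc (0 : ℝ) 1 ×ˢ Metric.closedBall x δ)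
    have hKc : IsCompact K := (isCompact_Icc.prod (isCompact_closedBall x δ)).image (by fun_prop)
    have hKU : K ⊆ U := by
      rintro _ ⟨⟨t, y⟩, ⟨ht, hy⟩, rfl⟩
      have := hc hx₀ (hball hy) (sub_nonneg.2 ht.2) ht.1 (by ring)
      convert this using 1
      simp only [Complex.real_smul]
      push_cast
      ring
    have hKs : ∀ y ∈ K, ∀ t ∈ Icc (0 : ℝ) 1, x₀ + (t : ℂ) * (y - x₀) ∈ K := by
      rintro _ ⟨⟨s, y⟩, ⟨hs, hy⟩, rfl⟩ t ht
      refine ⟨⟨t * s, y⟩, ⟨⟨mul_nonneg ht.1 hs.1, mul_le_one₀ ht.2 hs.1 hs.2⟩, hy⟩, ?_⟩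
      push_cast
      ring
    have hballK : Metric.closedBall x δ ⊆ K := fun y hy =>
      ⟨⟨1, y⟩, ⟨by simp, hy⟩, by simp⟩
    obtain ⟨M, hM⟩ := hKc.exists_bound_of_continuousOn (hL.continuousOn.mono hKU)
    have hM0 : 0 ≤ M := (norm_nonneg _).trans (hM x (hballK (Metric.mem_closedBall_self hδ.le)))
    have hbound : ∀ n, ∀ y ∈ K, ‖(g n).1 y‖ ≤ ‖v₀‖ * (M * ‖y - x₀‖) ^ n / n.factorial := by
      intro n
      induction n with
      | zero => intro y _; simp [g]
      | succ n ih =>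
        exact picard_step_bound hKs hM n ih (fun y hy => hP (g n) y (hKU hy)) (hP0 (g n))
    obtain ⟨D, hD⟩ := hKc.exists_bound_of_continuousOn (f := fun y => y - x₀)
      (by fun_prop)
    have hbound' : ∀ n, ∀ y ∈ K, ‖(g n).1 y‖ ≤ ‖v₀‖ * ((M * D) ^ n / n.factorial) := by
      intro n y hy
      refine (hbound n y hy).trans ?_
      rw [mul_div_assoc]
      gcongr
      exact hD y hy
    let b : ℕ → ℝ := fun n => Nat.casesOn n 0 fun m => M * (‖v₀‖ * ((M * D) ^ m / m.factorial))
    have hb : Summable b := by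
      rw [← summable_nat_add_iff 1]
      exact ((Real.summable_pow_div_factorial (M * D)).mul_left _).mul_left _
    have hxK : x ∈ K := hballK (Metric.mem_closedBall_self hδ.le)
    have hsum : Summable (fun n => (g n).1 x) :=
      .of_norm_bounded ((Real.summable_pow_div_factorial (M * D)).mul_left ‖v₀‖)
        (fun n => hbound' n x hxK)
    refine ⟨?_, hsum⟩
    refine hasDerivAt_tsum_of_isPreconnected (t := Metric.ball x δ) (y₀ := x) hb Metric.isOpen_ball
      (convex_ball x δ).isPreconnected
      (fun n y hy => hg n y (hball (Metric.ball_subset_closedBall hy))) ?_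
      (Metric.mem_ball_self hδ) hsum (Metric.mem_ball_self hδ)
    rintro (_ | n) y hy
    · simp [g', b]
    · have hyK := hballK (Metric.ball_subset_closedBall hy)
      refine ((L y).le_opNorm _).trans ?_
      exact mul_le_mul (hM y hyK) (hbound' n y hyK) (norm_nonneg _) hM0
  refine ⟨fun x => ∑' n, (g n).1 x, ?_, fun x hx => ?_⟩
  · change ∑' n, (g n).1 x₀ = v₀
    rw [tsum_eq_single 0 (fun n hn => by
      obtain ⟨m, rfl⟩ := Nat.exists_eq_succ_of_ne_zero hn
      exact hval m)]
    rfl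
  · obtain ⟨h1, h2⟩ := key x hx
    convert h1 using 1
    have hs : Summable fun n => g' n x := by
      rw [← summable_nat_add_iff 1]
      exact (L x).summable h2
    rw [(L x).map_tsum h2, hs.tsum_eq_zero_add]
    simp [g']

end LinearODE

/-! ### Fuchsian singular points -/

section Fuchsian

variable {V : Type*} [NormedAddCommGroup V] [NormedSpace ℂ V]

/-- Gronwall's inequality along radii: solutions have at most polynomial growth at a Fuchsian
singularity. -/
theorem fuchsian_growth {T : ℂ → V →L[ℂ] V} {δ N C : ℝ}
    (hT : ∀ z, z ≠ 0 → ‖z‖ ≤ δ → ‖T z‖ ≤ N) {h : ℂ → V}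
    (hh : ∀ z, z ≠ 0 → ‖z‖ ≤ δ → HasDerivAt h (z⁻¹ • T z (h z)) z)
    (hC : ∀ z, ‖z‖ = δ → ‖h z‖ ≤ C) {z : ℂ} (hz : z ≠ 0) (hzδ : ‖z‖ ≤ δ) :
    ‖h z‖ ≤ C * Real.exp (N * Real.log (δ / ‖z‖)) := by
  have hz0 : 0 < ‖z‖ := norm_pos_iff.2 hz
  have hδ : 0 < δ := hz0.trans_le hzδ
  set u : ℂ := (δ / ‖z‖ : ℝ) * z with hu
  have hunorm : ‖u‖ = δ := by
    rw [hu, norm_mul, Complex.norm_real, Real.norm_of_nonneg (by positivity)]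
    field_simp
  have hu0 : u ≠ 0 := by rw [← norm_pos_iff, hunorm]; exact hδ
  have hmem : ∀ τ : ℝ, 0 ≤ τ → u * Complex.exp (-τ) ≠ 0 ∧ ‖u * Complex.exp (-τ)‖ ≤ δ := by
    intro τ hτ
    refine ⟨mul_ne_zero hu0 (Complex.exp_ne_zero _), ?_⟩
    rw [norm_mul, hunorm, Complex.norm_exp]
    exact mul_le_of_le_one_right hδ.le (by simpa using hτ)
  have hd : ∀ τ : ℝ, 0 ≤ τ → HasDerivAt (fun τ : ℝ => h (u * Complex.exp (-τ)))
      (-(T (u * Complex.exp (-τ)) (h (u * Complex.exp (-τ))))) τ := by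
    intro τ hτ
    have h1 : HasDerivAt (fun τ : ℝ => u * Complex.exp (-τ)) (-(u * Complex.exp (-τ))) τ := by
      have := ((Complex.ofRealCLM.hasDerivAt (x := τ)).neg.cexp).const_mul u
      simpa using this
    have h2 := (hh _ (hmem τ hτ).1 (hmem τ hτ).2).scomp τ h1
    rw [smul_smul, neg_mul, mul_inv_cancel₀ (hmem τ hτ).1, neg_one_smul] at h2
    exact h2
  have hτ : 0 ≤ Real.log (δ / ‖z‖) := Real.log_nonneg ((one_le_div hz0).2 hzδ)
  have := norm_le_gronwallBound_of_norm_deriv_right_le (δ := C) (K := N) (ε := 0) (a := 0)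
    (b := Real.log (δ / ‖z‖))
    (fun t ht => (hd t ht.1).continuousAt.continuousWithinAt)
    (fun t ht => (hd t ht.1).hasDerivWithinAt)
    (hC _ (by simpa using hunorm))
    (fun t ht => by
      rw [norm_neg, add_zero]
      refine ((T _).le_opNorm _).trans ?_
      gcongr
      exact hT _ (hmem t ht.1).1 (hmem t ht.1).2) (Real.log (δ / ‖z‖)) ⟨hτ, le_rfl⟩
  rw [gronwallBound_ε0, sub_zero] at this
  convert this using 3
  rw [← Complex.ofReal_neg, ← Complex.ofReal_exp, Real.exp_neg, Real.exp_log (by positivity), hu,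
    mul_right_comm, ← Complex.ofReal_mul, mul_inv_cancel₀ (by positivity)]
  simp

/-- A single-valued solution `h` of a Fuchsian equation `z h' = T(z) h` with `T(z) → T₀` is
meromorphic at `0`, and its order is an eigenvalue of `T₀`, an eigenvector being the leading
coefficient of `h`. -/
theorem fuchsian_order [CompleteSpace V] {T : ℂ → V →L[ℂ] V} {T₀ : V →L[ℂ] V}
    (hT : Tendsto T (𝓝[≠] 0) (𝓝 T₀)) {h : ℂ → V}
    (hh : ∀ᶠ z in 𝓝[≠] 0, HasDerivAt h (z⁻¹ • T z (h z)) z) :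
    (∀ᶠ z in 𝓝[≠] 0, h z = 0) ∨ ∃ (m : ℤ) (g : ℂ → V), AnalyticAt ℂ g 0 ∧ g 0 ≠ 0 ∧
      (∀ᶠ z in 𝓝[≠] 0, h z = z ^ m • g z) ∧ T₀ (g 0) = (m : ℂ) • g 0 := by
  obtain ⟨N, hN⟩ := exists_nat_gt ‖T₀‖
  have hb : ∀ᶠ z in 𝓝[≠] 0, ‖T z‖ < N := hT.norm.eventually (gt_mem_nhds hN)
  have hmer : MeromorphicAt h 0 := by
    obtain ⟨δ, hδ, hball⟩ := Metric.nhds_basis_closedBall.eventually_iff.1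
      (eventually_nhdsWithin_iff.1 (hh.and hb))
    have hball' : ∀ z : ℂ, z ≠ 0 → ‖z‖ ≤ δ →
        HasDerivAt h (z⁻¹ • T z (h z)) z ∧ ‖T z‖ < N :=
      fun z hz hzδ => hball (by simpa using hzδ) hz
    obtain ⟨C, hC⟩ := (isCompact_sphere (0 : ℂ) δ).exists_bound_of_continuousOn (f := h)
      (fun z hz => by
        have hz' : ‖z‖ = δ := by simpa using hz
        exact (hball' z (by rw [← norm_pos_iff, hz']; exact hδ)
          hz'.le).1.continuousAt.continuousWithinAt)
    refine ⟨N + 1, ?_⟩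
    simp only [sub_zero]
    refine Complex.analyticAt_of_differentiable_on_punctured_nhds_of_continuousAt ?_ ?_
    · filter_upwards [hh] with z hz
      exact ((differentiableAt_id.pow _).smul hz.differentiableAt)
    · have hle : ∀ᶠ z in 𝓝 (0 : ℂ), ‖z ^ (N + 1) • h z‖ ≤ ‖z‖ * (C * δ ^ N) := by
        filter_upwards [Metric.closedBall_mem_nhds (0 : ℂ) hδ] with z hz
        have hz' : ‖z‖ ≤ δ := by simpa using hz
        by_cases hz0 : z = 0
        · simp [hz0]
        have hzp : 0 < ‖z‖ := norm_pos_iff.2 hz0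
        have := fuchsian_growth (fun z h1 h2 => (hball' z h1 h2).2.le)
          (fun z h1 h2 => (hball' z h1 h2).1) (fun z hz => hC z (by simpa using hz)) hz0 hz'
        rw [← Real.log_pow, Real.exp_log (by positivity), div_pow] at this
        calc ‖z ^ (N + 1) • h z‖ = ‖z‖ ^ (N + 1) * ‖h z‖ := by rw [norm_smul, norm_pow]
          _ ≤ ‖z‖ ^ (N + 1) * (C * (δ ^ N / ‖z‖ ^ N)) := by gcongr
          _ = _ := by field_simp; ring
      have h0 : Tendsto (fun z : ℂ => ‖z‖ * (C * δ ^ N)) (𝓝 0) (𝓝 0) := by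
        have : Continuous fun z : ℂ => ‖z‖ * (C * δ ^ N) := by fun_prop
        simpa using this.tendsto 0
      have := squeeze_zero_norm' hle h0
      simpa [ContinuousAt] using this
  by_cases htop : meromorphicOrderAt h 0 = ⊤
  · exact Or.inl (meromorphicOrderAt_eq_top_iff.1 htop)
  obtain ⟨m, hm⟩ := WithTop.ne_top_iff_exists.1 htop
  obtain ⟨g, hg, hg0, hgh⟩ := (meromorphicOrderAt_eq_int_iff hmer).1 hm.symm
  simp only [sub_zero] at hgh
  refine Or.inr ⟨m, g, hg, hg0, hgh, ?_⟩
  have hgd : ∀ᶠ z in 𝓝[≠] (0 : ℂ), DifferentiableAt ℂ g z :=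
    (hg.eventually_analyticAt.mono fun z hz => hz.differentiableAt).filter_mono nhdsWithin_le_nhds
  -- comparison of the two expressions of `z h'`
  have hkey : ∀ᶠ z in 𝓝[≠] (0 : ℂ), T z (g z) = (m : ℂ) • g z + z • deriv g z := by
    have hgh' : ∀ᶠ z in 𝓝[≠] (0 : ℂ), ∀ᶠ y in 𝓝 z, h y = y ^ m • g y := by
      have := eventually_eventually_nhdsWithin.2 hgh
      filter_upwards [this, self_mem_nhdsWithin] with z hz hz0
      rwa [(isOpen_compl_singleton).nhdsWithin_eq hz0] at hz
    filter_upwards [hh, hgh', hgd, self_mem_nhdsWithin] with z hz hzg hgz (hz0 : z ≠ 0)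
    have h1 : HasDerivAt (fun y => y ^ m • g y) (z ^ m • deriv g z + ((m : ℂ) * z ^ (m - 1)) • g z)
        z := (hasDerivAt_zpow m z (Or.inl hz0)).smul hgz.hasDerivAt
    have h2 := (h1.congr_of_eventuallyEq hzg).unique hz
    rw [hzg.self_of_nhds, map_smul, smul_smul] at h2
    have h3 := congrArg (fun v => (z * (z ^ m)⁻¹) • v) h2
    have hzm : z ^ m ≠ 0 := zpow_ne_zero _ hz0
    simp only [smul_add, smul_smul] at h3
    rw [show z * (z ^ m)⁻¹ * (z⁻¹ * z ^ m) = 1 by field_simp, one_smul,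
      show z * (z ^ m)⁻¹ * z ^ m = z by field_simp,
      show z * (z ^ m)⁻¹ * (m * z ^ (m - 1)) = m by
        rw [zpow_sub_one₀ hz0]; field_simp] at h3
    rw [← h3, add_comm]
  have hgt : Tendsto g (𝓝[≠] 0) (𝓝 (g 0)) := hg.continuousAt.tendsto.mono_left nhdsWithin_le_nhds
  have hl : Tendsto (fun z => T z (g z)) (𝓝[≠] 0) (𝓝 (T₀ (g 0))) :=
    (isBoundedBilinearMap_apply.continuous.tendsto (T₀, g 0)).comp (hT.prodMk_nhds hgt)
  have hr : Tendsto (fun z => (m : ℂ) • g z + z • deriv g z) (𝓝[≠] 0)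
      (𝓝 ((m : ℂ) • g 0 + (0 : ℂ) • deriv g 0)) :=
    (hgt.const_smul _).add ((tendsto_id.mono_left nhdsWithin_le_nhds).smul
      (hg.deriv.continuousAt.tendsto.mono_left nhdsWithin_le_nhds))
  have := tendsto_nhds_unique (hl.congr' hkey) hr
  simpa using this

/-- A single-valued solution at a Fuchsian singularity whose residue has no nonzero integer as an
eigenvalue has a limit. -/
theorem fuchsian_tendsto [CompleteSpace V] {T : ℂ → V →L[ℂ] V} {T₀ : V →L[ℂ] V}
    (hT : Tendsto T (𝓝[≠] 0) (𝓝 T₀)) {h : ℂ → V}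
    (hh : ∀ᶠ z in 𝓝[≠] 0, HasDerivAt h (z⁻¹ • T z (h z)) z)
    (hres : ∀ m : ℤ, m ≠ 0 → ∀ v, T₀ v = (m : ℂ) • v → v = 0) :
    ∃ l, Tendsto h (𝓝[≠] 0) (𝓝 l) := by
  rcases fuchsian_order hT hh with h0 | ⟨m, g, hg, hg0, hgh, hm⟩
  · exact ⟨0, tendsto_const_nhds.congr' (h0.mono fun z hz => hz.symm)⟩
  · have : m = 0 := by
      by_contra hm0
      exact hg0 (hres m hm0 _ hm)
    subst this
    refine ⟨g 0, (hg.continuousAt.tendsto.mono_left nhdsWithin_le_nhds).congr' ?_⟩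
    filter_upwards [hgh] with z hz
    simp [hz]

end Fuchsian

/-! ### The logarithm and local monodromy -/

section LogPlane

variable {V : Type*} [NormedAddCommGroup V] [NormedSpace ℂ V]

/-- A branch of the logarithm near `exp w₀` with value `w₀` there. -/
theorem exists_log_branch (w₀ : ℂ) : ∃ β : ℂ → ℂ, β (Complex.exp w₀) = w₀ ∧
    (∀ᶠ z in 𝓝 (Complex.exp w₀), Complex.exp (β z) = z ∧ HasDerivAt β z⁻¹ z) ∧
    ∀ᶠ w in 𝓝 w₀, β (Complex.exp w) = w := by
  have hne := Complex.exp_ne_zero w₀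
  refine ⟨fun z => w₀ + Complex.log (z / Complex.exp w₀), by simp [hne], ?_, ?_⟩
  · have hcont : ContinuousAt (fun z => z / Complex.exp w₀) (Complex.exp w₀) := by fun_prop
    have hs : ∀ᶠ z in 𝓝 (Complex.exp w₀), z / Complex.exp w₀ ∈ Complex.slitPlane :=
      hcont.eventually_mem (Complex.isOpen_slitPlane.mem_nhds (by simp [hne]))
    filter_upwards [hs] with z hz
    have hz0 : z ≠ 0 := by
      rintro rfl
      simp at hz
    refine ⟨?_, ?_⟩
    · rw [Complex.exp_add, Complex.exp_log (div_ne_zero hz0 hne)]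
      field_simp
    · have := (((hasDerivAt_id z).div_const (Complex.exp w₀)).clog hz).const_add w₀
      refine this.congr_deriv ?_
      rw [id_eq, one_div, inv_div_left, div_mul_cancel₀ _ hne]
  · have hc : ContinuousAt (fun w : ℂ => (w - w₀).im) w₀ := by fun_prop
    have h1 : ∀ᶠ w in 𝓝 w₀, (w - w₀).im ∈ Ioo (-Real.pi) Real.pi :=
      hc.eventually_mem (Ioo_mem_nhds (by simp [Real.pi_pos]) (by simp [Real.pi_pos]))
    filter_upwards [h1] with w hw
    rw [← Complex.exp_sub, Complex.log_exp hw.1 hw.2.le]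
    ring

theorem eq_of_exp_eq_of_periodic {V : Type*} {P : Set ℝ} {y : ℂ → V}
    (hper : ∀ w : ℂ, w.re ∈ P → y (w + 2 * Real.pi * Complex.I) = y w) {w w' : ℂ} (hw : w.re ∈ P)
    (h : Complex.exp w' = Complex.exp w) : y w' = y w := by
  have hnat : ∀ (n : ℕ) (w : ℂ), w.re ∈ P → y (w + n * (2 * Real.pi * Complex.I)) = y w := by
    intro n
    induction n with
    | zero => simp
    | succ n ih =>
      intro w hw
      rw [← ih w hw, ← hper (w + n * (2 * Real.pi * Complex.I)) (by simpa using hw)]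
      congr 1
      push_cast
      ring
  obtain ⟨n, hn⟩ := Complex.exp_eq_exp_iff_exists_int.1 h
  obtain ⟨m, rfl | rfl⟩ := n.eq_nat_or_neg
  · rw [hn]
    exact_mod_cast hnat m w hw
  · have hw' : w'.re ∈ P := by
      rw [hn]
      simpa using hw
    rw [← hnat m w' hw', hn]
    congr 1
    push_cast
    ring

/-- A `2πi`-periodic function of the logarithm is a function of the variable. -/
theorem hasDerivAt_comp_log_of_periodic {P : Set ℝ} (hP : IsOpen P) {y : ℂ → V}
    (hper : ∀ w : ℂ, w.re ∈ P → y (w + 2 * Real.pi * Complex.I) = y w) {w : ℂ} (hw : w.re ∈ P)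
    {d : V} (hd : HasDerivAt y d w) :
    HasDerivAt (fun z => y (Complex.log z)) ((Complex.exp w)⁻¹ • d) (Complex.exp w) := by
  obtain ⟨β, hβ0, hβ, -⟩ := exists_log_branch w
  rw [← hβ0] at hd
  have h1 := hd.scomp (Complex.exp w) hβ.self_of_nhds.2
  refine h1.congr_of_eventuallyEq ?_
  have hc : ContinuousAt (fun z => (β z).re) (Complex.exp w) :=
    Complex.continuous_re.continuousAt.comp hβ.self_of_nhds.2.continuousAt
  have h2 : ∀ᶠ z in 𝓝 (Complex.exp w), (β z).re ∈ P :=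
    hc.eventually_mem (hP.mem_nhds (by rw [hβ0]; exact hw))
  filter_upwards [hβ, h2] with z hz hz'
  refine eq_of_exp_eq_of_periodic hper hz' ?_
  rw [hz.1, Complex.exp_log]
  rw [← hz.1]
  exact Complex.exp_ne_zero _

/-- A solution of a Fuchsian equation which is multiplied by `m` along a turn around the
singularity comes from an eigenvalue `μ` of the residue with `exp (2πiμ) = m`. -/
theorem exists_eigenvector_of_monodromy [CompleteSpace V] {c : ℝ} {T : ℂ → V →L[ℂ] V}
    {T₀ : V →L[ℂ] V} (hT : Tendsto T (𝓝[≠] 0) (𝓝 T₀))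
    (hTc : ContinuousOn T {z | z ≠ 0 ∧ ‖z‖ < Real.exp c}) {y : ℂ → V}
    (hy : ∀ v : ℂ, v.re < c → HasDerivAt y (T (Complex.exp v) (y v)) v) {m : ℂ}
    (hm : ∀ v : ℂ, v.re < c → y (v + 2 * Real.pi * Complex.I) = m • y v)
    {v₀ : ℂ} (hv₀ : v₀.re < c) (hne : y v₀ ≠ 0) :
    ∃ (μ : ℂ) (g : V), Complex.exp (2 * Real.pi * Complex.I * μ) = m ∧ g ≠ 0 ∧
      T₀ g = μ • g := by
  have hunique : ∀ v : ℂ, v.re < c → y v ≠ 0 := by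
    intro v hv h0
    refine hne ?_
    have hmaps : MapsTo Complex.exp {v : ℂ | v.re < c} {z | z ≠ 0 ∧ ‖z‖ < Real.exp c} :=
      fun v hv => ⟨Complex.exp_ne_zero v, by rw [Complex.norm_exp]; exact Real.exp_lt_exp.2 hv⟩
    exact linearODE_unique (L := fun v => T (Complex.exp v)) (g := fun _ => 0)
      (isOpen_lt Complex.continuous_re continuous_const)
      (convex_halfSpace_re_lt c).isPreconnected
      (hTc.comp Complex.continuous_exp.continuousOn hmaps) hy
      (fun x _ => by simpa using hasDerivAt_const x (0 : V)) hv (by simpa using h0) hv₀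
  have hm0 : m ≠ 0 := by
    rintro rfl
    refine hunique (v₀ + 2 * Real.pi * Complex.I) (by simpa using hv₀) ?_
    rw [hm v₀ hv₀, zero_smul]
  set κ : ℂ := Complex.log m / (2 * Real.pi * Complex.I) with hκ
  have hπ : (2 * Real.pi * Complex.I : ℂ) ≠ 0 := Complex.two_pi_I_ne_zero
  have hκm : Complex.exp (2 * Real.pi * Complex.I * κ) = m := by
    rw [hκ, mul_div_cancel₀ _ hπ, Complex.exp_log hm0]
  -- division by `z ^ κ` makes the solution single-valued
  let Y : ℂ → V := fun v => Complex.exp (-(κ * v)) • y v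
  have hYper : ∀ w : ℂ, w.re ∈ Iio c → Y (w + 2 * Real.pi * Complex.I) = Y w := by
    intro w hw
    simp only [Y]
    rw [hm w hw, smul_smul]
    congr 1
    rw [← hκm, ← Complex.exp_add]
    congr 1
    ring
  have hYd : ∀ v : ℂ, v.re < c → HasDerivAt Y
      ((T (Complex.exp v) - κ • ContinuousLinearMap.id ℂ V) (Y v)) v := by
    intro v hv
    have h1 : HasDerivAt (fun v => Complex.exp (-(κ * v))) (Complex.exp (-(κ * v)) * (-κ)) v := by
      simpa using (((hasDerivAt_id v).const_mul κ).neg).cexp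
    refine (h1.fun_smul (hy v hv)).congr_deriv ?_
    change _ = T (Complex.exp v) (Complex.exp (-(κ * v)) • y v) - κ • (Complex.exp (-(κ * v)) • y v)
    rw [map_smul]
    module
  have hlog : ∀ z : ℂ, z ≠ 0 → ‖z‖ < Real.exp c → (Complex.log z).re < c := by
    intro z hz0 hz
    rw [Complex.log_re, ← Real.log_exp c]
    exact Real.log_lt_log (norm_pos_iff.2 hz0) hz
  have hball : ∀ᶠ z in 𝓝[≠] (0 : ℂ), z ≠ 0 ∧ ‖z‖ < Real.exp c := by
    filter_upwards [self_mem_nhdsWithin,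
      nhdsWithin_le_nhds (Metric.ball_mem_nhds (0 : ℂ) (Real.exp_pos c))] with z hz hz'
    exact ⟨hz, by simpa using hz'⟩
  have hh : ∀ᶠ z in 𝓝[≠] (0 : ℂ), HasDerivAt (fun z => Y (Complex.log z))
      (z⁻¹ • (T z - κ • ContinuousLinearMap.id ℂ V) (Y (Complex.log z))) z := by
    filter_upwards [hball] with z hz
    have hl := hlog z hz.1 hz.2
    have := hasDerivAt_comp_log_of_periodic isOpen_Iio hYper hl (hYd _ hl)
    rwa [Complex.exp_log hz.1] at this
  rcases fuchsian_order (hT.sub_const _) hh with h0 | ⟨p, g, hg, hg0, -, hp⟩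
  · obtain ⟨z, hz, hz'⟩ := (h0.and hball).exists
    refine absurd hz (smul_ne_zero (Complex.exp_ne_zero _) (hunique _ (hlog z hz'.1 hz'.2)))
  · refine ⟨κ + p, g 0, ?_, hg0, ?_⟩
    · rw [mul_add, Complex.exp_add, hκm, mul_comm _ (p : ℂ), Complex.exp_int_mul_two_pi_mul_I,
        mul_one]
    · change T₀ (g 0) - κ • g 0 = _ at hp
      rw [add_smul, ← hp]
      abel

end LogPlane

/-! ### The operators `H ↦ P H - H Q` and resonance -/

section AdOp

variable {A : Type*} [NormedRing A] [NormedAlgebra ℂ A]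

/-- The operator `H ↦ P H - H Q`. -/
noncomputable def adOp (P Q : A) : A →L[ℂ] A :=
  ContinuousLinearMap.mul ℂ A P - (ContinuousLinearMap.mul ℂ A).flip Q

theorem adOp_apply (P Q H : A) : adOp P Q H = P * H - H * Q := rfl

theorem tendsto_adOp {X : Type*} {P Q : X → A}
    {P₀ Q₀ : A} {l : Filter X} (hP : Tendsto P l (𝓝 P₀)) (hQ : Tendsto Q l (𝓝 Q₀)) :
    Tendsto (fun z => adOp (P z) (Q z)) l (𝓝 (adOp P₀ Q₀)) :=
  (((ContinuousLinearMap.mul ℂ A).continuous.tendsto P₀).comp hP).sub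
    (((ContinuousLinearMap.mul ℂ A).flip.continuous.tendsto Q₀).comp hQ)

theorem adOp_smul (c : ℂ) (P Q : A) : adOp (c • P) (c • Q) = c • adOp P Q := by
  ext1 H
  change c • P * H - H * (c • Q) = c • (P * H - H * Q)
  simp [smul_sub]

end AdOp

section MatrixAlgebra

open scoped Matrix.Norms.Operator

variable {n : ℕ}

/-- Sylvester's criterion: `A H = H B` has only the zero solution if `A` and `B` have no common
eigenvalue. -/
theorem eq_zero_of_mul_eq_mul {A B H : Matrix (Fin n) (Fin n) ℂ}
    (h : ∀ μ, A.charpoly.IsRoot μ → B.charpoly.IsRoot μ → False) (hH : A * H = H * B) : H = 0 := by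
  have hcop : IsCoprime A.charpoly B.charpoly := by
    rw [Polynomial.isCoprime_iff_aeval_ne_zero_of_isAlgClosed ℂ ℂ]
    intro a
    by_contra! hcon
    exact h a (by simpa [Polynomial.IsRoot] using hcon.1)
      (by simpa [Polynomial.IsRoot] using hcon.2)
  obtain ⟨a, b, hab⟩ := hcop
  have hpoly : ∀ q : Polynomial ℂ, Polynomial.aeval A q * H = H * Polynomial.aeval B q := by
    intro q
    induction q using Polynomial.induction_on' with
    | add p q hp hq => rw [map_add, map_add, add_mul, mul_add, hp, hq]
    | monomial k c =>
      rw [Polynomial.aeval_monomial, Polynomial.aeval_monomial]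
      have hk : A ^ k * H = H * B ^ k := by
        induction k with
        | zero => simp
        | succ k ih => rw [pow_succ, mul_assoc, hH, ← mul_assoc, ih, mul_assoc, ← pow_succ]
      rw [mul_assoc, hk, ← mul_assoc, Algebra.commutes, mul_assoc]
  have h1 := congrArg (fun q => Polynomial.aeval B q) hab
  simp only [map_add, map_mul, Matrix.aeval_self_charpoly, mul_zero, add_zero, map_one] at h1
  have h2 := hpoly A.charpoly
  rw [Matrix.aeval_self_charpoly, zero_mul] at h2
  have h3 : Polynomial.aeval B A.charpoly * Polynomial.aeval B a = 1 := by
    rw [← map_mul, mul_comm, map_mul, h1]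
  calc H = H * (Polynomial.aeval B A.charpoly * Polynomial.aeval B a) := by rw [h3, mul_one]
    _ = 0 := by rw [← mul_assoc, ← h2, zero_mul]

/-- The eigenvalues of `adOp A B` are differences of eigenvalues of `A` and `B`. -/
theorem eq_zero_of_adOp_eq_smul {A B H : Matrix (Fin n) (Fin n) ℂ} {c : ℂ}
    (h : ∀ μ, B.charpoly.IsRoot μ → A.charpoly.IsRoot (μ + c) → False)
    (hH : adOp A B H = c • H) : H = 0 := by
  refine eq_zero_of_mul_eq_mul (A := A) (B := B + Matrix.scalar (Fin n) c) (H := H) ?_ ?_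
  · intro μ hA hB
    refine h (μ - c) ?_ (by simpa using hA)
    rw [Polynomial.IsRoot.def, Matrix.eval_charpoly] at hB ⊢
    rw [← hB, map_sub]
    congr 1
    abel
  · rw [adOp_apply, sub_eq_iff_eq_add] at hH
    rw [hH, mul_add, ← (Matrix.scalar_commute c (fun _ => mul_comm _ _) H).eq, Matrix.scalar_apply,
      ← Matrix.smul_eq_diagonal_mul, add_comm]

/-- No two eigenvalues differ by a nonzero integer. -/
def IsNonresonant (A : Matrix (Fin n) (Fin n) ℂ) : Prop :=
  ∀ (μ : ℂ) (m : ℤ), A.charpoly.IsRoot μ → A.charpoly.IsRoot (μ + m) → m = 0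

/-- No nonzero integer is an eigenvalue of the operator. -/
def HasNoIntEigenvalue {V : Type*} [NormedAddCommGroup V] [NormedSpace ℂ V] (T : V →L[ℂ] V) :
    Prop :=
  ∀ m : ℤ, m ≠ 0 → ∀ v, T v = (m : ℂ) • v → v = 0

theorem IsNonresonant.hasNoIntEigenvalue {A : Matrix (Fin n) (Fin n) ℂ} (hA : IsNonresonant A) :
    HasNoIntEigenvalue (adOp A A) := fun m hm _ hH =>
  eq_zero_of_adOp_eq_smul (fun μ h1 h2 => hm (hA μ m h1 h2)) hH

/-- The condition is open: close to `T₀`, the integral eigenvalues are bounded, and for each integer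
`m` the injectivity of `T - m` is an open condition. -/
theorem HasNoIntEigenvalue.eventually {V : Type*} [NormedAddCommGroup V] [NormedSpace ℂ V]
    [FiniteDimensional ℂ V] {T₀ : V →L[ℂ] V} (h : HasNoIntEigenvalue T₀) :
    ∀ᶠ T in 𝓝 T₀, HasNoIntEigenvalue T := by
  -- only the integers of absolute value at most `‖T₀‖ + 1` matter
  have h1 : ∀ᶠ T : V →L[ℂ] V in 𝓝 T₀, ‖T‖ < ‖T₀‖ + 1 :=
    continuous_norm.continuousAt.eventually (gt_mem_nhds (by linarith))
  obtain ⟨N, hN⟩ := exists_nat_gt (‖T₀‖ + 1)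
  have h2 : ∀ m ∈ (Finset.Icc (-(N : ℤ)) N).filter (· ≠ 0), ∀ᶠ T : V →L[ℂ] V in 𝓝 T₀,
      ∀ v, T v = (m : ℂ) • v → v = 0 := by
    intro m hm
    have hc : Continuous fun T : V →L[ℂ] V => T - (m : ℂ) • ContinuousLinearMap.id ℂ V := by
      fun_prop
    have hinj : T₀ - (m : ℂ) • ContinuousLinearMap.id ℂ V ∈
        {S : V →L[ℂ] V | Function.Injective S} := by
      refine (injective_iff_map_eq_zero _).2 fun v hv => h m (Finset.mem_filter.1 hm).2 v ?_
      exact sub_eq_zero.1 hv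
    filter_upwards [hc.continuousAt.eventually_mem
      (ContinuousLinearMap.isOpen_injective.mem_nhds hinj)] with T hT v hv
    exact (injective_iff_map_eq_zero _).1 hT v (sub_eq_zero.2 hv)
  filter_upwards [h1, (Finset.eventually_all _).2 h2] with T hT hT2 m hm v hv
  by_cases hmN : m ∈ Finset.Icc (-(N : ℤ)) N
  · exact hT2 m (Finset.mem_filter.2 ⟨hmN, hm⟩) v hv
  · by_contra hv0
    have hmN' : (N : ℝ) ≤ ‖(m : ℂ)‖ := by
      rw [Complex.norm_intCast]
      have : (N : ℤ) ≤ |m| := by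
        by_contra! hlt
        exact hmN (Finset.mem_Icc.2 (abs_le.1 hlt.le))
      exact_mod_cast this
    have h3 := T.le_opNorm v
    rw [hv, norm_smul] at h3
    have := le_of_mul_le_mul_right h3 (norm_pos_iff.2 hv0)
    linarith

theorem isRoot_charpoly_of_mul_eq_smul {A g : Matrix (Fin n) (Fin n) ℂ} {μ : ℂ}
    (h : A * g = μ • g) (hg : g ≠ 0) : A.charpoly.IsRoot μ := by
  by_contra hroot
  rw [Polynomial.IsRoot.def, Matrix.eval_charpoly] at hroot
  have hu : IsUnit (Matrix.scalar (Fin n) μ - A) :=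
    (Matrix.isUnit_iff_isUnit_det _).2 (isUnit_iff_ne_zero.2 hroot)
  refine hg (hu.mul_right_eq_zero.1 ?_)
  rw [sub_mul, h, Matrix.scalar_apply, ← Matrix.smul_eq_diagonal_mul, sub_self]

theorem exists_mul_eq_smul_of_isRoot {A : Matrix (Fin n) (Fin n) ℂ} {μ : ℂ}
    (h : A.charpoly.IsRoot μ) : ∃ g : Matrix (Fin n) (Fin n) ℂ, g ≠ 0 ∧ A * g = μ • g := by
  rw [Polynomial.IsRoot.def, Matrix.eval_charpoly] at h
  obtain ⟨q, hq, hAq⟩ := Matrix.exists_mulVec_eq_zero_iff.2 h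
  refine ⟨Matrix.of fun i _ => q i, ?_, ?_⟩
  · intro h0
    obtain ⟨i, hi⟩ := Function.ne_iff.1 hq
    exact hi (congrFun (congrFun h0 i) i)
  · ext i l
    have := congrFun hAq i
    rw [Matrix.sub_mulVec, Matrix.scalar_apply, Pi.sub_apply, Matrix.mulVec_diagonal,
      Pi.zero_apply, sub_eq_zero] at this
    exact Matrix.mul_apply.trans this.symm

/-- If each eigenvalue of a matrix `M` with distinct eigenvalues is `exp (2πiμ)` for an
eigenvalue `μ` of `A`, then these `μ` are all the eigenvalues of `A`, and `A` is nonresonant. -/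
theorem isNonresonant_of_exp {A M : Matrix (Fin n) (Fin n) ℂ} (hM : HasDistinctEigenvalues M)
    (h : ∀ m, M.charpoly.IsRoot m →
      ∃ μ, Complex.exp (2 * Real.pi * Complex.I * μ) = m ∧ A.charpoly.IsRoot μ) :
    IsNonresonant A := by
  classical
  have hM0 := M.charpoly_monic.ne_zero
  have hA0 := A.charpoly_monic.ne_zero
  choose! μ hμ hroot using h
  have hcard : M.charpoly.roots.toFinset.card = n := by
    rw [Multiset.toFinset_card_of_nodup hM, IsAlgClosed.card_roots_eq_natDegree,
      Matrix.charpoly_natDegree_eq_dim, Fintype.card_fin]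
  have hmem : ∀ m ∈ M.charpoly.roots.toFinset, M.charpoly.IsRoot m := fun m hm => by
    rw [Multiset.mem_toFinset, Polynomial.mem_roots hM0] at hm
    exact hm
  have hinj : Set.InjOn μ M.charpoly.roots.toFinset := fun a ha b hb hab => by
    rw [← hμ a (hmem a ha), ← hμ b (hmem b hb), hab]
  have himage : M.charpoly.roots.toFinset.image μ = A.charpoly.roots.toFinset := by
    refine Finset.eq_of_subset_of_card_le ?_ ?_
    · intro x hx
      obtain ⟨m, hm, rfl⟩ := Finset.mem_image.1 hx
      rw [Multiset.mem_toFinset, Polynomial.mem_roots hA0]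
      exact hroot m (hmem m hm)
    · rw [Finset.card_image_of_injOn hinj, hcard]
      refine (Multiset.toFinset_card_le _).trans ((Polynomial.card_roots' _).trans ?_)
      rw [Matrix.charpoly_natDegree_eq_dim, Fintype.card_fin]
  have hsurj : ∀ x, A.charpoly.IsRoot x → ∃ m ∈ M.charpoly.roots.toFinset, μ m = x := by
    intro x hx
    have : x ∈ A.charpoly.roots.toFinset := by
      rwa [Multiset.mem_toFinset, Polynomial.mem_roots hA0]
    rwa [← himage, Finset.mem_image] at this
  intro x k hx hxk
  obtain ⟨a, ha, hax⟩ := hsurj x hx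
  obtain ⟨b, hb, hbx⟩ := hsurj _ hxk
  have hab : a = b := by
    rw [← hμ a (hmem a ha), ← hμ b (hmem b hb), hax, hbx, mul_add, Complex.exp_add,
      mul_comm _ (k : ℂ), Complex.exp_int_mul_two_pi_mul_I, mul_one]
  subst hab
  have : x + k = x := hbx.symm.trans hax
  simpa using this

end MatrixAlgebra

/-! ### Analytic continuation along paths -/

section Continuation

variable {V : Type*} [NormedAddCommGroup V] [NormedSpace ℂ V]

/-- `Y` is, on the set `J` of parameters, the analytic continuation along `γ` of a solution of the
linear differential equation `y' = L(x) y`. -/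
def IsContinuationOn (L : ℂ → V →L[ℂ] V) (γ : ℝ → ℂ) (J : Set ℝ) (Y : ℝ → V) : Prop :=
  ∀ t ∈ J, ∃ Z : ℂ → V, (∀ᶠ z in 𝓝 (γ t), HasDerivAt Z (L z (Z z)) z) ∧
    ∀ᶠ s in 𝓝[J] t, Y s = Z (γ s)

theorem IsContinuationOn.mono {L : ℂ → V →L[ℂ] V} {γ : ℝ → ℂ} {J J' : Set ℝ} {Y : ℝ → V}
    (h : IsContinuationOn L γ J Y) (hJ : J' ⊆ J) : IsContinuationOn L γ J' Y := fun t ht => by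
  obtain ⟨Z, hZ, hY⟩ := h t (hJ ht)
  exact ⟨Z, hZ, hY.filter_mono (nhdsWithin_mono t hJ)⟩

theorem IsContinuationOn.congr_path {L : ℂ → V →L[ℂ] V} {γ γ' : ℝ → ℂ} {J : Set ℝ} {Y : ℝ → V}
    (h : IsContinuationOn L γ J Y) (hγ : EqOn γ' γ J) : IsContinuationOn L γ' J Y := fun t ht => by
  obtain ⟨Z, hZ, hY⟩ := h t ht
  refine ⟨Z, by rwa [hγ ht], ?_⟩
  filter_upwards [hY, self_mem_nhdsWithin] with s hs hsJ
  rw [hs, hγ hsJ]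

theorem IsContinuationOn.map {L : ℂ → V →L[ℂ] V} {γ : ℝ → ℂ} {J : Set ℝ} {Y : ℝ → V}
    (h : IsContinuationOn L γ J Y) {W : Type*} [NormedAddCommGroup W] [NormedSpace ℂ W]
    {L' : ℂ → W →L[ℂ] W} (τ : V →L[ℂ] W) (hτ : ∀ z v, τ (L z v) = L' z (τ v)) :
    IsContinuationOn L' γ J fun t => τ (Y t) := fun t ht => by
  obtain ⟨Z, hZ, hY⟩ := h t ht
  refine ⟨fun z => τ (Z z), ?_, hY.mono fun s hs => congrArg τ hs⟩
  filter_upwards [hZ] with z hz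
  have := τ.hasFDerivAt.comp_hasDerivAt z hz
  rwa [hτ] at this

theorem IsContinuationOn.unique [CompleteSpace V] {L : ℂ → V →L[ℂ] V} {U : Set ℂ} (hU : IsOpen U)
    (hL : ContinuousOn L U) {γ : ℝ → ℂ} {J : Set ℝ} (hJ : IsPreconnected J)
    (hγ : ContinuousOn γ J) (hγU : MapsTo γ J U) {Y₁ Y₂ : ℝ → V}
    (h₁ : IsContinuationOn L γ J Y₁) (h₂ : IsContinuationOn L γ J Y₂) {t₀ : ℝ} (ht₀ : t₀ ∈ J)
    (h0 : Y₁ t₀ = Y₂ t₀) : EqOn Y₁ Y₂ J := by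
  intro t ht
  refine (hJ.induction₂ (fun s t => Y₁ s = Y₂ s ↔ Y₁ t = Y₂ t) ?_
    (fun _ _ _ _ _ _ h h' => h.trans h') (fun _ _ _ _ h => h.symm) ht₀ ht).1 h0
  intro t ht
  obtain ⟨Z₁, hZ₁, hY₁⟩ := h₁ t ht
  obtain ⟨Z₂, hZ₂, hY₂⟩ := h₂ t ht
  obtain ⟨δ, hδ, hball⟩ := Metric.eventually_nhds_iff_ball.1
    ((hZ₁.and hZ₂).and (hU.mem_nhds (hγU ht)))
  have hmem : ∀ᶠ s in 𝓝[J] t, γ s ∈ Metric.ball (γ t) δ :=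
    (hγ t ht).eventually_mem (Metric.ball_mem_nhds _ hδ)
  have hiff : ∀ z ∈ Metric.ball (γ t) δ, ∀ w ∈ Metric.ball (γ t) δ,
      Z₁ z = Z₂ z → Z₁ w = Z₂ w := fun z hz w hw h =>
    linearODE_unique Metric.isOpen_ball (convex_ball _ _).isPreconnected
      (hL.mono fun z hz => (hball z hz).2) (fun z hz => (hball z hz).1.1)
      (fun z hz => (hball z hz).1.2) hz h hw
  have ht1 : Y₁ t = Z₁ (γ t) := hY₁.self_of_nhdsWithin ht
  have ht2 : Y₂ t = Z₂ (γ t) := hY₂.self_of_nhdsWithin ht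
  filter_upwards [hY₁, hY₂, hmem] with s hs1 hs2 hs
  rw [ht1, ht2, hs1, hs2]
  exact ⟨hiff _ (Metric.mem_ball_self hδ) _ hs, hiff _ hs _ (Metric.mem_ball_self hδ)⟩

end Continuation

section Development

/-- The part of the logarithmic plane in which a system with singular points in the disk of radius
`R / 2` and at `R` is developed: over the annulus `R / 2 < |x| < R` and over `|x| > R` the
argument is free, and the two parts are connected by the arguments in `(0, 2π)`. -/
def logDomain (R : ℝ) : Set ℂ :=
  {w | Real.log (R / 2) < w.re ∧ (w.re ≠ Real.log R ∨ (0 < w.im ∧ w.im < 2 * Real.pi))}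

theorem isOpen_logDomain (R : ℝ) : IsOpen (logDomain R) :=
  (isOpen_lt continuous_const Complex.continuous_re).inter
    ((isOpen_ne_fun Complex.continuous_re continuous_const).union
      ((isOpen_lt continuous_const Complex.continuous_im).inter
        (isOpen_lt Complex.continuous_im continuous_const)))

theorem exp_mem_of_mem_logDomain {R : ℝ} (hR : 0 < R) {w : ℂ} (hw : w ∈ logDomain R) :
    R / 2 < ‖Complex.exp w‖ ∧ Complex.exp w ≠ R := by
  refine ⟨?_, fun h => ?_⟩
  · rw [Complex.norm_exp, ← Real.exp_log (half_pos hR)]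
    exact Real.exp_lt_exp.2 hw.1
  · have hre : w.re = Real.log R := by
      have := congrArg norm h
      rw [Complex.norm_exp, Complex.norm_real, Real.norm_of_nonneg hR.le] at this
      rw [← this, Real.log_exp]
    rcases hw.2 with h1 | ⟨h1, h2⟩
    · exact h1 hre
    · have h3 : Complex.exp w = Complex.exp (Real.log R : ℝ) := by
        rw [h, ← Complex.ofReal_exp, Real.exp_log hR]
      obtain ⟨m, hm⟩ := Complex.exp_eq_exp_iff_exists_int.1 h3
      have him : w.im = m * (2 * Real.pi) := by
        rw [hm]
        simp
      rw [him] at h1 h2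
      have hm0 : 0 < m := by
        have : (0 : ℝ) < m := by
          by_contra! hm0
          nlinarith [Real.pi_pos]
        exact_mod_cast this
      have hm1 : m < 1 := by
        have : (m : ℝ) < 1 := by nlinarith [Real.pi_pos]
        exact_mod_cast this
      omega

variable {V : Type*} [NormedAddCommGroup V] [NormedSpace ℂ V] [CompleteSpace V]

/-- The equation `y' = L(x) y` in the variable `w = log x`. -/
noncomputable def logOp (L : ℂ → V →L[ℂ] V) (w : ℂ) : V →L[ℂ] V := Complex.exp w • L (Complex.exp w)

end Development

/-! ### Development in the logarithmic plane -/

section Development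

variable {V : Type*} [NormedAddCommGroup V] [NormedSpace ℂ V]

theorem differentiableOn_logOp {L : ℂ → V →L[ℂ] V} {U : Set ℂ} (hL : DifferentiableOn ℂ L U)
    {D : Set ℂ} (hD : MapsTo Complex.exp D U) : DifferentiableOn ℂ (logOp L) D :=
  Complex.differentiable_exp.differentiableOn.smul
    (hL.comp Complex.differentiable_exp.differentiableOn hD)

/-- A solution in the logarithmic plane, composed with a local inverse of `exp`, is a solution. -/
theorem hasDerivAt_comp_of_logOp {L : ℂ → V →L[ℂ] V} {Φ : ℂ → V} {β : ℂ → ℂ} {z : ℂ}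
    (hβ : Complex.exp (β z) = z) (hβ' : HasDerivAt β z⁻¹ z)
    (hΦ : HasDerivAt Φ (logOp L (β z) (Φ (β z))) (β z)) :
    HasDerivAt (fun z => Φ (β z)) (L z (Φ (β z))) z := by
  have hz : z ≠ 0 := by
    rw [← hβ]
    exact Complex.exp_ne_zero _
  refine (hΦ.scomp z hβ').congr_deriv ?_
  change z⁻¹ • (Complex.exp (β z) • L (Complex.exp (β z)) (Φ (β z))) = _
  rw [hβ, smul_smul, inv_mul_cancel₀ hz, one_smul]

theorem hasDerivAt_logOp_of_solution {L : ℂ → V →L[ℂ] V} {f : ℂ → V} {w : ℂ}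
    (hf : HasDerivAt f (L (Complex.exp w) (f (Complex.exp w))) (Complex.exp w)) :
    HasDerivAt (fun w => f (Complex.exp w)) (logOp L w (f (Complex.exp w))) w :=
  hf.scomp w (Complex.hasDerivAt_exp w)

theorem hasDerivAt_logOp_shift {L : ℂ → V →L[ℂ] V} {Φ : ℂ → V} {w : ℂ}
    (h : HasDerivAt Φ (logOp L (w + 2 * Real.pi * Complex.I) (Φ (w + 2 * Real.pi * Complex.I)))
      (w + 2 * Real.pi * Complex.I)) :
    HasDerivAt (fun w => Φ (w + 2 * Real.pi * Complex.I))
      (logOp L w (Φ (w + 2 * Real.pi * Complex.I))) w := by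
  have hop : logOp L (w + 2 * Real.pi * Complex.I) = logOp L w := by
    simp only [logOp, Complex.exp_periodic w]
  rw [hop] at h
  exact h.comp_add_const w _

variable [CompleteSpace V]

theorem log_half_lt_log {R : ℝ} (hR : 0 < R) : Real.log (R / 2) < Real.log R :=
  Real.log_lt_log (half_pos hR) (half_lt_self hR)

/-- Solutions can be developed over the whole of `logDomain R`. -/
theorem exists_logDevelopment {R : ℝ} (hR : 0 < R) {L : ℂ → V →L[ℂ] V}
    (hL : DifferentiableOn ℂ L {x | R / 2 < ‖x‖ ∧ x ≠ R}) {w₀ : ℂ}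
    (hw₀ : Real.log (R / 2) < w₀.re) (hw₀' : w₀.re < Real.log R) (v₀ : V) :
    ∃ Φ : ℂ → V, Φ w₀ = v₀ ∧ ∀ w ∈ logDomain R, HasDerivAt Φ (logOp L w (Φ w)) w := by
  have hD := differentiableOn_logOp hL (fun w hw => exp_mem_of_mem_logDomain hR hw)
  let D₀ : Set ℂ := {w | Real.log (R / 2) < w.re} ∩ {w | w.re < Real.log R}
  let D₁ : Set ℂ := {w | Real.log (R / 2) < w.re} ∩ ({w | 0 < w.im} ∩ {w | w.im < 2 * Real.pi})
  let D₂ : Set ℂ := {w | Real.log R < w.re}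
  have hsub₀ : D₀ ⊆ logDomain R := fun w hw => ⟨hw.1, Or.inl (ne_of_lt hw.2)⟩
  have hsub₁ : D₁ ⊆ logDomain R := fun w hw => ⟨hw.1, Or.inr hw.2⟩
  have hsub₂ : D₂ ⊆ logDomain R := fun w (hw : Real.log R < w.re) =>
    ⟨(log_half_lt_log hR).trans hw, Or.inl (ne_of_gt hw)⟩
  have ho₀ : IsOpen D₀ := (isOpen_lt continuous_const Complex.continuous_re).inter
    (isOpen_lt Complex.continuous_re continuous_const)
  have ho₁ : IsOpen D₁ := (isOpen_lt continuous_const Complex.continuous_re).inter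
    ((isOpen_lt continuous_const Complex.continuous_im).inter
      (isOpen_lt Complex.continuous_im continuous_const))
  have ho₂ : IsOpen D₂ := isOpen_lt continuous_const Complex.continuous_re
  have hc₀ : Convex ℝ D₀ := (convex_halfSpace_re_gt _).inter (convex_halfSpace_re_lt _)
  have hc₁ : Convex ℝ D₁ := (convex_halfSpace_re_gt _).inter
    ((convex_halfSpace_im_gt _).inter (convex_halfSpace_im_lt _))
  have hc₂ : Convex ℝ D₂ := convex_halfSpace_re_gt _
  have hπ := Real.pi_pos
  have hw₁ : ((w₀.re : ℂ) + Real.pi * Complex.I) ∈ D₀ ∩ D₁ := by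
    refine ⟨⟨?_, ?_⟩, ?_, ?_, ?_⟩ <;> simp [hw₀, hw₀', hπ]
  have hw₂ : (((Real.log R + 1 : ℝ) : ℂ) + Real.pi * Complex.I) ∈ D₁ ∩ D₂ := by
    have := log_half_lt_log hR
    have hre : ∀ c : ℝ, ((c : ℂ) + Real.pi * Complex.I).re = c := by simp
    have him : ∀ c : ℝ, ((c : ℂ) + Real.pi * Complex.I).im = Real.pi := by simp
    refine ⟨⟨?_, ?_, ?_⟩, ?_⟩ <;> rw [mem_ofPred_eq] <;> simp only [hre, him] <;> linarith
  obtain ⟨Φ₀, hΦ₀, hd₀⟩ := linearODE_exists ho₀ hc₀ (hD.mono hsub₀) ⟨hw₀, hw₀'⟩ v₀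
  obtain ⟨Φ₁, hΦ₁, hd₁⟩ := linearODE_exists ho₁ hc₁ (hD.mono hsub₁) hw₁.2
    (Φ₀ ((w₀.re : ℂ) + Real.pi * Complex.I))
  obtain ⟨Φ₂, hΦ₂, hd₂⟩ := linearODE_exists ho₂ hc₂ (hD.mono hsub₂) hw₂.2
    (Φ₁ (((Real.log R + 1 : ℝ) : ℂ) + Real.pi * Complex.I))
  have h01 : EqOn Φ₀ Φ₁ (D₀ ∩ D₁) := linearODE_unique (ho₀.inter ho₁)
    (hc₀.inter hc₁).isPreconnected (hD.continuousOn.mono (inter_subset_left.trans hsub₀))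
    (fun x hx => hd₀ x hx.1) (fun x hx => hd₁ x hx.2) hw₁ hΦ₁.symm
  have h12 : EqOn Φ₁ Φ₂ (D₁ ∩ D₂) := linearODE_unique (ho₁.inter ho₂)
    (hc₁.inter hc₂).isPreconnected (hD.continuousOn.mono (inter_subset_left.trans hsub₁))
    (fun x hx => hd₁ x hx.1) (fun x hx => hd₂ x hx.2) hw₂ hΦ₂.symm
  classical
  let Φ : ℂ → V := fun w =>
    if w.re < Real.log R then Φ₀ w else if Real.log R < w.re then Φ₂ w else Φ₁ w
  have he₀ : EqOn Φ Φ₀ D₀ := fun w hw => if_pos hw.2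
  have he₂ : EqOn Φ Φ₂ D₂ := fun w hw => by
    have hw' : Real.log R < w.re := hw
    simp only [Φ, if_neg hw'.not_gt, if_pos hw']
  have he₁ : EqOn Φ Φ₁ D₁ := fun w hw => by
    rcases lt_trichotomy w.re (Real.log R) with h | h | h
    · rw [← h01 ⟨⟨hw.1, h⟩, hw⟩, he₀ ⟨hw.1, h⟩]
    · simp [Φ, h]
    · rw [h12 ⟨hw, h⟩, he₂ h]
  have htrans : ∀ {D : Set ℂ} {Ψ : ℂ → V}, IsOpen D → EqOn Φ Ψ D →
      (∀ w ∈ D, HasDerivAt Ψ (logOp L w (Ψ w)) w) → ∀ w ∈ D, HasDerivAt Φ (logOp L w (Φ w)) w := by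
    intro D Ψ hDo he hd w hw
    rw [he hw]
    exact (hd w hw).congr_of_eventuallyEq (he.eventuallyEq_of_mem (hDo.mem_nhds hw))
  refine ⟨Φ, (he₀ ⟨hw₀, hw₀'⟩).trans hΦ₀, fun w hw => ?_⟩
  rcases lt_trichotomy w.re (Real.log R) with h | h | h
  · exact htrans ho₀ he₀ hd₀ w ⟨hw.1, h⟩
  · exact htrans ho₁ he₁ hd₁ w ⟨hw.1, hw.2.resolve_left (not_not.2 h)⟩
  · exact htrans ho₂ he₂ hd₂ w h

/-- If a turn multiplies the solution by `τ` at one point of a convex domain, it does so on the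
whole domain. -/
theorem shift_eq_of_shift_eq_at {L : ℂ → V →L[ℂ] V} {D : Set ℂ} (hDo : IsOpen D)
    (hDc : Convex ℝ D) (hL : ContinuousOn (logOp L) D)
    (hDs : ∀ w ∈ D, w + 2 * Real.pi * Complex.I ∈ D) {Φ : ℂ → V}
    (hΦ : ∀ w ∈ D, HasDerivAt Φ (logOp L w (Φ w)) w) {τ : V →L[ℂ] V}
    (hτ : ∀ z v, τ (L z v) = L z (τ v)) {w₁ : ℂ} (hw₁ : w₁ ∈ D)
    (h : Φ (w₁ + 2 * Real.pi * Complex.I) = τ (Φ w₁)) {w : ℂ} (hw : w ∈ D) :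
    Φ (w + 2 * Real.pi * Complex.I) = τ (Φ w) := by
  refine linearODE_unique (f := fun w => Φ (w + 2 * Real.pi * Complex.I)) (g := fun w => τ (Φ w))
    hDo hDc.isPreconnected hL (fun w hw => hasDerivAt_logOp_shift (hΦ _ (hDs w hw)))
    (fun w hw => ?_) hw₁ h hw
  have := τ.hasFDerivAt.comp_hasDerivAt w (hΦ w hw)
  refine this.congr_deriv ?_
  change τ (Complex.exp w • L (Complex.exp w) (Φ w)) = Complex.exp w • L (Complex.exp w) (τ (Φ w))
  rw [map_smul, hτ]

theorem isPreconnected_logDomain {R : ℝ} (hR : 0 < R) : IsPreconnected (logDomain R) := by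
  have hπ := Real.pi_pos
  have hlog := log_half_lt_log hR
  let D₀ : Set ℂ := {w | Real.log (R / 2) < w.re} ∩ {w | w.re < Real.log R}
  let D₁ : Set ℂ := {w | Real.log (R / 2) < w.re} ∩ ({w | 0 < w.im} ∩ {w | w.im < 2 * Real.pi})
  let D₂ : Set ℂ := {w | Real.log R < w.re}
  have hc₀ : IsPreconnected D₀ :=
    ((convex_halfSpace_re_gt _).inter (convex_halfSpace_re_lt _)).isPreconnected
  have hc₁ : IsPreconnected D₁ := ((convex_halfSpace_re_gt _).inter
    ((convex_halfSpace_im_gt _).inter (convex_halfSpace_im_lt _))).isPreconnected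
  have hc₂ : IsPreconnected D₂ := (convex_halfSpace_re_gt _).isPreconnected
  have hre : ∀ c : ℝ, ((c : ℂ) + Real.pi * Complex.I).re = c := by simp
  have him : ∀ c : ℝ, ((c : ℂ) + Real.pi * Complex.I).im = Real.pi := by simp
  have heq : logDomain R = (D₀ ∪ D₁) ∪ D₂ := by
    ext w
    constructor
    · rintro ⟨h1, h2 | h2⟩
      · rcases h2.lt_or_gt with h | h
        · exact Or.inl (Or.inl ⟨h1, h⟩)
        · exact Or.inr h
      · exact Or.inl (Or.inr ⟨h1, h2⟩)
    · rintro ((h | h) | h)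
      · exact ⟨h.1, Or.inl (ne_of_lt h.2)⟩
      · exact ⟨h.1, Or.inr h.2⟩
      · exact ⟨hlog.trans h, Or.inl (ne_of_gt h)⟩
  rw [heq]
  refine (hc₀.union
    ((((Real.log (R / 2) + Real.log R) / 2 : ℝ) : ℂ) + Real.pi * Complex.I) ?_ ?_ hc₁).union
    (((Real.log R + 1 : ℝ) : ℂ) + Real.pi * Complex.I) ?_ ?_ hc₂
  · exact ⟨by rw [mem_ofPred_eq, hre]; linarith, by rw [mem_ofPred_eq, hre]; linarith⟩
  · exact ⟨by rw [mem_ofPred_eq, hre]; linarith, by rw [mem_ofPred_eq, him]; linarith,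
      by rw [mem_ofPred_eq, him]; linarith⟩
  · exact Or.inr ⟨by rw [mem_ofPred_eq, hre]; linarith, by rw [mem_ofPred_eq, him]; linarith,
      by rw [mem_ofPred_eq, him]; linarith⟩
  · rw [mem_ofPred_eq, hre]
    linarith

end Development

/-! ### The loop around infinity -/

section Monodromy

variable {V : Type*} [NormedAddCommGroup V] [NormedSpace ℂ V]

theorem eventually_hasDerivAt_comp_log {R : ℝ} {L : ℂ → V →L[ℂ] V} {Φ : ℂ → V}
    (hΦ : ∀ w ∈ logDomain R, HasDerivAt Φ (logOp L w (Φ w)) w) {x : ℂ} (hx : x ∈ Complex.slitPlane)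
    (hxR : Complex.log x ∈ logDomain R) :
    ∀ᶠ z in 𝓝 x, HasDerivAt (fun z => Φ (Complex.log z)) (L z (Φ (Complex.log z))) z := by
  filter_upwards [Complex.isOpen_slitPlane.mem_nhds hx,
    (continuousAt_clog hx).eventually_mem ((isOpen_logDomain R).mem_nhds hxR)] with z hz hzR
  exact hasDerivAt_comp_of_logOp (Complex.exp_log (Complex.slitPlane_ne_zero hz))
    (Complex.hasDerivAt_log hz) (hΦ _ hzR)

theorem log_mem_logDomain {R : ℝ} (hR : 0 < R) {x : ℂ} (hx : R / 2 < ‖x‖)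
    (h : ‖x‖ ≠ R ∨ 0 < x.im) : Complex.log x ∈ logDomain R := by
  have hx0 : 0 < ‖x‖ := (half_pos hR).trans hx
  refine ⟨?_, ?_⟩
  · rw [Complex.log_re]
    exact Real.log_lt_log (half_pos hR) hx
  · rw [Complex.log_re, Complex.log_im]
    refine h.imp (fun h h' => h (Real.log_injOn_pos hx0 hR h')) fun h => ?_
    refine ⟨?_, (Complex.arg_le_pi x).trans_lt (by linarith [Real.pi_pos])⟩
    refine (Complex.arg_nonneg_iff.2 h.le).lt_of_ne fun h0 => ?_
    exact h.ne' (Complex.arg_eq_zero_iff.1 h0.symm).2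

/-- The vertical segment at the beginning of `loopInfty`. -/
theorem vertical_mem {R : ℝ} (hR : 0 < R) {t : ℝ} (ht : 0 ≤ t) :
    (3 * R / 4 + 2 * R * Complex.I * (3 * t) : ℂ) ∈ Complex.slitPlane ∧
    R / 2 < ‖(3 * R / 4 + 2 * R * Complex.I * (3 * t) : ℂ)‖ ∧
    (‖(3 * R / 4 + 2 * R * Complex.I * (3 * t) : ℂ)‖ ≠ R ∨
      0 < (3 * R / 4 + 2 * R * Complex.I * (3 * t) : ℂ).im) := by
  have hform : (3 * R / 4 + 2 * R * Complex.I * (3 * t) : ℂ) =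
      ((3 * R / 4 : ℝ) : ℂ) + ((6 * R * t : ℝ) : ℂ) * Complex.I := by
    push_cast
    ring
  rw [hform]
  have hre : (((3 * R / 4 : ℝ) : ℂ) + ((6 * R * t : ℝ) : ℂ) * Complex.I).re = 3 * R / 4 := by
    rw [Complex.add_re, Complex.ofReal_re, Complex.re_ofReal_mul, Complex.I_re, mul_zero, add_zero]
  have him : (((3 * R / 4 : ℝ) : ℂ) + ((6 * R * t : ℝ) : ℂ) * Complex.I).im = 6 * R * t := by
    rw [Complex.add_im, Complex.ofReal_im, Complex.im_ofReal_mul, Complex.I_im, mul_one, zero_add]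
  refine ⟨Or.inl (by rw [hre]; positivity), ?_, ?_⟩
  · refine lt_of_lt_of_le ?_ (Complex.re_le_norm _)
    rw [hre]
    linarith
  · rcases ht.eq_or_lt with rfl | ht
    · left
      rw [mul_zero, Complex.ofReal_zero, zero_mul, add_zero, Complex.norm_real,
        Real.norm_of_nonneg (by positivity)]
      linarith
    · right
      rw [him]
      positivity

/-- If the continuation along `loopInfty` multiplies a solution by `τ`, so does a turn around
infinity in the logarithmic plane. -/
theorem shift_eq_of_loopInfty [CompleteSpace V] {R : ℝ} (hR : 0 < R) {L : ℂ → V →L[ℂ] V}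
    (hL : DifferentiableOn ℂ L {x | R / 2 < ‖x‖ ∧ x ≠ R}) {Φ : ℂ → V}
    (hΦ : ∀ w ∈ logDomain R, HasDerivAt Φ (logOp L w (Φ w)) w) {τ : V →L[ℂ] V}
    (hτ : ∀ z v, τ (L z v) = L z (τ v)) {Y : ℝ → V}
    (hY : IsContinuationOn L (loopInfty R) (Icc 0 1) Y)
    (h0 : Y 0 = Φ (Complex.log ((3 * R / 4 : ℝ) : ℂ))) (h1 : Y 1 = τ (Y 0)) {w : ℂ}
    (hw : Real.log R < w.re) : Φ (w + 2 * Real.pi * Complex.I) = τ (Φ w) := by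
  have hU : IsOpen {x : ℂ | R / 2 < ‖x‖ ∧ x ≠ R} :=
    (isOpen_lt continuous_const continuous_norm).inter isOpen_ne
  -- the first third: the vertical segment
  let γ₁ : ℝ → ℂ := fun t => 3 * R / 4 + 2 * R * Complex.I * (3 * t)
  have hγ₁c : Continuous γ₁ := by fun_prop
  have hγ₁U : MapsTo γ₁ (Icc 0 (1 / 3)) {x : ℂ | R / 2 < ‖x‖ ∧ x ≠ R} := by
    intro t ht
    have := vertical_mem hR ht.1
    refine ⟨this.2.1, fun h => ?_⟩
    have h' : (3 * R / 4 + 2 * R * Complex.I * (3 * t) : ℂ) = R := h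
    rw [h'] at this
    rcases this.2.2 with h2 | h2
    · simp [abs_of_pos hR] at h2
    · simp at h2
  have hY₁ : IsContinuationOn L γ₁ (Icc 0 (1 / 3)) Y :=
    (hY.mono (Icc_subset_Icc le_rfl (by norm_num))).congr_path fun t ht => by
      simp only [loopInfty, if_pos ht.2, γ₁]
  have hΦ₁ : IsContinuationOn L γ₁ (Icc 0 (1 / 3)) fun t => Φ (Complex.log (γ₁ t)) := by
    intro t ht
    have := vertical_mem hR ht.1
    exact ⟨fun z => Φ (Complex.log z),
      eventually_hasDerivAt_comp_log hΦ this.1 (log_mem_logDomain hR this.2.1 this.2.2),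
      Eventually.of_forall fun s => rfl⟩
  have e₁ := hY₁.unique hU hL.continuousOn isPreconnected_Icc hγ₁c.continuousOn hγ₁U hΦ₁
    (t₀ := 0) (by norm_num) (by
      rw [h0]
      congr 2
      simp [γ₁])
  -- the last third: the vertical segment again, run backwards
  have hY₃ : IsContinuationOn L γ₁ (Icc 0 (1 / 3)) fun t => Y (1 - t) := by
    have hγ : ∀ s ∈ Icc (0 : ℝ) (1 / 3), loopInfty R (1 - s) = γ₁ s := by
      intro s hs
      have hs1 : ¬ (1 - s ≤ 1 / 3) := by linarith [hs.2]
      rcases hs.2.eq_or_lt with hs' | hs'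
      · subst hs'
        have h2 : (1 - 1 / 3 : ℝ) ≤ 2 / 3 := by norm_num
        simp only [loopInfty, if_neg hs1, if_pos h2, γ₁]
        have : (2 * Real.pi * Complex.I * (3 * ((1 - 1 / 3 : ℝ) : ℂ) - 1)) =
            2 * Real.pi * Complex.I := by
          push_cast
          ring
        rw [this, Complex.exp_two_pi_mul_I]
        push_cast
        ring
      · have hs2 : ¬ (1 - s ≤ 2 / 3) := by linarith
        simp only [loopInfty, if_neg hs1, if_neg hs2, γ₁]
        push_cast
        ring
    intro t ht
    obtain ⟨Z, hZ, hZY⟩ := hY (1 - t) ⟨by linarith [ht.2], by linarith [ht.1]⟩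
    rw [hγ t ht] at hZ
    refine ⟨Z, hZ, ?_⟩
    have htend : Tendsto (fun s : ℝ => 1 - s) (𝓝[Icc 0 (1 / 3)] t) (𝓝[Icc 0 1] (1 - t)) := by
      refine ((continuous_const.sub continuous_id).continuousWithinAt).tendsto_nhdsWithin ?_
      intro s hs
      exact ⟨by change 0 ≤ 1 - s; linarith [hs.2], by change 1 - s ≤ 1; linarith [hs.1]⟩
    filter_upwards [htend.eventually hZY, self_mem_nhdsWithin] with s hs hs'
    rw [hs, hγ s hs']
  have e₃ := hY₃.unique hU hL.continuousOn isPreconnected_Icc hγ₁c.continuousOn hγ₁U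
    (hY₁.map τ hτ) (t₀ := 0) (by norm_num) (by simpa using h1)
  -- the circle
  set b : ℂ := γ₁ (1 / 3) with hb
  have hbform : b = 3 * R / 4 + 2 * R * Complex.I := by
    simp only [hb, γ₁]
    push_cast
    ring
  have hb0 : b ≠ 0 := Complex.slitPlane_ne_zero (vertical_mem hR (t := 1 / 3) (by norm_num)).1
  have hbR : Real.log R < (Complex.log b).re := by
    rw [Complex.log_re]
    refine Real.log_lt_log hR (lt_of_lt_of_le ?_ (Complex.abs_im_le_norm b))
    have : b.im = 2 * R := by
      rw [hbform, show (3 * R / 4 + 2 * R * Complex.I : ℂ) =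
        ((3 * R / 4 : ℝ) : ℂ) + ((2 * R : ℝ) : ℂ) * Complex.I by push_cast; ring,
        Complex.add_im, Complex.ofReal_im, Complex.im_ofReal_mul, Complex.I_im, mul_one, zero_add]
    rw [this, abs_of_pos (by positivity)]
    linarith
  let ω : ℝ → ℂ := fun t => Complex.log b + ((2 * Real.pi * (3 * t - 1) : ℝ) : ℂ) * Complex.I
  have hωc : Continuous ω := by fun_prop
  have hωre : ∀ t, Real.log R < (ω t).re := by
    intro t
    simp only [ω]
    rw [Complex.add_re, Complex.re_ofReal_mul, Complex.I_re, mul_zero, add_zero]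
    exact hbR
  have hωdom : ∀ t, ω t ∈ logDomain R := fun t =>
    ⟨(log_half_lt_log hR).trans (hωre t), Or.inl (hωre t).ne'⟩
  have hωexp : ∀ t, Complex.exp (ω t) =
      b * Complex.exp (2 * Real.pi * Complex.I * (3 * t - 1)) := by
    intro t
    simp only [ω]
    rw [Complex.exp_add, Complex.exp_log hb0]
    congr 2
    push_cast
    ring
  have hY₂ : IsContinuationOn L (fun t => Complex.exp (ω t)) (Icc (1 / 3) (2 / 3)) Y :=
    (hY.mono (Icc_subset_Icc (by norm_num) (by norm_num))).congr_path fun t ht => by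
      simp only [hωexp]
      rcases ht.1.eq_or_lt with ht' | ht'
      · subst ht'
        simp only [loopInfty, if_pos (le_refl (1 / 3 : ℝ)), hbform]
        have : (2 * Real.pi * Complex.I * (3 * ((1 / 3 : ℝ) : ℂ) - 1)) = 0 := by
          push_cast
          ring
        rw [this, Complex.exp_zero]
        push_cast
        ring
      · simp only [loopInfty, if_neg ht'.not_ge, if_pos ht.2, hbform]
  have hΦ₂ : IsContinuationOn L (fun t => Complex.exp (ω t)) (Icc (1 / 3) (2 / 3))
      fun t => Φ (ω t) := by
    intro t ht
    obtain ⟨β, hβ0, hβ, hβ'⟩ := exists_log_branch (ω t)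
    refine ⟨fun z => Φ (β z), ?_, ?_⟩
    · have hc : ∀ᶠ z in 𝓝 (Complex.exp (ω t)), β z ∈ logDomain R :=
        hβ.self_of_nhds.2.continuousAt.eventually_mem
          ((isOpen_logDomain R).mem_nhds (by rw [hβ0]; exact hωdom t))
      filter_upwards [hβ, hc] with z hz hz'
      exact hasDerivAt_comp_of_logOp hz.1 hz.2 (hΦ _ hz')
    · filter_upwards [nhdsWithin_le_nhds (hωc.continuousAt.eventually hβ')] with s hs
      simp only [hs]
  have hω1 : ω (1 / 3) = Complex.log b := by
    simp only [ω]
    norm_num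
  have hω2 : ω (2 / 3) = Complex.log b + 2 * Real.pi * Complex.I := by
    simp only [ω]
    norm_num
  have e₂ := hY₂.unique hU hL.continuousOn isPreconnected_Icc
    (Complex.continuous_exp.comp hωc).continuousOn
    (fun t _ => exp_mem_of_mem_logDomain hR (hωdom t)) hΦ₂ (t₀ := 1 / 3) (by norm_num) (by
      rw [hω1]
      exact e₁ (by norm_num))
  have hb1 : Φ (Complex.log b + 2 * Real.pi * Complex.I) = τ (Φ (Complex.log b)) := by
    have h3 : Y (1 - 1 / 3) = τ (Y (1 / 3)) := e₃ (by norm_num : (1 / 3 : ℝ) ∈ Icc 0 (1 / 3))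
    have h2 : Y (2 / 3) = Φ (ω (2 / 3)) := e₂ (by norm_num)
    have h1' : Y (1 / 3) = Φ (Complex.log b) := e₁ (by norm_num : (1 / 3 : ℝ) ∈ Icc 0 (1 / 3))
    rw [← hω2, ← h2, ← h1', ← h3]
    norm_num
  have hsub : {w : ℂ | Real.log R < w.re} ⊆ logDomain R := fun w hw =>
    ⟨(log_half_lt_log hR).trans hw, Or.inl (ne_of_gt hw)⟩
  exact shift_eq_of_shift_eq_at (D := {w : ℂ | Real.log R < w.re})
    (isOpen_lt continuous_const Complex.continuous_re) (convex_halfSpace_re_gt _)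
    ((differentiableOn_logOp hL fun w hw => exp_mem_of_mem_logDomain hR hw).continuousOn.mono hsub)
    (fun w hw => by simpa using hw) (fun w hw => hΦ w (hsub hw)) hτ hbR hb1 hw

end Monodromy

/-! ### The monodromy around `R` -/

section AroundR

theorem cos_lt_neg_half {θ : ℝ} (h1 : 2 * Real.pi / 3 < θ) (h2 : θ < 4 * Real.pi / 3) :
    Real.cos θ < -(1 / 2) := by
  have h : 1 / 2 < Real.cos (θ - Real.pi) := by
    rw [← Real.cos_abs, ← Real.cos_pi_div_three]
    refine Real.cos_lt_cos_of_nonneg_of_le_pi (abs_nonneg _) (by linarith [Real.pi_pos]) ?_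
    rw [abs_lt]
    constructor <;> linarith
  rw [Real.cos_sub_pi] at h
  linarith

/-- Polar coordinates centred at `R`: a point close to `R` lies inside or outside the circle of
radius `R` according to its direction. -/
theorem around_R_position {R : ℝ} (hR : 0 < R) {v : ℂ} (hv : v.re < Real.log (R / 2)) :
    (R + Complex.exp v : ℂ) ∈ Complex.slitPlane ∧ R / 2 < ‖(R + Complex.exp v : ℂ)‖ ∧
    (Real.cos v.im < -(1 / 2) → ‖(R + Complex.exp v : ℂ)‖ < R) ∧
    (0 < Real.cos v.im → R < ‖(R + Complex.exp v : ℂ)‖) ∧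
    (R + Complex.exp v : ℂ).im = Real.exp v.re * Real.sin v.im := by
  set r := Real.exp v.re with hr
  have hr0 : 0 < r := Real.exp_pos _
  have hrR : r < R / 2 := by
    rw [hr, ← Real.exp_log (half_pos hR)]
    exact Real.exp_lt_exp.2 hv
  have hre : (R + Complex.exp v : ℂ).re = R + r * Real.cos v.im := by
    rw [Complex.add_re, Complex.ofReal_re, Complex.exp_re]
  have him : (R + Complex.exp v : ℂ).im = r * Real.sin v.im := by
    rw [Complex.add_im, Complex.ofReal_im, Complex.exp_im, zero_add]
  have hre2 : R / 2 < (R + Complex.exp v : ℂ).re := by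
    rw [hre]
    nlinarith [Real.neg_one_le_cos v.im]
  have hsq : ‖(R + Complex.exp v : ℂ)‖ ^ 2 = R ^ 2 + 2 * R * r * Real.cos v.im + r ^ 2 := by
    rw [← Complex.normSq_eq_norm_sq, Complex.normSq_apply, hre, him]
    linear_combination r ^ 2 * Real.sin_sq_add_cos_sq v.im
  refine ⟨Or.inl (by linarith), hre2.trans_le (Complex.re_le_norm _), fun h => ?_, fun h => ?_, him⟩
  · refine lt_of_pow_lt_pow_left₀ 2 hR.le ?_
    rw [hsq]
    nlinarith [mul_pos hR hr0]
  · refine lt_of_pow_lt_pow_left₀ 2 (norm_nonneg _) ?_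
    rw [hsq]
    nlinarith [mul_pos (mul_pos hR hr0) h, mul_pos hr0 hr0]

variable {V : Type*} [NormedAddCommGroup V] [NormedSpace ℂ V]

/-- A solution developed in the plane of `log x` becomes, in the variable `v = log (x - R)`, a
solution developed around `R`. -/
theorem hasDerivAt_logOp_around {R : ℝ} {L : ℂ → V →L[ℂ] V} {Φ : ℂ → V} {v : ℂ}
    (hx : (R + Complex.exp v : ℂ) ∈ Complex.slitPlane)
    (h : HasDerivAt Φ (logOp L (Complex.log (R + Complex.exp v))
      (Φ (Complex.log (R + Complex.exp v)))) (Complex.log (R + Complex.exp v))) :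
    HasDerivAt (fun v => Φ (Complex.log (R + Complex.exp v)))
      (logOp (fun z => L (R + z)) v (Φ (Complex.log (R + Complex.exp v)))) v := by
  have h1 := hasDerivAt_comp_of_logOp (Complex.exp_log (Complex.slitPlane_ne_zero hx))
    (Complex.hasDerivAt_log hx) h
  have h2 : HasDerivAt (fun z => Φ (Complex.log (R + z)))
      (L (R + Complex.exp v) (Φ (Complex.log (R + Complex.exp v)))) (Complex.exp v) :=
    h1.comp_const_add (R : ℂ) (Complex.exp v)
  exact hasDerivAt_logOp_of_solution (L := fun z => L (R + z)) h2

/-- **Monodromy around `R`.** If a solution, developed in the logarithmic plane, is multiplied by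
`τ₀` along the circles of radius between `R / 2` and `R` and by `τ` along the circles of radius
greater than `R`, then it is multiplied by `τ₀⁻¹ τ` along a small circle around `R`. -/
theorem exists_solution_around_R [CompleteSpace V] {R : ℝ} (hR : 0 < R) {L : ℂ → V →L[ℂ] V}
    (hL : DifferentiableOn ℂ L {x | R / 2 < ‖x‖ ∧ x ≠ R}) {Φ : ℂ → V}
    (hΦ : ∀ w ∈ logDomain R, HasDerivAt Φ (logOp L w (Φ w)) w) {τ₀ σ₀ τ : V →L[ℂ] V}
    (hσ₀ : ∀ v, σ₀ (τ₀ v) = v) (hcσ : ∀ z v, σ₀ (L z v) = L z (σ₀ v))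
    (hcτ : ∀ z v, τ (L z v) = L z (τ v))
    (h₀ : ∀ w : ℂ, Real.log (R / 2) < w.re → w.re < Real.log R →
      Φ (w + 2 * Real.pi * Complex.I) = τ₀ (Φ w))
    (h : ∀ w : ℂ, Real.log R < w.re → Φ (w + 2 * Real.pi * Complex.I) = τ (Φ w)) :
    ∃ Ψ : ℂ → V, (∀ v : ℂ, v.re < Real.log (R / 2) →
        HasDerivAt Ψ (logOp (fun z => L (R + z)) v (Ψ v)) v) ∧
      (∀ v : ℂ, v.re < Real.log (R / 2) → Ψ (v + 2 * Real.pi * Complex.I) = σ₀ (τ (Ψ v))) ∧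
      ∃ v₀ : ℂ, v₀.re < Real.log (R / 2) ∧ Ψ v₀ = Φ (Complex.log ((3 * R / 4 : ℝ) : ℂ)) := by
  have hπ := Real.pi_pos
  let D : Set ℂ := {v | v.re < Real.log (R / 2)}
  have hDo : IsOpen D := isOpen_lt Complex.continuous_re continuous_const
  have hDc : Convex ℝ D := convex_halfSpace_re_lt _
  have hL' : DifferentiableOn ℂ (logOp fun z => L (R + z)) D := by
    refine differentiableOn_logOp (U := {z | z ≠ 0 ∧ ‖z‖ < R / 2}) ?_ ?_
    · refine hL.comp (differentiableOn_id.const_add (R : ℂ)) fun z hz => ⟨?_, ?_⟩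
      · have h1 := norm_sub_norm_le (R : ℂ) (-z)
        rw [sub_neg_eq_add, norm_neg, Complex.norm_real, Real.norm_of_nonneg hR.le] at h1
        change R / 2 < ‖(R : ℂ) + z‖
        linarith [hz.2]
      · simpa using hz.1
    · intro v hv
      refine ⟨Complex.exp_ne_zero _, ?_⟩
      rw [Complex.norm_exp, ← Real.exp_log (half_pos hR)]
      exact Real.exp_lt_exp.2 hv
  -- a window of arguments around `R`
  let O : ℝ → ℝ → Set ℂ := fun a b => D ∩ ({v | a < v.im} ∩ {v | v.im < b})
  have hOo : ∀ a b, IsOpen (O a b) := fun a b => hDo.inter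
    ((isOpen_lt continuous_const Complex.continuous_im).inter
      (isOpen_lt Complex.continuous_im continuous_const))
  have hOc : ∀ a b, IsPreconnected (O a b) := fun a b =>
    (hDc.inter ((convex_halfSpace_im_gt _).inter (convex_halfSpace_im_lt _))).isPreconnected
  let q : ℝ → ℂ := fun θ => ((Real.log (R / 4) : ℝ) : ℂ) + (θ : ℂ) * Complex.I
  have hqre : ∀ θ, (q θ).re = Real.log (R / 4) := fun θ => by
    simp only [q]
    rw [Complex.add_re, Complex.ofReal_re, Complex.re_ofReal_mul, Complex.I_re, mul_zero, add_zero]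
  have hqim : ∀ θ, (q θ).im = θ := fun θ => by
    simp only [q]
    rw [Complex.add_im, Complex.ofReal_im, Complex.im_ofReal_mul, Complex.I_im, mul_one, zero_add]
  have hqD : ∀ θ, q θ ∈ D := fun θ => by
    change (q θ).re < _
    rw [hqre]
    exact Real.log_lt_log (by positivity) (by linarith)
  have hqO : ∀ {a b θ : ℝ}, a < θ → θ < b → q θ ∈ O a b := fun {a b θ} h1 h2 =>
    ⟨hqD θ, by rwa [mem_ofPred_eq, hqim], by rwa [mem_ofPred_eq, hqim]⟩
  have hqexp : ∀ θ, Complex.exp (q θ) = (R / 4 : ℝ) * Complex.exp (θ * Complex.I) := fun θ => by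
    simp only [q]
    rw [Complex.exp_add, ← Complex.ofReal_exp, Real.exp_log (by positivity)]
  let g₁ : ℂ → V := fun v => Φ (Complex.log (R + Complex.exp v))
  let g₂ : ℂ → V := fun v => σ₀ (Φ (Complex.log (R + Complex.exp v) + 2 * Real.pi * Complex.I))
  -- `g₁` continues the solution from direction `0` to direction `4π/3` around `R`
  have hg : ∀ v ∈ D, (Complex.log (R + Complex.exp v)) ∈ logDomain R →
      HasDerivAt g₁ (logOp (fun z => L (R + z)) v (g₁ v)) v := fun v hv hlog =>
    hasDerivAt_logOp_around (around_R_position hR hv).1 (hΦ _ hlog)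
  have hd₁ : ∀ v ∈ O 0 (4 * Real.pi / 3),
      HasDerivAt g₁ (logOp (fun z => L (R + z)) v (g₁ v)) v := by
    rintro v ⟨hv, hv0 : 0 < v.im, hv1 : v.im < 4 * Real.pi / 3⟩
    obtain ⟨-, hn, hlt, -, him⟩ := around_R_position hR hv
    refine hg v hv (log_mem_logDomain hR hn ?_)
    rcases lt_or_ge v.im Real.pi with hlt' | hge
    · right
      rw [him]
      exact mul_pos (Real.exp_pos _) (Real.sin_pos_of_pos_of_lt_pi hv0 hlt')
    · exact Or.inl (hlt (cos_lt_neg_half (by linarith) hv1)).ne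
  -- `g₂` continues it from direction `2π/3` to direction `5π/2`
  have hd₂ : ∀ v ∈ O (2 * Real.pi / 3) (5 * Real.pi / 2),
      HasDerivAt g₂ (logOp (fun z => L (R + z)) v (g₂ v)) v := by
    rintro v ⟨hv, hv0 : 2 * Real.pi / 3 < v.im, hv1 : v.im < 5 * Real.pi / 2⟩
    obtain ⟨hs, hn, hlt, hgt, him⟩ := around_R_position hR hv
    have hmem : Complex.log (R + Complex.exp v) + 2 * Real.pi * Complex.I ∈ logDomain R := by
      have hn0 : 0 < ‖(R + Complex.exp v : ℂ)‖ := (half_pos hR).trans hn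
      have hre : (Complex.log (R + Complex.exp v) + 2 * Real.pi * Complex.I).re =
          Real.log ‖(R + Complex.exp v : ℂ)‖ := by simp [Complex.log_re]
      have hmi : (Complex.log (R + Complex.exp v) + 2 * Real.pi * Complex.I).im =
          (R + Complex.exp v : ℂ).arg + 2 * Real.pi := by simp [Complex.log_im]
      refine ⟨?_, ?_⟩
      · rw [hre]
        exact Real.log_lt_log (half_pos hR) hn
      rw [hre, hmi]
      by_cases hne : ‖(R + Complex.exp v : ℂ)‖ = R
      · right
        have h1 : Real.pi < v.im := by
          by_contra! hle
          exact (hlt (cos_lt_neg_half hv0 (by linarith))).ne hne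
        have h2 : v.im < 2 * Real.pi := by
          by_contra! hle
          refine (hgt ?_).ne' hne
          rw [← Real.cos_sub_two_pi]
          exact Real.cos_pos_of_mem_Ioo ⟨by linarith, by linarith⟩
        have h3 : (R + Complex.exp v : ℂ).im < 0 := by
          rw [him]
          refine mul_neg_of_pos_of_neg (Real.exp_pos _) ?_
          rw [← Real.sin_sub_two_pi]
          exact Real.sin_neg_of_neg_of_neg_pi_lt (by linarith) (by linarith)
        have h4 := Complex.arg_neg_iff.2 h3
        have h5 := Complex.neg_pi_lt_arg (R + Complex.exp v : ℂ)
        constructor <;> linarith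
      · exact Or.inl fun h' => hne (Real.log_injOn_pos hn0 hR h')
    have h1 := hasDerivAt_logOp_around (Φ := fun w => Φ (w + 2 * Real.pi * Complex.I)) hs
      (hasDerivAt_logOp_shift (hΦ _ hmem))
    refine (σ₀.hasFDerivAt.comp_hasDerivAt v h1).congr_deriv ?_
    change σ₀ (Complex.exp v • L _ _) = Complex.exp v • L _ (σ₀ _)
    rw [map_smul, hcσ]
  -- and `σ₀ τ g₁` from direction `3π/2` to direction `3π`
  have hd₃ : ∀ v ∈ O (3 * Real.pi / 2) (3 * Real.pi),
      HasDerivAt (fun v => σ₀ (τ (g₁ v))) (logOp (fun z => L (R + z)) v (σ₀ (τ (g₁ v)))) v := by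
    rintro v ⟨hv, hv0 : 3 * Real.pi / 2 < v.im, hv1 : v.im < 3 * Real.pi⟩
    obtain ⟨-, hn, -, hgt, him⟩ := around_R_position hR hv
    have hmem : Complex.log (R + Complex.exp v) ∈ logDomain R := by
      refine log_mem_logDomain hR hn ?_
      rcases lt_or_ge (2 * Real.pi) v.im with hlt' | hge
      · right
        rw [him, ← Real.sin_sub_two_pi]
        exact mul_pos (Real.exp_pos _)
          (Real.sin_pos_of_pos_of_lt_pi (by linarith) (by linarith))
      · refine Or.inl (hgt ?_).ne'
        rw [← Real.cos_sub_two_pi]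
        exact Real.cos_pos_of_mem_Ioo ⟨by linarith, by linarith⟩
    refine ((σ₀.comp τ).hasFDerivAt.comp_hasDerivAt v (hg v hv hmem)).congr_deriv ?_
    change σ₀ (τ (Complex.exp v • L _ _)) = Complex.exp v • L _ (σ₀ (τ _))
    rw [map_smul, map_smul, hcτ, hcσ]
  obtain ⟨Ψ, hΨ₀, hΨ⟩ := linearODE_exists hDo hDc hL' (hqD Real.pi)
    (Φ (Complex.log ((3 * R / 4 : ℝ) : ℂ)))
  have hx₀ : (R + Complex.exp (q Real.pi) : ℂ) = ((3 * R / 4 : ℝ) : ℂ) := by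
    rw [hqexp, Complex.exp_pi_mul_I]
    push_cast
    ring
  have e₁ : EqOn Ψ g₁ (O 0 (4 * Real.pi / 3)) :=
    linearODE_unique (hOo _ _) (hOc _ _) (hL'.continuousOn.mono inter_subset_left)
      (fun v hv => hΨ v hv.1) hd₁ (hqO hπ (by linarith)) (by rw [hΨ₀, ← hx₀])
  have e₂ : EqOn Ψ g₂ (O (2 * Real.pi / 3) (5 * Real.pi / 2)) :=
    linearODE_unique (hOo _ _) (hOc _ _) (hL'.continuousOn.mono inter_subset_left)
      (fun v hv => hΨ v hv.1) hd₂ (hqO (θ := Real.pi) (by linarith) (by linarith)) (by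
        simp only [g₂]
        have hre : (Complex.log ((3 * R / 4 : ℝ) : ℂ)).re = Real.log (3 * R / 4) := by
          rw [Complex.log_re, Complex.norm_real, Real.norm_of_nonneg (by positivity)]
        rw [hΨ₀, hx₀, h₀, hσ₀]
        · rw [hre]
          exact Real.log_lt_log (by positivity) (by linarith)
        · rw [hre]
          exact Real.log_lt_log (by positivity) (by linarith))
  have e₃ : EqOn Ψ (fun v => σ₀ (τ (g₁ v))) (O (3 * Real.pi / 2) (3 * Real.pi)) :=
    linearODE_unique (hOo _ _) (hOc _ _) (hL'.continuousOn.mono inter_subset_left)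
      (fun v hv => hΨ v hv.1) hd₃ (hqO (θ := 2 * Real.pi) (by linarith) (by linarith)) (by
        rw [e₂ (hqO (θ := 2 * Real.pi) (by linarith) (by linarith))]
        simp only [g₂, g₁]
        rw [h]
        rw [Complex.log_re]
        refine Real.log_lt_log hR ((around_R_position hR (hqD _)).2.2.2.1 ?_)
        rw [hqim, Real.cos_two_pi]
        exact one_pos)
  have hq2 : q (Real.pi / 2) + 2 * Real.pi * Complex.I = q (5 * Real.pi / 2) := by
    simp only [q]
    push_cast
    ring
  have hstar : Ψ (q (Real.pi / 2) + 2 * Real.pi * Complex.I) =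
      (σ₀.comp τ) (Ψ (q (Real.pi / 2))) := by
    have hexp : Complex.exp (q (5 * Real.pi / 2)) = Complex.exp (q (Real.pi / 2)) := by
      rw [← hq2]
      exact Complex.exp_periodic _
    rw [hq2, e₃ (hqO (by linarith) (by linarith)),
      e₁ (hqO (θ := Real.pi / 2) (by linarith) (by linarith))]
    simp only [g₁, hexp]
    rfl
  refine ⟨Ψ, hΨ, fun v hv => ?_, q Real.pi, hqD _, hΨ₀⟩
  exact shift_eq_of_shift_eq_at hDo hDc hL'.continuousOn
    (fun w hw => by
      have hw' : w.re < Real.log (R / 2) := hw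
      change (w + 2 * Real.pi * Complex.I).re < _
      simpa using hw') hΨ (τ := σ₀.comp τ)
    (fun z v => by
      change σ₀ (τ (L _ v)) = L _ (σ₀ (τ v))
      rw [hcτ, hcσ]) (hqD _) hstar hv

end AroundR

/-! ### Rational systems and their residues -/

section Systems

open scoped Matrix.Norms.Operator

variable {k n : ℕ}

theorem differentiable_pVal (ε : Fin k → ℂ) : Differentiable ℂ (pVal ε) :=
  (pPoly ε).differentiable

theorem pVal_eq (ε : Fin k → ℂ) (x : ℂ) :
    pVal ε x = x ^ (k + 1) + ∑ j : Fin k, ε j * x ^ (j : ℕ) := by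
  simp [pVal, pPoly, Polynomial.eval_finsetSum]

theorem RationalSystem.differentiableAt_B (sys : RationalSystem k n) {R : ℝ} {ε : Fin k → ℂ}
    {x : ℂ} (hp : pVal ε x ≠ 0) (hx : x ≠ R) : DifferentiableAt ℂ (sys.B R ε) x := by
  have h1 : DifferentiableAt ℂ (fun x => (pVal ε x)⁻¹) x := (differentiable_pVal ε x).inv hp
  have h2 : DifferentiableAt ℂ (fun x : ℂ => (x - R)⁻¹) x :=
    (differentiableAt_id.sub_const _).inv (sub_ne_zero.2 hx)
  have h3 : DifferentiableAt ℂ (fun x : ℂ => ∑ m : Fin (k + 1), x ^ (m : ℕ) • sys.A m) x := by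
    fun_prop
  exact (h1.smul h3).add (h2.smul_const _)

theorem RationalSystem.IsSolutionAt.hasDerivAt {sys : RationalSystem k n} {R : ℝ} {ε : Fin k → ℂ}
    {X : ℂ → Matrix (Fin n) (Fin n) ℂ} {x : ℂ} (h : sys.IsSolutionAt R ε X x) :
    HasDerivAt X (sys.B R ε x * X x) x :=
  hasDerivAt_pi.2 fun i => hasDerivAt_pi.2 (h.2 i)

/-- The residue at `R`. -/
theorem RationalSystem.tendsto_residue_R (sys : RationalSystem k n) {R : ℝ} {ε : Fin k → ℂ}
    (hp : pVal ε R ≠ 0) : Tendsto (fun z : ℂ => z • sys.B R ε (R + z)) (𝓝[≠] 0) (𝓝 sys.Ahat) := by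
  have h1 : ContinuousAt (fun z : ℂ => (z * (pVal ε (R + z))⁻¹) •
      (∑ m : Fin (k + 1), ((R : ℂ) + z) ^ (m : ℕ) • sys.A m) + sys.Ahat) 0 := by
    have hpc : ContinuousAt (fun z : ℂ => (pVal ε (R + z))⁻¹) 0 := by
      refine ContinuousAt.inv₀ ?_ (by simpa using hp)
      exact ((differentiable_pVal ε).continuous.comp (by fun_prop)).continuousAt
    have : Continuous (fun z : ℂ => ∑ m : Fin (k + 1), ((R : ℂ) + z) ^ (m : ℕ) • sys.A m) := by
      fun_prop
    exact ((continuousAt_id.mul hpc).smul this.continuousAt).add continuousAt_const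
  have h2 := h1.tendsto.mono_left (nhdsWithin_le_nhds (s := {0}ᶜ))
  simp only [zero_mul, zero_smul, zero_add] at h2
  refine h2.congr' ?_
  filter_upwards [self_mem_nhdsWithin] with z (hz : z ≠ 0)
  rw [RationalSystem.B, smul_add, smul_smul, smul_smul, add_sub_cancel_left, mul_inv_cancel₀ hz,
    one_smul]

/-- The residue at infinity, up to the sign. -/
theorem RationalSystem.tendsto_residue_infty (sys : RationalSystem k n) (R : ℝ) (ε : Fin k → ℂ) :
    Tendsto (fun z : ℂ => -(z⁻¹ • sys.B R ε z⁻¹)) (𝓝[≠] 0)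
      (𝓝 (-(sys.A (Fin.last k) + sys.Ahat))) := by
  -- `z ^ (k + 1) p_ε (1 / z)` and `z ^ k A(1 / z)` are polynomials in `z`
  let q : ℂ → ℂ := fun z => 1 + ∑ j : Fin k, ε j * z ^ (k + 1 - (j : ℕ))
  let N : ℂ → Matrix (Fin n) (Fin n) ℂ := fun z => ∑ m : Fin (k + 1), z ^ (k - (m : ℕ)) • sys.A m
  have hq0 : q 0 = 1 := by
    simp only [q]
    rw [Finset.sum_eq_zero, add_zero]
    intro j _
    have : k + 1 - (j : ℕ) ≠ 0 := by omega
    simp [this]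
  have hN0 : N 0 = sys.A (Fin.last k) := by
    simp only [N]
    rw [Fin.sum_univ_castSucc, Finset.sum_eq_zero]
    · simp
    · intro j _
      have : k - (j.castSucc : ℕ) ≠ 0 := by simp; omega
      simp only [zero_pow this, zero_smul]
  have hqc : ContinuousAt (fun z => (q z)⁻¹) 0 :=
    ContinuousAt.inv₀ (by simp only [q]; fun_prop) (by rw [hq0]; exact one_ne_zero)
  have hNc : ContinuousAt N 0 := by simp only [N]; fun_prop
  have hRc : ContinuousAt (fun z : ℂ => (1 - z * R)⁻¹) 0 :=
    ContinuousAt.inv₀ (by fun_prop) (by simp)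
  have h1 : ContinuousAt (fun z => -((q z)⁻¹ • N z + (1 - z * R)⁻¹ • sys.Ahat)) 0 :=
    ((hqc.smul hNc).add (hRc.smul continuousAt_const)).neg
  have h2 := h1.tendsto.mono_left (nhdsWithin_le_nhds (s := {0}ᶜ))
  simp only [hq0, hN0, inv_one, one_smul, zero_mul, sub_zero] at h2
  refine h2.congr' ?_
  filter_upwards [self_mem_nhdsWithin] with z (hz : z ≠ 0)
  have hpq : pVal ε z⁻¹ = (z ^ (k + 1))⁻¹ * q z := by
    rw [pVal_eq]
    simp only [q]
    rw [mul_add, mul_one, Finset.mul_sum, inv_pow]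
    congr 1
    refine Finset.sum_congr rfl fun j _ => ?_
    have : z ^ (k + 1) = z ^ (k + 1 - (j : ℕ)) * z ^ (j : ℕ) := by
      rw [← pow_add]
      congr 1
      omega
    rw [this, inv_pow]
    field_simp
  have hAN : ∑ m : Fin (k + 1), z⁻¹ ^ (m : ℕ) • sys.A m = (z ^ k)⁻¹ • N z := by
    simp only [N]
    rw [Finset.smul_sum]
    refine Finset.sum_congr rfl fun m _ => ?_
    rw [smul_smul]
    congr 1
    have : z ^ k = z ^ (k - (m : ℕ)) * z ^ (m : ℕ) := by
      rw [← pow_add]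
      congr 1
      omega
    rw [this, inv_pow]
    field_simp
  rw [RationalSystem.B, hpq, hAN, smul_add, smul_smul, smul_smul, smul_smul]
  congr 3
  · rw [mul_inv, inv_inv, pow_succ]
    field_simp
  · rw [← mul_inv]
    congr 1
    field_simp

/-- The residue at a simple zero of `p_ε`. -/
theorem RationalSystem.tendsto_residue_zero (sys : RationalSystem k n) {R : ℝ} {ε : Fin k → ℂ}
    {a : ℂ} (ha : pVal ε a = 0) (ha' : (pPoly ε).derivative.eval a ≠ 0) (haR : a ≠ R) :
    Tendsto (fun z : ℂ => z • sys.B R ε (a + z)) (𝓝[≠] 0)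
      (𝓝 (((pPoly ε).derivative.eval a)⁻¹ • ∑ m : Fin (k + 1), a ^ (m : ℕ) • sys.A m)) := by
  have hd : Tendsto (fun z => z * (pVal ε (a + z))⁻¹) (𝓝[≠] 0)
      (𝓝 ((pPoly ε).derivative.eval a)⁻¹) := by
    have h1 := hasDerivAt_iff_tendsto_slope_zero.1 ((pPoly ε).hasDerivAt a)
    have h2 := h1.inv₀ ha'
    refine h2.congr fun z => ?_
    change (z⁻¹ • (pVal ε (a + z) - pVal ε a))⁻¹ = _
    rw [ha, sub_zero, smul_eq_mul, mul_inv, inv_inv]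
  have hN : Tendsto (fun z : ℂ => ∑ m : Fin (k + 1), (a + z) ^ (m : ℕ) • sys.A m) (𝓝[≠] 0)
      (𝓝 (∑ m : Fin (k + 1), a ^ (m : ℕ) • sys.A m)) := by
    have : Continuous (fun z : ℂ => ∑ m : Fin (k + 1), (a + z) ^ (m : ℕ) • sys.A m) := by
      fun_prop
    have := (this.tendsto 0).mono_left (nhdsWithin_le_nhds (s := {0}ᶜ))
    simpa using this
  have hR : Tendsto (fun z : ℂ => (z * (a + z - R)⁻¹) • sys.Ahat) (𝓝[≠] 0) (𝓝 0) := by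
    have h1 : ContinuousAt (fun z : ℂ => (z * (a + z - R)⁻¹) • sys.Ahat) 0 := by
      refine ContinuousAt.smul (continuousAt_id.mul (ContinuousAt.inv₀ (by fun_prop) ?_))
        continuousAt_const
      simpa [sub_eq_zero] using haR
    have := h1.tendsto.mono_left (nhdsWithin_le_nhds (s := {0}ᶜ))
    simpa using this
  have := (hd.smul hN).add hR
  rw [add_zero] at this
  refine this.congr fun z => ?_
  rw [RationalSystem.B, smul_add, smul_smul, smul_smul]

/-- Multiplication by `B(x)` on the left, as an operator. -/
noncomputable def RationalSystem.leftOp (sys : RationalSystem k n) (R : ℝ) (ε : Fin k → ℂ) (x : ℂ) :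
    Matrix (Fin n) (Fin n) ℂ →L[ℂ] Matrix (Fin n) (Fin n) ℂ :=
  ContinuousLinearMap.mul ℂ _ (sys.B R ε x)

theorem RationalSystem.differentiableAt_leftOp (sys : RationalSystem k n) {R : ℝ} {ε : Fin k → ℂ}
    {x : ℂ} (hp : pVal ε x ≠ 0) (hx : x ≠ R) : DifferentiableAt ℂ (sys.leftOp R ε) x :=
  ((ContinuousLinearMap.mul ℂ (Matrix (Fin n) (Fin n) ℂ)).differentiableAt).comp x
    (sys.differentiableAt_B hp hx)

/-- Multiplication by a constant matrix on the right, as an operator. -/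
noncomputable def rightMul (M : Matrix (Fin n) (Fin n) ℂ) :
    Matrix (Fin n) (Fin n) ℂ →L[ℂ] Matrix (Fin n) (Fin n) ℂ :=
  (ContinuousLinearMap.mul ℂ _).flip M

theorem RationalSystem.rightMul_leftOp (sys : RationalSystem k n) (R : ℝ) (ε : Fin k → ℂ) (x : ℂ)
    (M H : Matrix (Fin n) (Fin n) ℂ) :
    rightMul M (sys.leftOp R ε x H) = sys.leftOp R ε x (rightMul M H) :=
  mul_assoc _ _ _

theorem RationalSystem.IsContinuation.isContinuationOn {sys : RationalSystem k n} {R : ℝ}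
    {ε : Fin k → ℂ} {γ : ℝ → ℂ} {Y : ℝ → Matrix (Fin n) (Fin n) ℂ}
    (h : sys.IsContinuation R ε γ Y) : IsContinuationOn (sys.leftOp R ε) γ (Icc 0 1) Y :=
  fun t ht => by
    obtain ⟨Z, hZ, hY⟩ := h t ht
    exact ⟨Z, hZ.mono fun z hz => hz.hasDerivAt, hY⟩

end Systems

/-! ### The system at `ε = 0` -/

section AtZero

open scoped Matrix.Norms.Operator

variable {k n : ℕ}

theorem prod_reverse_finRange {M : Type*} [Monoid M] :
    ∀ (k : ℕ) (f : Fin k → M) (T : ℕ → M), T 0 = 1 → (∀ j : Fin k, T (j + 1) = f j * T j) →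
      ((List.finRange k).reverse.map f).prod = T k
  | 0, f, T, h0, _ => by simp [h0]
  | k + 1, f, T, h0, h => by
    have ih := prod_reverse_finRange k (fun j => f j.castSucc) T h0 (fun j => h j.castSucc)
    have hlast := h (Fin.last k)
    rw [Fin.val_last] at hlast
    rw [List.finRange_succ_last, List.reverse_append, List.map_append, List.prod_append, hlast,
      ← ih]
    simp [List.map_reverse, Function.comp_def]

theorem isUnit_of_eq_mul {A B C : Matrix (Fin n) (Fin n) ℂ} (hA : IsUnit A.det) (h : A = B * C) :
    IsUnit C.det := by
  rw [h, Matrix.det_mul] at hA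
  exact isUnit_of_mul_isUnit_right hA

/-- Nonresonance at `R` and at infinity of a system whose monodromies there have distinct
eigenvalues. The monodromy around `R` is the quotient of those along the circles of radius greater
than `R` and between `R / 2` and `R`. -/
theorem isNonresonant_of_monodromy {R : ℝ} (hR : 0 < R) {ε : Fin k → ℂ} {sys : RationalSystem k n}
    (hp : ∀ x : ℂ, R / 2 < ‖x‖ → pVal ε x ≠ 0) {Φ : ℂ → Matrix (Fin n) (Fin n) ℂ}
    (hΦ : ∀ w ∈ logDomain R, HasDerivAt Φ (logOp (sys.leftOp R ε) w (Φ w)) w)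
    {M₀ M : Matrix (Fin n) (Fin n) ℂ} (hM₀ : IsUnit M₀.det)
    (hu : IsUnit (Φ (Complex.log ((3 * R / 4 : ℝ) : ℂ))).det)
    (h₀ : ∀ w : ℂ, Real.log (R / 2) < w.re → w.re < Real.log R →
      Φ (w + 2 * Real.pi * Complex.I) = Φ w * M₀)
    (h : ∀ w : ℂ, Real.log R < w.re → Φ (w + 2 * Real.pi * Complex.I) = Φ w * M)
    (hM : HasDistinctEigenvalues M) (hMM₀ : HasDistinctEigenvalues (M * M₀⁻¹)) :
    IsNonresonant sys.Ahat ∧ IsNonresonant (sys.A (Fin.last k) + sys.Ahat) := by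
  have hL : DifferentiableOn ℂ (sys.leftOp R ε) {x | R / 2 < ‖x‖ ∧ x ≠ R} := fun x hx =>
    (sys.differentiableAt_leftOp (hp x hx.1) hx.2).differentiableWithinAt
  set w₀ : ℂ := Complex.log ((3 * R / 4 : ℝ) : ℂ) with hw₀
  have hnonzero : ∀ N : Matrix (Fin n) (Fin n) ℂ, N ≠ 0 → Φ w₀ * N ≠ 0 := fun N hN h0 =>
    hN (((Matrix.isUnit_iff_isUnit_det _).2 hu).mul_right_eq_zero.1 h0)
  constructor
  · refine isNonresonant_of_exp hMM₀ fun m hm => ?_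
    obtain ⟨N, hN0, hN⟩ := exists_mul_eq_smul_of_isRoot hm
    obtain ⟨Ψ, hΨ, hΨs, v₀, hv₀, hΨ₀⟩ := exists_solution_around_R hR hL hΦ (τ₀ := rightMul M₀)
      (σ₀ := rightMul M₀⁻¹) (τ := rightMul M)
      (fun v => by
        change v * M₀ * M₀⁻¹ = v
        rw [mul_assoc, Matrix.mul_nonsing_inv _ hM₀, mul_one])
      (fun z v => sys.rightMul_leftOp R ε z _ v) (fun z v => sys.rightMul_leftOp R ε z _ v) h₀ h
    have hT : Tendsto (fun z : ℂ => ContinuousLinearMap.mul ℂ (Matrix (Fin n) (Fin n) ℂ)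
        (z • sys.B R ε (R + z))) (𝓝[≠] 0) (𝓝 (ContinuousLinearMap.mul ℂ _ sys.Ahat)) :=
      ((ContinuousLinearMap.mul ℂ (Matrix (Fin n) (Fin n) ℂ)).continuous.tendsto _).comp
        (sys.tendsto_residue_R (hp R (by
          rw [Complex.norm_real, Real.norm_of_nonneg hR.le]
          linarith)))
    have hTc : ContinuousOn (fun z : ℂ => ContinuousLinearMap.mul ℂ (Matrix (Fin n) (Fin n) ℂ)
        (z • sys.B R ε (R + z))) {z | z ≠ 0 ∧ ‖z‖ < Real.exp (Real.log (R / 2))} := by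
      rintro z ⟨hz0, hz⟩
      rw [Real.exp_log (half_pos hR)] at hz
      have hz1 : R / 2 < ‖(R : ℂ) + z‖ := by
        have h1 := norm_sub_norm_le (R : ℂ) (-z)
        rw [sub_neg_eq_add, norm_neg, Complex.norm_real, Real.norm_of_nonneg hR.le] at h1
        linarith
      have hB : ContinuousAt (fun z : ℂ => sys.B R ε (R + z)) z :=
        ContinuousAt.comp (f := fun z : ℂ => (R : ℂ) + z)
          (sys.differentiableAt_B (hp _ hz1) (by simpa using hz0)).continuousAt (by fun_prop)
      exact ((ContinuousLinearMap.mul ℂ (Matrix (Fin n) (Fin n) ℂ)).continuous.continuousAt.comp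
        (continuousAt_id.smul hB)).continuousWithinAt
    obtain ⟨μ, g, hμ, hg, hgμ⟩ := exists_eigenvector_of_monodromy hT hTc
      (y := fun v => Ψ v * N) (m := m)
      (fun v hv => by
        refine ((rightMul N).hasFDerivAt.comp_hasDerivAt v (hΨ v hv)).congr_deriv ?_
        change (Complex.exp v • (sys.B R ε (R + Complex.exp v) * Ψ v)) * N =
          (Complex.exp v • sys.B R ε (R + Complex.exp v)) * (Ψ v * N)
        rw [smul_mul_assoc, smul_mul_assoc, mul_assoc])
      (fun v hv => by
        change Ψ _ * N = m • (Ψ v * N)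
        rw [hΨs v hv]
        change Ψ v * M * M₀⁻¹ * N = m • (Ψ v * N)
        rw [mul_assoc, mul_assoc, ← mul_assoc M, hN, mul_smul_comm])
      hv₀ (by
        change Ψ v₀ * N ≠ 0
        rw [hΨ₀]
        exact hnonzero N hN0)
    exact ⟨μ, hμ, isRoot_charpoly_of_mul_eq_smul hgμ hg⟩
  · refine isNonresonant_of_exp hM fun m hm => ?_
    obtain ⟨N, hN0, hN⟩ := exists_mul_eq_smul_of_isRoot hm
    have hsub : ∀ w : ℂ, Real.log R < w.re → w ∈ logDomain R := fun w hw =>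
      ⟨(log_half_lt_log hR).trans hw, Or.inl hw.ne'⟩
    have hw₀mem : w₀ ∈ logDomain R := by
      refine log_mem_logDomain hR ?_ (Or.inl ?_) <;>
        rw [Complex.norm_real, Real.norm_of_nonneg (by positivity)] <;> linarith
    have hne : ∀ w : ℂ, w ∈ logDomain R → Φ w * N ≠ 0 := by
      intro w hw h0
      refine hnonzero N hN0 ?_
      have hop := differentiableOn_logOp hL (fun w hw => exp_mem_of_mem_logDomain hR hw)
      exact linearODE_unique (f := fun w => Φ w * N) (g := fun _ => 0) (isOpen_logDomain R)
        (isPreconnected_logDomain hR) hop.continuousOn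
        (fun w hw => by
          refine ((rightMul N).hasFDerivAt.comp_hasDerivAt w (hΦ w hw)).congr_deriv ?_
          change (Complex.exp w • (sys.B R ε (Complex.exp w) * Φ w)) * N =
            Complex.exp w • (sys.B R ε (Complex.exp w) * (Φ w * N))
          rw [smul_mul_assoc, mul_assoc])
        (fun w _ => by simpa using hasDerivAt_const w (0 : Matrix (Fin n) (Fin n) ℂ)) hw
        (by simpa using h0) hw₀mem
    have hturn : ∀ w : ℂ, Real.log R < w.re →
        Φ (w + 2 * Real.pi * Complex.I) * N = m • (Φ w * N) := by
      intro w hw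
      rw [h w hw, mul_assoc, hN, mul_smul_comm]
    have hm0 : m ≠ 0 := by
      rintro rfl
      have hw1 : Real.log R < ((Real.log R + 1 : ℝ) : ℂ).re := by
        rw [Complex.ofReal_re]
        linarith
      refine hne _ (hsub (((Real.log R + 1 : ℝ) : ℂ) + 2 * Real.pi * Complex.I)
        (by simp)) ?_
      rw [hturn _ hw1, zero_smul]
    -- the variable `1 / x` at infinity
    have hT : Tendsto (fun z : ℂ => ContinuousLinearMap.mul ℂ (Matrix (Fin n) (Fin n) ℂ)
        (-(z⁻¹ • sys.B R ε z⁻¹))) (𝓝[≠] 0)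
        (𝓝 (ContinuousLinearMap.mul ℂ _ (-(sys.A (Fin.last k) + sys.Ahat)))) :=
      ((ContinuousLinearMap.mul ℂ (Matrix (Fin n) (Fin n) ℂ)).continuous.tendsto _).comp
        (sys.tendsto_residue_infty R ε)
    have hTc : ContinuousOn (fun z : ℂ => ContinuousLinearMap.mul ℂ (Matrix (Fin n) (Fin n) ℂ)
        (-(z⁻¹ • sys.B R ε z⁻¹))) {z | z ≠ 0 ∧ ‖z‖ < Real.exp (-Real.log R)} := by
      rintro z ⟨hz0, hz⟩
      rw [Real.exp_neg, Real.exp_log hR] at hz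
      have hz1 : R < ‖z⁻¹‖ := by
        rw [norm_inv]
        exact (lt_inv_comm₀ hR (norm_pos_iff.2 hz0)).2 hz
      have hB : ContinuousAt (fun z : ℂ => sys.B R ε z⁻¹) z := by
        refine ContinuousAt.comp (f := fun z : ℂ => z⁻¹)
          (sys.differentiableAt_B (hp _ (by linarith)) ?_).continuousAt
          (continuousAt_inv₀ hz0)
        intro h'
        rw [h', Complex.norm_real, Real.norm_of_nonneg hR.le] at hz1
        exact lt_irrefl _ hz1
      exact ((ContinuousLinearMap.mul ℂ (Matrix (Fin n) (Fin n) ℂ)).continuous.continuousAt.comp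
        (((continuousAt_inv₀ hz0).smul hB).neg)).continuousWithinAt
    obtain ⟨μ, g, hμ, hg, hgμ⟩ := exists_eigenvector_of_monodromy hT hTc
      (y := fun v => Φ (-v) * N) (m := m⁻¹) (v₀ := ((-(Real.log R + 1) : ℝ) : ℂ))
      (fun v hv => by
        have hv' : Real.log R < (-v).re := by
          rw [Complex.neg_re]
          linarith
        have h1 := (hΦ _ (hsub _ hv')).scomp v (hasDerivAt_neg v)
        refine ((rightMul N).hasFDerivAt.comp_hasDerivAt v h1).congr_deriv ?_
        change ((-1 : ℂ) • (Complex.exp (-v) • (sys.B R ε (Complex.exp (-v)) * Φ (-v)))) * N =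
          (-((Complex.exp v)⁻¹ • sys.B R ε (Complex.exp v)⁻¹)) * (Φ (-v) * N)
        rw [← Complex.exp_neg, neg_one_smul, neg_mul, neg_mul, smul_mul_assoc, smul_mul_assoc,
          mul_assoc])
      (fun v hv => by
        have hv' : Real.log R < (-(v + 2 * Real.pi * Complex.I)).re := by
          simp only [Complex.neg_re, Complex.add_re]
          simp
          linarith
        have h1 := hturn _ hv'
        change Φ _ * N = m⁻¹ • (Φ (-v) * N)
        rw [show -v = -(v + 2 * Real.pi * Complex.I) + 2 * Real.pi * Complex.I by ring, h1,
          inv_smul_smul₀ hm0])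
      (by
        rw [Complex.ofReal_re]
        linarith)
      (by
        refine hne _ (hsub _ ?_)
        rw [Complex.neg_re, Complex.ofReal_re]
        linarith)
    refine ⟨-μ, ?_, ?_⟩
    · rw [mul_neg, Complex.exp_neg, hμ, inv_inv]
    · refine isRoot_charpoly_of_mul_eq_smul (g := g) ?_ hg
      have h2 : (-(sys.A (Fin.last k) + sys.Ahat)) * g = μ • g := hgμ
      rw [neg_mul] at h2
      rw [neg_smul, ← h2, neg_neg]

end AtZero

section Sectors

open scoped Matrix.Norms.Operator

variable {k n : ℕ}

theorem exp_mem_circSector {R a b : ℝ} (hR : 0 < R) {w : ℂ} (hw : w.re < Real.log R)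
    (ha : a < w.im) (hb : w.im < b) : Complex.exp w ∈ circSector R a b := by
  refine ⟨Real.exp w.re, ⟨Real.exp_pos _, ?_⟩, w.im, ⟨ha, hb⟩, ?_⟩
  · rw [← Real.exp_log hR]
    exact Real.exp_lt_exp.2 hw
  · rw [Complex.ofReal_exp, ← Complex.exp_add, Complex.re_add_im]

/-- The point of modulus `3R/4` and argument `θ` in the logarithmic plane. -/
noncomputable def logPoint (R θ : ℝ) : ℂ :=
  ((Real.log (3 * R / 4) : ℝ) : ℂ) + (θ : ℂ) * Complex.I

theorem logPoint_re (R θ : ℝ) : (logPoint R θ).re = Real.log (3 * R / 4) := by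
  rw [logPoint, Complex.add_re, Complex.ofReal_re, Complex.re_ofReal_mul, Complex.I_re, mul_zero,
    add_zero]

theorem logPoint_im (R θ : ℝ) : (logPoint R θ).im = θ := by
  rw [logPoint, Complex.add_im, Complex.ofReal_im, Complex.im_ofReal_mul, Complex.I_im, mul_one,
    zero_add]

theorem logPoint_re_mem {R : ℝ} (hR : 0 < R) (θ : ℝ) :
    Real.log (R / 2) < (logPoint R θ).re ∧ (logPoint R θ).re < Real.log R := by
  rw [logPoint_re]
  exact ⟨Real.log_lt_log (by positivity) (by linarith),
    Real.log_lt_log (by positivity) (by linarith)⟩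

theorem logPoint_zero {R : ℝ} (hR : 0 < R) :
    logPoint R 0 = Complex.log ((3 * R / 4 : ℝ) : ℂ) := by
  rw [logPoint, Complex.ofReal_log (by positivity), Complex.ofReal_zero, zero_mul, add_zero]

/-- On a range of arguments where the development `Φ` and a sectorial solution `X` live, a relation
`Φ = X N` propagates from one point to another. -/
theorem eq_mul_of_eq_mul_at {R : ℝ} (hR : 0 < R) {ε : Fin k → ℂ} {sys : RationalSystem k n}
    (hL : DifferentiableOn ℂ (sys.leftOp R ε) {x | R / 2 < ‖x‖ ∧ x ≠ R})
    {Φ : ℂ → Matrix (Fin n) (Fin n) ℂ}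
    (hΦ : ∀ w ∈ logDomain R, HasDerivAt Φ (logOp (sys.leftOp R ε) w (Φ w)) w)
    {X : ℂ → Matrix (Fin n) (Fin n) ℂ} {a b : ℝ}
    (hX : ∀ x ∈ circSector R a b, sys.IsSolutionAt R ε X x) {N : Matrix (Fin n) (Fin n) ℂ}
    {θ θ' : ℝ} (hθ : θ ∈ Ioo a b) (hθ' : θ' ∈ Ioo a b)
    (h : Φ (logPoint R θ) = X (Complex.exp (logPoint R θ)) * N) :
    Φ (logPoint R θ') = X (Complex.exp (logPoint R θ')) * N := by
  let D : Set ℂ := ({w | Real.log (R / 2) < w.re} ∩ {w | w.re < Real.log R}) ∩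
    ({w | a < w.im} ∩ {w | w.im < b})
  have hDo : IsOpen D := ((isOpen_lt continuous_const Complex.continuous_re).inter
    (isOpen_lt Complex.continuous_re continuous_const)).inter
      ((isOpen_lt continuous_const Complex.continuous_im).inter
        (isOpen_lt Complex.continuous_im continuous_const))
  have hDc : Convex ℝ D := ((convex_halfSpace_re_gt _).inter (convex_halfSpace_re_lt _)).inter
    ((convex_halfSpace_im_gt _).inter (convex_halfSpace_im_lt _))
  have hsub : D ⊆ logDomain R := fun w hw => ⟨hw.1.1, Or.inl (ne_of_lt hw.1.2)⟩
  have hmem : ∀ {θ : ℝ}, θ ∈ Ioo a b → logPoint R θ ∈ D := fun {θ} hθ =>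
    ⟨logPoint_re_mem hR θ, by rw [mem_ofPred_eq, logPoint_im]; exact hθ.1,
      by rw [mem_ofPred_eq, logPoint_im]; exact hθ.2⟩
  have hop := differentiableOn_logOp hL (fun w hw => exp_mem_of_mem_logDomain hR (hsub hw))
  exact linearODE_unique (g := fun w => X (Complex.exp w) * N) hDo hDc.isPreconnected
    hop.continuousOn (fun w hw => hΦ w (hsub hw))
    (fun w hw => by
      have h1 := hasDerivAt_logOp_of_solution (L := sys.leftOp R ε)
        (hX _ (exp_mem_circSector hR hw.1.2 hw.2.1 hw.2.2)).hasDerivAt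
      refine ((rightMul N).hasFDerivAt.comp_hasDerivAt w h1).congr_deriv ?_
      change (Complex.exp w • (sys.B R ε (Complex.exp w) * X (Complex.exp w))) * N =
        Complex.exp w • (sys.B R ε (Complex.exp w) * (X (Complex.exp w) * N))
      rw [smul_mul_assoc, mul_assoc]) (hmem hθ) h (hmem hθ')

variable [NeZero k]

theorem fin_zero_sub_one (hk : k - 1 < k) : (0 - 1 : Fin k) = ⟨k - 1, hk⟩ := by
  obtain ⟨k, rfl⟩ := Nat.exists_eq_succ_of_ne_zero (NeZero.ne k)
  rw [sub_eq_iff_eq_add]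
  ext
  rw [Fin.val_add, Fin.coe_ofNat_eq_mod, Fin.coe_ofNat_eq_mod]
  simp

theorem fin_succ_sub_one {j : ℕ} (hj : j + 1 < k) :
    (⟨j + 1, hj⟩ - 1 : Fin k) = ⟨j, by omega⟩ := by
  obtain ⟨k, rfl⟩ := Nat.exists_eq_succ_of_ne_zero (NeZero.ne k)
  rw [sub_eq_iff_eq_add]
  ext
  rw [Fin.val_add]
  have : (1 : Fin (k + 1)).val = 1 := by
    rw [Fin.coe_ofNat_eq_mod]
    exact Nat.mod_eq_of_lt (by omega)
  rw [this, Nat.mod_eq_of_lt (by simpa using hj)]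

/-- The rational system at `ε = 0` is nonresonant at `R` and at infinity: following the sectors once
around the circle of radius `3R/4` gives `totalMonodromy CU CL`, so that the monodromy around `R` is
conjugate to `Minf * (totalMonodromy CU CL)⁻¹`. -/
theorem IsRealizationAtZero.isNonresonant {ρ R : ℝ} (hR : 0 < R) {Λ : FormalInvariants k n ρ}
    {CU CL : Fin k → Matrix (Fin n) (Fin n) ℂ} {Minf : Matrix (Fin n) (Fin n) ℂ}
    {T : NormalizingMonomials k n} {sys : RationalSystem k n}
    (h : IsRealizationAtZero R Λ CU CL Minf T sys) (hMinf : HasDistinctEigenvalues Minf)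
    (hMR : HasDistinctEigenvalues (Minf * (totalMonodromy CU CL)⁻¹)) :
    IsNonresonant sys.Ahat ∧ IsNonresonant (sys.A (Fin.last k) + sys.Ahat) := by
  obtain ⟨η, hη, Xp, Xm, -, -, -, -, hXp, hXm, -, -, -, -, -, -, hU, hLo, Y, hY, hY0, hY1⟩ :=
    h.stokes
  have hπ := Real.pi_pos
  have hk : 0 < k := Nat.pos_of_ne_zero (NeZero.ne k)
  have hk' : (0 : ℝ) < k := by exact_mod_cast hk
  have hp : ∀ x : ℂ, R / 2 < ‖x‖ → pVal (0 : Fin k → ℂ) x ≠ 0 := by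
    intro x hx
    have hx0 : x ≠ 0 := by
      rintro rfl
      rw [norm_zero] at hx
      linarith
    rw [pVal_eq]
    simpa using hx0
  have hL : DifferentiableOn ℂ (sys.leftOp R 0) {x | R / 2 < ‖x‖ ∧ x ≠ R} := fun x hx =>
    (sys.differentiableAt_leftOp (hp x hx.1) hx.2).differentiableWithinAt
  obtain ⟨Φ, hΦ0, hΦ⟩ := exists_logDevelopment hR hL (w₀ := logPoint R 0)
    (logPoint_re_mem hR 0).1 (logPoint_re_mem hR 0).2 (Xm (0 - 1) ((3 * R / 4 : ℝ) : ℂ))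
  have hexp0 : Complex.exp (logPoint R 0) = ((3 * R / 4 : ℝ) : ℂ) := by
    rw [logPoint_zero hR, Complex.exp_log]
    exact_mod_cast (by positivity : (3 * R / 4 : ℝ) ≠ 0)
  have hexp : ∀ {a b θ : ℝ}, θ ∈ Ioo a b → Complex.exp (logPoint R θ) ∈ circSector R a b :=
    fun {a b θ} hθ => exp_mem_circSector hR (logPoint_re_mem hR θ).2
      (by rw [logPoint_im]; exact hθ.1) (by rw [logPoint_im]; exact hθ.2)
  -- inequalities between the arguments
  have harg : ∀ j : ℝ, 2 * Real.pi * j / k < Real.pi * (2 * j + 1) / k ∧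
      Real.pi * (2 * j + 1) / k < 2 * Real.pi * (j + 1) / k := fun j => by
    constructor <;> exact div_lt_div_of_pos_right (by linarith) hk'
  have hUmem : ∀ j : Fin k, Complex.exp (logPoint R (2 * Real.pi * (j : ℕ) / k)) ∈
      interUZero k R η j := fun j => hexp ⟨by linarith [hη.1], by linarith [hη.1]⟩
  have hLmem : ∀ j : Fin k, Complex.exp (logPoint R (Real.pi * (2 * (j : ℕ) + 1) / k)) ∈
      interLZero k R η j := fun j => hexp ⟨by linarith [hη.1], by linarith [hη.1]⟩
  have hUp : ∀ j : Fin k, Complex.exp (logPoint R (2 * Real.pi * (j : ℕ) / k)) ∈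
      plusZero k R η j := fun j =>
    hexp ⟨by linarith [hη.1], by linarith [hη.1, (harg (j : ℕ)).1]⟩
  have hLp : ∀ j : Fin k, Complex.exp (logPoint R (Real.pi * (2 * (j : ℕ) + 1) / k)) ∈
      plusZero k R η j := fun j =>
    hexp ⟨by linarith [hη.1, (harg (j : ℕ)).1], by linarith [hη.1]⟩
  have hLm : ∀ j : Fin k, Complex.exp (logPoint R (Real.pi * (2 * (j : ℕ) + 1) / k)) ∈
      minusZero k R η j := fun j =>
    hexp ⟨by linarith [hη.1], by linarith [hη.1, (harg (j : ℕ)).2]⟩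
  have hCU : ∀ j, IsUnit (CU j).det := fun j =>
    isUnit_of_eq_mul (hXp j _ (hUp j)).1 (hU j _ (hUmem j))
  have hCL : ∀ j, IsUnit (CL j).det := fun j =>
    isUnit_of_eq_mul (hXm j _ (hLm j)).1 (hLo j _ (hLmem j))
  -- one step of the continuation around the circle of radius `3R/4`
  have step : ∀ (j : Fin k) (N : Matrix (Fin n) (Fin n) ℂ),
      Φ (logPoint R (2 * Real.pi * (j : ℕ) / k)) =
        Xm (j - 1) (Complex.exp (logPoint R (2 * Real.pi * (j : ℕ) / k))) * N →
      Φ (logPoint R (2 * Real.pi * ((j : ℕ) + 1) / k)) =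
        Xm j (Complex.exp (logPoint R (2 * Real.pi * ((j : ℕ) + 1) / k))) *
          ((CL j)⁻¹ * (CU j)⁻¹ * N) := by
    intro j N hN
    have hj := harg (j : ℕ)
    have h1 : Φ (logPoint R (2 * Real.pi * (j : ℕ) / k)) =
        Xp j (Complex.exp (logPoint R (2 * Real.pi * (j : ℕ) / k))) * ((CU j)⁻¹ * N) := by
      rw [hU j _ (hUmem j), Matrix.mul_assoc, Matrix.mul_nonsing_inv_cancel_left _ _ (hCU j), hN]
    have h2 := eq_mul_of_eq_mul_at hR hL hΦ (hXp j)
      (θ' := Real.pi * (2 * (j : ℕ) + 1) / k)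
      ⟨by linarith [hη.1], by linarith [hη.1]⟩ ⟨by linarith [hη.1], by linarith [hη.1]⟩ h1
    have h3 : Φ (logPoint R (Real.pi * (2 * (j : ℕ) + 1) / k)) =
        Xm j (Complex.exp (logPoint R (Real.pi * (2 * (j : ℕ) + 1) / k))) *
          ((CL j)⁻¹ * (CU j)⁻¹ * N) := by
      rw [hLo j _ (hLmem j), Matrix.mul_assoc (CL j)⁻¹, Matrix.mul_assoc,
        Matrix.mul_nonsing_inv_cancel_left _ _ (hCL j),
        h2]
    exact eq_mul_of_eq_mul_at hR hL hΦ (hXm j)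
      ⟨by linarith [hη.1], by linarith [hη.1]⟩ ⟨by linarith [hη.1], by linarith [hη.1]⟩ h3
  let P : ℕ → Matrix (Fin n) (Fin n) ℂ := fun j => Nat.rec 1
    (fun j N => if hj : j < k then (CL ⟨j, hj⟩)⁻¹ * (CU ⟨j, hj⟩)⁻¹ * N else N) j
  have hPs : ∀ j : Fin k, P (j + 1) = (CL j)⁻¹ * (CU j)⁻¹ * P j := fun j => by
    simp only [P, dif_pos j.2]
  have hPtot : P k = totalMonodromy CU CL :=
    (prod_reverse_finRange k (fun j => (CL j)⁻¹ * (CU j)⁻¹) P rfl hPs).symm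
  have hall : ∀ j (hj : j < k), Φ (logPoint R (2 * Real.pi * ((j : ℝ) + 1) / k)) =
      Xm ⟨j, hj⟩ (Complex.exp (logPoint R (2 * Real.pi * ((j : ℝ) + 1) / k))) * P (j + 1) := by
    intro j
    induction j with
    | zero =>
      intro hj
      have := step ⟨0, hj⟩ 1 (by
        have hz : logPoint R (2 * Real.pi * ((0 : ℕ) : ℝ) / k) = logPoint R 0 := by simp
        rw [hz, hexp0, hΦ0, mul_one]
        rfl)
      rw [hPs ⟨0, hj⟩]
      exact this
    | succ j ih =>
      intro hj
      have h1 := ih (by omega)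
      have := step ⟨j + 1, hj⟩ (P (j + 1)) (by
        rw [fin_succ_sub_one hj]
        push_cast
        exact h1)
      rw [hPs ⟨j + 1, hj⟩]
      exact this
  have hM₀ : IsUnit (totalMonodromy CU CL).det := by
    rw [← hPtot]
    have : ∀ j ≤ k, IsUnit (P j).det := by
      intro j
      induction j with
      | zero => intro _; simp [P]
      | succ j ih =>
        intro hj
        rw [hPs ⟨j, hj⟩, Matrix.det_mul, Matrix.det_mul]
        exact (((Matrix.isUnit_nonsing_inv_det _ (hCL _)).mul
          (Matrix.isUnit_nonsing_inv_det _ (hCU _)))).mul (ih (by omega))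
    exact this k le_rfl
  have hx₀ : ((3 * R / 4 : ℝ) : ℂ) ∈ minusZero k R η (0 - 1) := by
    rw [fin_zero_sub_one (by omega)]
    refine ⟨3 * R / 4, ⟨by positivity, by linarith⟩, 2 * Real.pi, ⟨?_, ?_⟩, ?_⟩
    · have h1 := (harg ((k - 1 : ℕ) : ℝ)).2
      have h2 : 2 * Real.pi * (((k - 1 : ℕ) : ℝ) + 1) / k = 2 * Real.pi := by
        rw [Nat.cast_sub hk]
        push_cast
        field_simp
        ring
      rw [h2] at h1
      have := hη.1
      change Real.pi * (2 * ((k - 1 : ℕ) : ℝ) + 1) / k - η < 2 * Real.pi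
      linarith
    · have h2 : 2 * Real.pi * (((k - 1 : ℕ) : ℝ) + 1) / k = 2 * Real.pi := by
        rw [Nat.cast_sub hk]
        push_cast
        field_simp
        ring
      change 2 * Real.pi < 2 * Real.pi * (((k - 1 : ℕ) : ℝ) + 1) / k + η
      rw [h2]
      linarith [hη.1]
    · push_cast
      rw [Complex.exp_two_pi_mul_I, mul_one]
  have hX₀ : IsUnit (Xm (0 - 1) ((3 * R / 4 : ℝ) : ℂ)).det := (hXm _ _ hx₀).1
  have hturn : Φ (logPoint R 0 + 2 * Real.pi * Complex.I) =
      rightMul (totalMonodromy CU CL) (Φ (logPoint R 0)) := by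
    have h1 := hall (k - 1) (by omega)
    have h2 : 2 * Real.pi * (((k - 1 : ℕ) : ℝ) + 1) / k = 2 * Real.pi := by
      rw [Nat.cast_sub hk]
      push_cast
      field_simp
      ring
    have h3 : logPoint R (2 * Real.pi) = logPoint R 0 + 2 * Real.pi * Complex.I := by
      simp [logPoint]
    rw [h2, h3, Complex.exp_periodic, hexp0, Nat.sub_add_cancel hk, hPtot,
      ← fin_zero_sub_one (by omega)] at h1
    rw [h1, hΦ0]
    rfl
  have hsub : ({w : ℂ | Real.log (R / 2) < w.re} ∩ {w | w.re < Real.log R}) ⊆ logDomain R :=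
    fun w hw => ⟨hw.1, Or.inl (ne_of_lt hw.2)⟩
  have hop := differentiableOn_logOp hL (fun w hw => exp_mem_of_mem_logDomain hR hw)
  refine isNonresonant_of_monodromy hR hp hΦ hM₀ (M := Minf) ?_ ?_ ?_ hMinf hMR
  · rw [← logPoint_zero hR, hΦ0]
    exact hX₀
  · intro w hw hw'
    exact shift_eq_of_shift_eq_at
      (D := {w : ℂ | Real.log (R / 2) < w.re} ∩ {w | w.re < Real.log R})
      ((isOpen_lt continuous_const Complex.continuous_re).inter
        (isOpen_lt Complex.continuous_re continuous_const))
      ((convex_halfSpace_re_gt _).inter (convex_halfSpace_re_lt _))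
      (hop.continuousOn.mono hsub) (fun w hw => ⟨by simpa using hw.1, by simpa using hw.2⟩)
      (fun w hw => hΦ w (hsub hw)) (τ := rightMul (totalMonodromy CU CL))
      (fun z v => sys.rightMul_leftOp R 0 z _ v) (logPoint_re_mem hR 0) hturn ⟨hw, hw'⟩
  · intro w hw
    refine shift_eq_of_loopInfty hR hL hΦ (τ := rightMul Minf)
      (fun z v => sys.rightMul_leftOp R 0 z _ v) hY.isContinuationOn ?_ ?_ hw
    · rw [hY0, ← logPoint_zero hR, hΦ0]
    · rw [hY1, hY0]
      rfl

end Sectors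

/-! ### Global solutions -/

section GlobalSolution

variable {V : Type*} [NormedAddCommGroup V] [NormedSpace ℂ V]

theorem isContinuationOn_of_hasDerivAt {L : ℂ → V →L[ℂ] V} {U : Set ℂ} (hU : IsOpen U)
    {γ : ℝ → ℂ} {J : Set ℝ} (hγU : MapsTo γ J U) {Z : ℂ → V}
    (hZ : ∀ z ∈ U, HasDerivAt Z (L z (Z z)) z) : IsContinuationOn L γ J fun t => Z (γ t) :=
  fun t ht => ⟨Z, by filter_upwards [hU.mem_nhds (hγU ht)] with z hz using hZ z hz,
    Eventually.of_forall fun _ => rfl⟩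

theorem IsContinuationOn.comp {L : ℂ → V →L[ℂ] V} {γ : ℝ → ℂ} {J J' : Set ℝ} {Y : ℝ → V}
    (h : IsContinuationOn L γ J Y) {φ : ℝ → ℝ} (hφ : ContinuousOn φ J') (hJ : MapsTo φ J' J) :
    IsContinuationOn L (fun t => γ (φ t)) J' fun t => Y (φ t) := fun t ht => by
  obtain ⟨Z, hZ, hY⟩ := h (φ t) (hJ ht)
  exact ⟨Z, hZ, ((hφ t ht).tendsto_nhdsWithin hJ).eventually hY⟩

variable [CompleteSpace V]

theorem IsContinuationOn.glue {L : ℂ → V →L[ℂ] V} {U : Set ℂ} (hU : IsOpen U)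
    (hL : ContinuousOn L U) {γ : ℝ → ℂ} {a b c : ℝ} (hab : a ≤ b) (hbc : b ≤ c)
    (hγ : ContinuousOn γ (Icc a c)) (hγU : γ b ∈ U) {Y₁ Y₂ : ℝ → V}
    (h₁ : IsContinuationOn L γ (Icc a b) Y₁) (h₂ : IsContinuationOn L γ (Icc b c) Y₂)
    (h : Y₁ b = Y₂ b) :
    IsContinuationOn L γ (Icc a c) fun s => if s ≤ b then Y₁ s else Y₂ s := by
  intro t ht
  rcases lt_trichotomy t b with htb | rfl | htb
  · obtain ⟨Z, hZ, hY⟩ := h₁ t ⟨ht.1, htb.le⟩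
    refine ⟨Z, hZ, ?_⟩
    rw [eventually_nhdsWithin_iff] at hY ⊢
    filter_upwards [hY, eventually_lt_nhds htb] with s hs hsb hsJ
    rw [if_pos hsb.le]
    exact hs ⟨hsJ.1, hsb.le⟩
  · obtain ⟨Z₁, hZ₁, hY₁⟩ := h₁ t ⟨hab, le_rfl⟩
    obtain ⟨Z₂, hZ₂, hY₂⟩ := h₂ t ⟨le_rfl, hbc⟩
    obtain ⟨δ, hδ, hball⟩ := Metric.eventually_nhds_iff_ball.1
      ((hZ₁.and hZ₂).and (hU.mem_nhds hγU))
    have hmem : ∀ᶠ s in 𝓝[Icc a c] t, γ s ∈ Metric.ball (γ t) δ :=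
      (hγ t ht).eventually_mem (Metric.ball_mem_nhds _ hδ)
    have heq : Z₁ (γ t) = Z₂ (γ t) := by
      rw [← hY₁.self_of_nhdsWithin ⟨hab, le_rfl⟩, ← hY₂.self_of_nhdsWithin ⟨le_rfl, hbc⟩, h]
    refine ⟨Z₁, hZ₁, ?_⟩
    rw [eventually_nhdsWithin_iff] at hY₁ hY₂ hmem ⊢
    filter_upwards [hY₁, hY₂, hmem] with s hs1 hs2 hs hsJ
    split_ifs with hst
    · exact hs1 ⟨hsJ.1, hst⟩
    · rw [hs2 ⟨(not_le.1 hst).le, hsJ.2⟩]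
      exact (linearODE_unique Metric.isOpen_ball (convex_ball _ _).isPreconnected
        (hL.mono fun z hz => (hball z hz).2) (fun z hz => (hball z hz).1.1)
        (fun z hz => (hball z hz).1.2) (Metric.mem_ball_self hδ) heq (hs hsJ)).symm
  · obtain ⟨Z, hZ, hY⟩ := h₂ t ⟨htb.le, ht.2⟩
    refine ⟨Z, hZ, ?_⟩
    rw [eventually_nhdsWithin_iff] at hY ⊢
    filter_upwards [hY, eventually_gt_nhds htb] with s hs hsb hsJ
    rw [if_neg (not_le.2 hsb)]
    exact hs ⟨hsb.le, hsJ.2⟩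

/-- Solutions of a linear differential equation can be continued along every path. -/
theorem exists_isContinuationOn {L : ℂ → V →L[ℂ] V} {U : Set ℂ} (hU : IsOpen U)
    (hL : DifferentiableOn ℂ L U) {γ : ℝ → ℂ} (hγ : ContinuousOn γ (Icc 0 1))
    (hγU : MapsTo γ (Icc 0 1) U) (v₀ : V) :
    ∃ Y : ℝ → V, IsContinuationOn L γ (Icc 0 1) Y ∧ Y 0 = v₀ := by
  obtain ⟨δ, hδ, hsub⟩ := (isCompact_Icc.image_of_continuousOn hγ).exists_thickening_subset_open hU
    hγU.image_subset
  have hball : ∀ t ∈ Icc (0 : ℝ) 1, Metric.ball (γ t) δ ⊆ U := fun t ht =>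
    (Metric.ball_subset_thickening (mem_image_of_mem _ ht) δ).trans hsub
  obtain ⟨η, hη, hηδ⟩ := Metric.uniformContinuousOn_iff.1
    (isCompact_Icc.uniformContinuousOn_of_continuous hγ) δ hδ
  obtain ⟨N, hN⟩ := exists_nat_one_div_lt hη
  have hN0 : (0 : ℝ) < N + 1 := by positivity
  have key : ∀ m : ℕ, m ≤ N + 1 →
      ∃ Y : ℝ → V, IsContinuationOn L γ (Icc 0 ((m : ℝ) / (N + 1))) Y ∧ Y 0 = v₀ := by
    intro m
    induction m with
    | zero =>
      intro _
      obtain ⟨Z, hZ0, hZ⟩ := linearODE_exists Metric.isOpen_ball (convex_ball (γ 0) δ)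
        (hL.mono (hball 0 (by simp))) (Metric.mem_ball_self hδ) v₀
      refine ⟨fun t => Z (γ t), isContinuationOn_of_hasDerivAt Metric.isOpen_ball ?_ hZ, hZ0⟩
      intro t ht
      have : t = 0 := by simpa using ht
      rw [this]
      exact Metric.mem_ball_self hδ
    | succ m ih =>
      intro hm
      obtain ⟨Y, hY, hY0⟩ := ih (by omega)
      set b : ℝ := (m : ℝ) / (N + 1) with hb
      have hm1 : (m : ℝ) + 1 ≤ N + 1 := by exact_mod_cast hm
      have hb0 : 0 ≤ b := by positivity
      have hc : ((m + 1 : ℕ) : ℝ) / (N + 1) = b + 1 / (N + 1) := by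
        rw [hb]
        push_cast
        ring
      have hc1 : b + 1 / (N + 1) ≤ 1 := by
        rw [← hc, div_le_one hN0]
        exact_mod_cast hm
      have hpos : 0 < 1 / ((N : ℝ) + 1) := by positivity
      rw [hc]
      have hbI : b ∈ Icc (0 : ℝ) 1 := ⟨hb0, by linarith⟩
      obtain ⟨Z, hZ0, hZ⟩ := linearODE_exists Metric.isOpen_ball (convex_ball (γ b) δ)
        (hL.mono (hball b hbI)) (Metric.mem_ball_self hδ) (Y b)
      refine ⟨_, hY.glue hU hL.continuousOn hb0 (by linarith)
        (hγ.mono (Icc_subset_Icc le_rfl hc1)) (hγU hbI) (Y₂ := fun t => Z (γ t))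
        (isContinuationOn_of_hasDerivAt Metric.isOpen_ball ?_ hZ) hZ0.symm, ?_⟩
      · intro t ht
        refine hηδ t ⟨hb0.trans ht.1, ht.2.trans hc1⟩ b hbI ?_
        rw [Real.dist_eq, abs_of_nonneg (by linarith [ht.1])]
        linarith [ht.2]
      · simp only [if_pos hb0, hY0]
  obtain ⟨Y, hY, hY0⟩ := key (N + 1) le_rfl
  push_cast at hY
  rw [div_self hN0.ne'] at hY
  exact ⟨Y, hY, hY0⟩

/-- A solution whose continuation along every loop is single-valued is defined globally. -/
theorem exists_global_solution {L : ℂ → V →L[ℂ] V} {U : Set ℂ} (hU : IsOpen U)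
    (hc : IsPathConnected U) (hL : DifferentiableOn ℂ L U) {x₀ : ℂ} (hx₀ : x₀ ∈ U) {v₀ : V}
    (hloop : ∀ γ : ℝ → ℂ, ContinuousOn γ (Icc 0 1) → MapsTo γ (Icc 0 1) U → γ 0 = x₀ → γ 1 = x₀ →
      ∀ Y, IsContinuationOn L γ (Icc 0 1) Y → Y 0 = v₀ → Y 1 = v₀) :
    ∃ h : ℂ → V, h x₀ = v₀ ∧ ∀ x ∈ U, HasDerivAt h (L x (h x)) x := by
  have hγ : ∀ x ∈ U, ∃ γ : Path x₀ x, ∀ t, γ t ∈ U := fun x hx => hc.joinedIn x₀ hx₀ x hx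
  have hext : ∀ {x y : ℂ} {S : Set ℂ} (γ : Path x y), (∀ t, γ t ∈ S) → ∀ t, γ.extend t ∈ S := by
    intro x y S γ h t
    have : γ.extend t ∈ range γ.extend := mem_range_self t
    rw [Path.extend_range] at this
    obtain ⟨s, hs⟩ := this
    rw [← hs]
    exact h s
  have hY : ∀ x ∈ U, ∃ (γ : Path x₀ x) (Y : ℝ → V), (∀ t, γ t ∈ U) ∧
      IsContinuationOn L γ.extend (Icc 0 1) Y ∧ Y 0 = v₀ := by
    intro x hx
    obtain ⟨γ, hγ⟩ := hγ x hx
    obtain ⟨Y, h1, h2⟩ := exists_isContinuationOn hU hL γ.continuous_extend.continuousOn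
      (fun t _ => hext γ hγ t) v₀
    exact ⟨γ, Y, hγ, h1, h2⟩
  choose! h hh using fun x => show ∃ v : V, x ∈ U → ∃ (γ : Path x₀ x) (Y : ℝ → V), (∀ t, γ t ∈ U) ∧
      IsContinuationOn L γ.extend (Icc 0 1) Y ∧ Y 0 = v₀ ∧ Y 1 = v by
    by_cases hx : x ∈ U
    · obtain ⟨γ, Y, h1, h2, h3⟩ := hY x hx
      exact ⟨Y 1, fun _ => ⟨γ, Y, h1, h2, h3, rfl⟩⟩
    · exact ⟨0, fun h => absurd h hx⟩
  refine ⟨h, ?_, ?_⟩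
  · obtain ⟨γ, Y, h1, h2, h3, h4⟩ := hh x₀ hx₀
    rw [← h4]
    exact hloop _ γ.continuous_extend.continuousOn (fun t _ => hext γ h1 t) γ.extend_zero
      γ.extend_one Y h2 h3
  intro x hx
  obtain ⟨δ, hδ, hball⟩ := Metric.isOpen_iff.1 hU x hx
  obtain ⟨Z, hZ0, hZ⟩ := linearODE_exists Metric.isOpen_ball (convex_ball x δ)
    (hL.mono hball) (Metric.mem_ball_self hδ) (h x)
  refine (hZ x (Metric.mem_ball_self hδ)).congr_of_eventuallyEq ?_ |>.congr_deriv (by rw [hZ0])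
  filter_upwards [Metric.ball_mem_nhds x hδ] with y hy
  obtain ⟨γ₁, Y₁, hγ₁, hY₁, hY₁0, hY₁1⟩ := hh x hx
  obtain ⟨γ₂, Y₂, hγ₂, hY₂, hY₂0, hY₂1⟩ := hh y (hball hy)
  obtain ⟨γ₃, hγ₃⟩ := ((convex_ball x δ).isPathConnected ⟨x, Metric.mem_ball_self hδ⟩).joinedIn x
    (Metric.mem_ball_self hδ) y hy
  -- the loop through `x` and `y`, and the continuation of the solution along it
  let γ : Path x₀ x₀ := (γ₁.trans γ₃).trans γ₂.symm
  have hγU : ∀ t, γ.extend t ∈ U := by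
    intro t
    rcases le_total t (1 / 2) with ht | ht
    · rw [Path.extend_trans_of_le_half _ _ ht]
      rcases le_total (2 * t) (1 / 2) with ht' | ht'
      · rw [Path.extend_trans_of_le_half _ _ ht']
        exact hext γ₁ hγ₁ _
      · rw [Path.extend_trans_of_half_le _ _ ht']
        exact hball (hext γ₃ hγ₃ _)
    · rw [Path.extend_trans_of_half_le _ _ ht, Path.extend_symm_apply]
      exact hext γ₂ hγ₂ _
  obtain ⟨Y, hY, hY0⟩ := exists_isContinuationOn hU hL γ.continuous_extend.continuousOn
    (fun t _ => hγU t) v₀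
  have hY1 : Y 1 = v₀ := hloop _ γ.continuous_extend.continuousOn (fun t _ => hγU t) γ.extend_zero
    γ.extend_one Y hY hY0
  have piece : ∀ {a b : ℂ} (p : Path a b) (φ : ℝ → ℝ) (W : ℝ → V), Continuous φ →
      MapsTo φ (Icc 0 1) (Icc 0 1) → (∀ t ∈ Icc (0 : ℝ) 1, γ.extend (φ t) = p.extend t) →
      IsContinuationOn L p.extend (Icc 0 1) W →
      ∀ t₀ ∈ Icc (0 : ℝ) 1, Y (φ t₀) = W t₀ → EqOn (fun t => Y (φ t)) W (Icc 0 1) := by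
    intro a b p φ W hφ hφI hp hW t₀ ht₀ h0
    refine IsContinuationOn.unique hU hL.continuousOn isPreconnected_Icc
      p.continuous_extend.continuousOn (fun t ht => ?_)
      ((hY.comp hφ.continuousOn hφI).congr_path fun t ht => (hp t ht).symm) hW ht₀ h0
    rw [← hp t ht]
    exact hγU _
  have e1 := piece γ₁ (fun t => t / 4) Y₁ (by fun_prop)
    (fun t ht => ⟨by linarith [ht.1], by linarith [ht.2]⟩)
    (fun t ht => by
      rw [Path.extend_trans_of_le_half _ _ (by linarith [ht.2]),
        Path.extend_trans_of_le_half _ _ (by linarith [ht.2])]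
      congr 1
      ring) hY₁ 0 (by simp) (by simp [hY0, hY₁0])
  have e1' : Y (1 / 4) = h x := (e1 (by simp : (1 : ℝ) ∈ Icc 0 1)).trans hY₁1
  have e2 := piece γ₃ (fun t => (1 + t) / 4) (fun t => Z (γ₃.extend t)) (by fun_prop)
    (fun t ht => ⟨by linarith [ht.1], by linarith [ht.2]⟩)
    (fun t ht => by
      rw [Path.extend_trans_of_le_half _ _ (by linarith [ht.2]),
        Path.extend_trans_of_half_le _ _ (by linarith [ht.1])]
      congr 1
      ring)
    (isContinuationOn_of_hasDerivAt Metric.isOpen_ball (fun t _ => hext γ₃ hγ₃ t) hZ) 0 (by simp)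
    (by
      simp only [Path.extend_zero, add_zero]
      rw [hZ0, e1'])
  have e2' : Y (1 / 2) = Z y := by
    have := e2 (by simp : (1 : ℝ) ∈ Icc 0 1)
    simp only [Path.extend_one] at this
    rw [← this]
    norm_num
  have e3 := piece γ₂ (fun t => 1 - t / 2) Y₂ (by fun_prop)
    (fun t ht => ⟨by linarith [ht.2], by linarith [ht.1]⟩)
    (fun t ht => by
      rw [Path.extend_trans_of_half_le _ _ (by linarith [ht.2]), Path.extend_symm_apply]
      congr 1
      ring) hY₂ 0 (by simp) (by simp [hY1, hY₂0])
  have e3' : Y (1 / 2) = h y := by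
    have := e3 (by simp : (1 : ℝ) ∈ Icc 0 1)
    simp only at this
    rw [hY₂1] at this
    rw [← this]
    norm_num
  rw [← e3', e2']

end GlobalSolution

/-! ### The gauge transformation over the punctured disk -/

theorem pPoly_monic {k : ℕ} (ε : Fin k → ℂ) : (pPoly ε).Monic := by
  refine Polynomial.monic_X_pow_add ((Polynomial.degree_sum_le _ _).trans_lt ?_)
  rw [Finset.sup_lt_iff (WithBot.bot_lt_coe _)]
  intro j _
  refine (Polynomial.degree_C_mul_X_pow_le _ _).trans_lt ?_
  exact_mod_cast j.2.trans (Nat.lt_succ_self k)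

theorem finite_zeros {k : ℕ} (ε : Fin k → ℂ) : {x | pVal ε x = 0}.Finite :=
  Polynomial.finite_setOfPred_isRoot (pPoly_monic ε).ne_zero

theorem isOpen_pVal_ne_zero {k : ℕ} (ε : Fin k → ℂ) : IsOpen {x | pVal ε x ≠ 0} :=
  isOpen_ne_fun (pPoly ε).continuous continuous_const

theorem isOpen_puncturedDisk {k : ℕ} (R : ℝ) (ε : Fin k → ℂ) :
    IsOpen {x : ℂ | ‖x‖ < R ∧ pVal ε x ≠ 0} :=
  (isOpen_lt continuous_norm continuous_const).inter (isOpen_pVal_ne_zero ε)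

theorem isPathConnected_puncturedDisk {k : ℕ} {R : ℝ} (hR : 0 < R) (ε : Fin k → ℂ) :
    IsPathConnected {x : ℂ | ‖x‖ < R ∧ pVal ε x ≠ 0} := by
  let e := OpenPartialHomeomorph.univBall (0 : ℂ) R
  have hs : e.source = univ := OpenPartialHomeomorph.univBall_source _ _
  have ht : e.target = Metric.ball 0 R := OpenPartialHomeomorph.univBall_target _ hR
  have hinj : Function.Injective e := by
    rw [← injOn_univ, ← hs]
    exact e.injOn
  have hc : Continuous e := by
    rw [← continuousOn_univ, ← hs]
    exact e.continuousOn
  have h1 : IsPathConnected (e ⁻¹' {x | pVal ε x = 0})ᶜ :=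
    ((finite_zeros ε).countable.preimage_of_injOn hinj.injOn).isPathConnected_compl_of_one_lt_rank
      (by rw [Complex.rank_real_complex]; exact Cardinal.one_lt_two)
  convert h1.image hc using 1
  ext x
  constructor
  · rintro ⟨hx, hp⟩
    have hx' : x ∈ e.target := by rw [ht, mem_ball_zero_iff]; exact hx
    refine ⟨e.symm x, ?_, e.right_inv hx'⟩
    rw [mem_compl_iff, mem_preimage, e.right_inv hx']
    exact hp
  · rintro ⟨y, hy, rfl⟩
    refine ⟨?_, hy⟩
    have : e y ∈ e.target := e.map_source (by rw [hs]; trivial)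
    rwa [ht, mem_ball_zero_iff] at this

theorem inv_mul_eq_mul_inv_mul {n : ℕ} {X X' C : Matrix (Fin n) (Fin n) ℂ} (hX : IsUnit X.det)
    (hX' : IsUnit X'.det) (h : X' = X * C) (Y : Matrix (Fin n) (Fin n) ℂ) :
    X⁻¹ * Y = C * (X'⁻¹ * Y) := by
  have h1 : X * (C * (X'⁻¹ * Y)) = Y := by
    rw [← Matrix.mul_assoc, ← h, Matrix.mul_nonsing_inv_cancel_left _ _ hX']
  conv_lhs => rw [← h1]
  rw [Matrix.nonsing_inv_mul_cancel_left _ _ hX]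

section Gauge

open scoped Matrix.Norms.Operator

variable {k n : ℕ}

theorem differentiableAt_adOp {P Q : ℂ → Matrix (Fin n) (Fin n) ℂ} {x : ℂ}
    (hP : DifferentiableAt ℂ P x) (hQ : DifferentiableAt ℂ Q x) :
    DifferentiableAt ℂ (fun x => adOp (P x) (Q x)) x :=
  (((ContinuousLinearMap.mul ℂ (Matrix (Fin n) (Fin n) ℂ)).differentiableAt).comp x hP).sub
    (((ContinuousLinearMap.mul ℂ (Matrix (Fin n) (Fin n) ℂ)).flip.differentiableAt).comp x hQ)

/-- Gauge transformations compose: if `Y' = P Y - Y Q` and `W' = Q W - W T`, then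
`(Y W)' = P (Y W) - (Y W) T`. With `T = 0` this is the action of a gauge transformation on
solutions. -/
theorem IsContinuationOn.mul {P Q T : ℂ → Matrix (Fin n) (Fin n) ℂ} {γ : ℝ → ℂ} {J : Set ℝ}
    {Y W : ℝ → Matrix (Fin n) (Fin n) ℂ} (hY : IsContinuationOn (fun x => adOp (P x) (Q x)) γ J Y)
    (hW : IsContinuationOn (fun x => adOp (Q x) (T x)) γ J W) :
    IsContinuationOn (fun x => adOp (P x) (T x)) γ J fun t => Y t * W t := by
  intro t ht
  obtain ⟨Z₁, hZ₁, h1⟩ := hY t ht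
  obtain ⟨Z₂, hZ₂, h2⟩ := hW t ht
  refine ⟨fun z => Z₁ z * Z₂ z, ?_, ?_⟩
  · filter_upwards [hZ₁, hZ₂] with z hz1 hz2
    refine (hz1.mul hz2).congr_deriv ?_
    simp only [adOp_apply]
    noncomm_ring
  · filter_upwards [h1, h2] with s hs1 hs2
    rw [hs1, hs2]

theorem isContinuationOn_adOp_one (P : ℂ → Matrix (Fin n) (Fin n) ℂ) (γ : ℝ → ℂ) (J : Set ℝ) :
    IsContinuationOn (fun x => adOp (P x) (P x)) γ J fun _ => 1 := fun t _ =>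
  ⟨fun _ => 1, Eventually.of_forall fun z =>
    (hasDerivAt_const z (1 : Matrix (Fin n) (Fin n) ℂ)).congr_deriv
    (by simp only [adOp_apply, mul_one, one_mul, sub_self]), Eventually.of_forall fun _ => rfl⟩

theorem leftOp_eq_adOp (sys : RationalSystem k n) (R : ℝ) (ε : Fin k → ℂ) :
    sys.leftOp R ε = fun x => adOp (sys.B R ε x) 0 := by
  funext x
  ext1 H
  change sys.B R ε x * H = sys.B R ε x * H - H * 0
  rw [mul_zero, sub_zero]

/-- A solution is a constant multiple of an invertible one. -/
theorem RationalSystem.eventually_eq_mul {sys : RationalSystem k n} {R : ℝ} {ε : Fin k → ℂ}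
    {W : Set ℂ} (hW : IsOpen W) (hWL : ContinuousOn (sys.leftOp R ε) W)
    {X Z : ℂ → Matrix (Fin n) (Fin n) ℂ} (hX : ∀ x ∈ W, sys.IsSolutionAt R ε X x) {x : ℂ}
    (hx : x ∈ W) (hZ : ∀ᶠ z in 𝓝 x, HasDerivAt Z (sys.leftOp R ε z (Z z)) z) :
    ∀ᶠ z in 𝓝 x, (X z)⁻¹ * Z z = (X x)⁻¹ * Z x := by
  obtain ⟨δ, hδ, hball⟩ := Metric.eventually_nhds_iff_ball.1 (hZ.and (hW.mem_nhds hx))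
  have heq : EqOn Z (fun z => X z * ((X x)⁻¹ * Z x)) (Metric.ball x δ) := by
    refine linearODE_unique Metric.isOpen_ball (convex_ball _ _).isPreconnected
      (hWL.mono fun z hz => (hball z hz).2) (fun z hz => (hball z hz).1) (fun z hz => ?_)
      (Metric.mem_ball_self hδ) (Matrix.mul_nonsing_inv_cancel_left _ _ (hX x hx).1).symm
    refine ((rightMul ((X x)⁻¹ * Z x)).hasFDerivAt.comp_hasDerivAt z
      (hX z (hball z hz).2).hasDerivAt).congr_deriv ?_
    exact Matrix.mul_assoc (sys.B R ε z) (X z) _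
  filter_upwards [Metric.ball_mem_nhds x hδ] with z hz
  rw [heq hz, Matrix.nonsing_inv_mul_cancel_left _ _ (hX z (hball z hz).2).1]

theorem differentiableOn_leftOp_disk (sys : RationalSystem k n) (R : ℝ) (ε : Fin k → ℂ) :
    DifferentiableOn ℂ (sys.leftOp R ε) {x : ℂ | ‖x‖ < R ∧ pVal ε x ≠ 0} := fun x hx =>
  (sys.differentiableAt_leftOp hx.2 (by
    rintro rfl
    have := hx.1
    rw [Complex.norm_real, Real.norm_eq_abs] at this
    exact absurd (le_abs_self R) (not_le.2 this))).differentiableWithinAt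

variable [NeZero k]

theorem SectorDecomposition.mem_punctured_of_plus {R : ℝ} {σ : Equiv.Perm (Fin k)}
    {ε : Fin k → ℂ} (D : SectorDecomposition k R σ ε) {j : Fin k} {x : ℂ} (hx : x ∈ D.plus j) :
    ‖x‖ < R ∧ pVal ε x ≠ 0 := by
  have : x ∈ (⋃ j, D.plus j) ∪ (⋃ j, D.minus j) := Or.inl (mem_iUnion.2 ⟨j, hx⟩)
  rwa [D.cover] at this

theorem SectorDecomposition.mem_punctured_of_minus {R : ℝ} {σ : Equiv.Perm (Fin k)}
    {ε : Fin k → ℂ} (D : SectorDecomposition k R σ ε) {j : Fin k} {x : ℂ} (hx : x ∈ D.minus j) :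
    ‖x‖ < R ∧ pVal ε x ≠ 0 := by
  have : x ∈ (⋃ j, D.plus j) ∪ (⋃ j, D.minus j) := Or.inr (mem_iUnion.2 ⟨j, hx⟩)
  rwa [D.cover] at this

theorem SectorDecomposition.mem_or_mem {R : ℝ} {σ : Equiv.Perm (Fin k)}
    {ε : Fin k → ℂ} (D : SectorDecomposition k R σ ε) {x : ℂ} (hx : ‖x‖ < R ∧ pVal ε x ≠ 0) :
    (∃ j, x ∈ D.plus j) ∨ (∃ j, x ∈ D.minus j) := by
  have : x ∈ (⋃ j, D.plus j) ∪ (⋃ j, D.minus j) := by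
    rw [D.cover]
    exact hx
  simpa using this

/-- The base point lies in the last sector, at the final point `2π` of its range of arguments. -/
theorem SectorDecomposition.base_mem {R : ℝ} {σ : Equiv.Perm (Fin k)}
    {ε : Fin k → ℂ} (D : SectorDecomposition k R σ ε) :
    ((3 * R / 4 : ℝ) : ℂ) ∈ D.minus (0 - 1) := by
  have hk : 0 < k := Nat.pos_of_ne_zero (NeZero.ne k)
  have hk' : (0 : ℝ) < k := by exact_mod_cast hk
  have h2 : 2 * Real.pi * (((k - 1 : ℕ) : ℝ) + 1) / k = 2 * Real.pi := by
    rw [Nat.cast_sub hk]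
    push_cast
    field_simp
    ring
  have h := D.circle_minus ⟨k - 1, by omega⟩ (2 * Real.pi) ⟨?_, h2.ge⟩
  · rw [fin_zero_sub_one (by omega)]
    convert h using 1
    push_cast
    rw [Complex.exp_two_pi_mul_I, mul_one]
  · rw [← h2]
    exact div_le_div_of_nonneg_right (by simp only; nlinarith [Real.pi_pos]) hk'.le

/-- Solutions `Xp j`, `Xm j` over the sectors which are related by the generalized Stokes matrices
and gate matrices. -/
structure StokesData.IsSectorial {R ρ : ℝ} {S : DSDomain k R ρ} {Λ : FormalInvariants k n ρ}
    {CU0 CL0 : Fin k → Matrix (Fin n) (Fin n) ℂ} (C : StokesData S Λ CU0 CL0) (u : S.carrier)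
    (sys : RationalSystem k n) (Xp Xm : Fin k → ℂ → Matrix (Fin n) (Fin n) ℂ) : Prop where
  plus : ∀ j, ∀ x ∈ (S.sec u).plus j, sys.IsSolutionAt R (S.proj u) (Xp j) x
  minus : ∀ j, ∀ x ∈ (S.sec u).minus j, sys.IsSolutionAt R (S.proj u) (Xm j) x
  upper : ∀ j, ∀ x ∈ (S.sec u).interU j, Xp j x = Xm (j - 1) x * C.CU u j
  lower : ∀ j, ∀ x ∈ (S.sec u).interL j, Xm j x = Xp j x * C.CL u j
  gate : ∀ j, ∀ x ∈ (S.sec u).interG j, Xm (S.σ j) x = Xp j x * C.CG u j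

variable {R ρ : ℝ} {S : DSDomain k R ρ} {Λ : FormalInvariants k n ρ}
  {CU0 CL0 : Fin k → Matrix (Fin n) (Fin n) ℂ} {C : StokesData S Λ CU0 CL0} {u : S.carrier}
  {sys : RationalSystem k n} {Xp Xm : Fin k → ℂ → Matrix (Fin n) (Fin n) ℂ}

theorem SectorDecomposition.interU_subset {R : ℝ} {σ : Equiv.Perm (Fin k)}
    {ε : Fin k → ℂ} (D : SectorDecomposition k R σ ε) {j : Fin k} {x : ℂ} (hx : x ∈ D.interU j) :
    x ∈ D.plus j ∩ D.minus (j - 1) := by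
  rw [D.plus_inter_minus]
  exact Or.inl ⟨rfl, hx⟩

theorem SectorDecomposition.interL_subset {R : ℝ} {σ : Equiv.Perm (Fin k)}
    {ε : Fin k → ℂ} (D : SectorDecomposition k R σ ε) {j : Fin k} {x : ℂ} (hx : x ∈ D.interL j) :
    x ∈ D.plus j ∩ D.minus j := by
  rw [D.plus_inter_minus]
  exact Or.inr (Or.inl ⟨rfl, hx⟩)

theorem SectorDecomposition.interG_subset {R : ℝ} {σ : Equiv.Perm (Fin k)}
    {ε : Fin k → ℂ} (D : SectorDecomposition k R σ ε) {j : Fin k} {x : ℂ} (hx : x ∈ D.interG j) :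
    x ∈ D.plus j ∩ D.minus (σ j) := by
  rw [D.plus_inter_minus]
  exact Or.inr (Or.inr ⟨rfl, hx⟩)

/-- The monodromy of the bundle is that of the system which realizes it. -/
theorem StokesData.IsSectorial.isMonodromy (h : C.IsSectorial u sys Xp Xm) {γ : ℝ → ℂ}
    (hγ : IsLoop R (S.proj u) γ) {Y : ℝ → Matrix (Fin n) (Fin n) ℂ}
    (hY : IsContinuationOn (sys.leftOp R (S.proj u)) γ (Icc 0 1) Y)
    (h0 : Y 0 = Xm (0 - 1) ((3 * R / 4 : ℝ) : ℂ)) :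
    C.IsMonodromy u γ ((Xm (0 - 1) ((3 * R / 4 : ℝ) : ℂ))⁻¹ * Y 1) := by
  have hL := (differentiableOn_leftOp_disk sys R (S.proj u)).continuousOn
  have hloc : ∀ (W : Set ℂ) (X : ℂ → Matrix (Fin n) (Fin n) ℂ), IsOpen W →
      W ⊆ {x : ℂ | ‖x‖ < R ∧ pVal (S.proj u) x ≠ 0} →
      (∀ x ∈ W, sys.IsSolutionAt R (S.proj u) X x) → ∀ t ∈ Icc (0 : ℝ) 1, γ t ∈ W →
      ∀ᶠ s in 𝓝[Icc 0 1] t, (X (γ s))⁻¹ * Y s = (X (γ t))⁻¹ * Y t := by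
    intro W X hW hWD hX t ht htW
    obtain ⟨Z, hZ, hYZ⟩ := hY t ht
    have h1 := (hγ.cont t ht).eventually
      (RationalSystem.eventually_eq_mul hW (hL.mono hWD) hX htW hZ)
    filter_upwards [h1, hYZ] with s hs1 hs2
    rw [hs2, hs1, hYZ.self_of_nhdsWithin ht]
  refine ⟨fun j t => (Xp j (γ t))⁻¹ * Y t, fun j t => (Xm j (γ t))⁻¹ * Y t, ?_, ?_, ?_, ?_, ?_, ?_,
    ?_⟩
  · exact fun j => hloc _ _ ((S.sec u).isOpen_plus j)
      (fun x hx => (S.sec u).mem_punctured_of_plus hx) (h.plus j)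
  · exact fun j => hloc _ _ ((S.sec u).isOpen_minus j)
      (fun x hx => (S.sec u).mem_punctured_of_minus hx) (h.minus j)
  · intro j t _ hj
    have hs := (S.sec u).interU_subset hj
    exact inv_mul_eq_mul_inv_mul (h.minus _ _ hs.2).1 (h.plus _ _ hs.1).1 (h.upper j _ hj) _
  · intro j t _ hj
    have hs := (S.sec u).interL_subset hj
    exact inv_mul_eq_mul_inv_mul (h.plus _ _ hs.1).1 (h.minus _ _ hs.2).1 (h.lower j _ hj) _
  · intro j t _ hj
    have hs := (S.sec u).interG_subset hj
    exact inv_mul_eq_mul_inv_mul (h.plus _ _ hs.1).1 (h.minus _ _ hs.2).1 (h.gate j _ hj) _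
  · simp only
    rw [hγ.start, h0]
    exact Matrix.nonsing_inv_mul _ (h.minus _ _ (S.sec u).base_mem).1
  · simp only
    rw [hγ.finish]

/-- Conversely, a flat frame of the bundle along a loop gives a continuation of a solution. -/
theorem StokesData.IsSectorial.exists_continuation (h : C.IsSectorial u sys Xp Xm) {γ : ℝ → ℂ}
    (hγ : IsLoop R (S.proj u) γ) {M : Matrix (Fin n) (Fin n) ℂ} (hM : C.IsMonodromy u γ M) :
    ∃ Y, IsContinuationOn (sys.leftOp R (S.proj u)) γ (Icc 0 1) Y ∧
      Y 0 = Xm (0 - 1) ((3 * R / 4 : ℝ) : ℂ) ∧ Y 1 = Xm (0 - 1) ((3 * R / 4 : ℝ) : ℂ) * M := by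
  obtain ⟨Vp, Vm, hVp, hVm, hU, hLo, hG, hV0, hV1⟩ := hM
  have hex : ∀ t, ∃ y : Matrix (Fin n) (Fin n) ℂ, t ∈ Icc (0 : ℝ) 1 →
      (∀ j, γ t ∈ (S.sec u).plus j → y = Xp j (γ t) * Vp j t) ∧
      (∀ j, γ t ∈ (S.sec u).minus j → y = Xm j (γ t) * Vm j t) := by
    intro t
    by_cases hp : ∃ i, γ t ∈ (S.sec u).plus i
    · obtain ⟨i, hi⟩ := hp
      refine ⟨Xp i (γ t) * Vp i t, fun ht => ⟨fun j hj => ?_, fun j hj => ?_⟩⟩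
      · by_cases hij : i = j
        · rw [hij]
        · exact absurd hj (Set.disjoint_left.1 ((S.sec u).plus_disjoint i j hij) hi)
      · have hmem : γ t ∈ (S.sec u).plus i ∩ (S.sec u).minus j := ⟨hi, hj⟩
        rw [(S.sec u).plus_inter_minus] at hmem
        rcases hmem with ⟨rfl, hx⟩ | ⟨rfl, hx⟩ | ⟨rfl, hx⟩
        · rw [hU i t ht hx, ← Matrix.mul_assoc, ← h.upper i _ hx]
        · rw [hLo j t ht hx, ← Matrix.mul_assoc, ← h.lower j _ hx]
        · rw [hG i t ht hx, ← Matrix.mul_assoc, ← h.gate i _ hx]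
    · by_cases hm : ∃ i, γ t ∈ (S.sec u).minus i
      · obtain ⟨i, hi⟩ := hm
        refine ⟨Xm i (γ t) * Vm i t, fun _ => ⟨fun j hj => absurd ⟨j, hj⟩ hp, fun j hj => ?_⟩⟩
        by_cases hij : i = j
        · rw [hij]
        · exact absurd hj (Set.disjoint_left.1 ((S.sec u).minus_disjoint i j hij) hi)
      · exact ⟨0, fun _ => ⟨fun j hj => absurd ⟨j, hj⟩ hp, fun j hj => absurd ⟨j, hj⟩ hm⟩⟩
  choose Y hY using hex
  have hder : ∀ (X : ℂ → Matrix (Fin n) (Fin n) ℂ) (N : Matrix (Fin n) (Fin n) ℂ) (z : ℂ),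
      sys.IsSolutionAt R (S.proj u) X z →
      HasDerivAt (fun z => X z * N) (sys.leftOp R (S.proj u) z (X z * N)) z := fun X N z hz =>
    ((rightMul N).hasFDerivAt.comp_hasDerivAt z hz.hasDerivAt).congr_deriv
      (Matrix.mul_assoc (sys.B R (S.proj u) z) (X z) N)
  have hb := (S.sec u).base_mem
  refine ⟨Y, fun t ht => ?_, ?_, ?_⟩
  · rcases (S.sec u).mem_or_mem (hγ.mem t ht) with ⟨j, hj⟩ | ⟨j, hj⟩
    · refine ⟨fun z => Xp j z * Vp j t, ?_, ?_⟩
      · filter_upwards [((S.sec u).isOpen_plus j).mem_nhds hj] with z hz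
        exact hder _ _ _ (h.plus j z hz)
      · filter_upwards [hVp j t ht hj, self_mem_nhdsWithin,
          (hγ.cont t ht).eventually (((S.sec u).isOpen_plus j).mem_nhds hj)] with s hs1 hs2 hs3
        rw [(hY s hs2).1 j hs3, hs1]
    · refine ⟨fun z => Xm j z * Vm j t, ?_, ?_⟩
      · filter_upwards [((S.sec u).isOpen_minus j).mem_nhds hj] with z hz
        exact hder _ _ _ (h.minus j z hz)
      · filter_upwards [hVm j t ht hj, self_mem_nhdsWithin,
          (hγ.cont t ht).eventually (((S.sec u).isOpen_minus j).mem_nhds hj)] with s hs1 hs2 hs3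
        rw [(hY s hs2).2 j hs3, hs1]
  · rw [(hY 0 (by simp)).2 (0 - 1) (by rw [hγ.start]; exact hb), hV0, Matrix.mul_one, hγ.start]
  · rw [(hY 1 (by simp)).2 (0 - 1) (by rw [hγ.finish]; exact hb), hV1, hγ.finish]

/-- When the monodromy representations defined by the Stokes data are conjugate, the two systems
are gauge equivalent over the punctured disk. -/
theorem exists_gauge_punctured_disk (hR : 0 < R) (h : C.IsSectorial u sys Xp Xm)
    {S' : DSDomain k R ρ} {C' : StokesData S' Λ CU0 CL0} {u' : S'.carrier}
    {sys' : RationalSystem k n} {Xp' Xm' : Fin k → ℂ → Matrix (Fin n) (Fin n) ℂ}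
    (h' : C'.IsSectorial u' sys' Xp' Xm') (hu : S'.proj u' = S.proj u)
    {G : Matrix (Fin n) (Fin n) ℂ} (hG : IsUnit G.det)
    (hconj : ∀ γ, IsLoop R (S.proj u) γ → ∀ M', C'.IsMonodromy u' γ M' →
      C.IsMonodromy u γ (G * M' * G⁻¹)) :
    ∃ H : ℂ → Matrix (Fin n) (Fin n) ℂ,
      H ((3 * R / 4 : ℝ) : ℂ) = Xm (0 - 1) ((3 * R / 4 : ℝ) : ℂ) * G *
        (Xm' (0 - 1) ((3 * R / 4 : ℝ) : ℂ))⁻¹ ∧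
      ∀ x, ‖x‖ < R → pVal (S.proj u) x ≠ 0 →
        HasDerivAt H (adOp (sys.B R (S.proj u) x) (sys'.B R (S.proj u) x) (H x)) x := by
  set x₀ : ℂ := ((3 * R / 4 : ℝ) : ℂ) with hx₀
  set ε := S.proj u with hε
  let D : Set ℂ := {x : ℂ | ‖x‖ < R ∧ pVal ε x ≠ 0}
  have hx₀D : x₀ ∈ D := (S.sec u).mem_punctured_of_minus (S.sec u).base_mem
  have hX'₀ : IsUnit (Xm' (0 - 1) x₀).det := (h'.minus _ _ (S'.sec u').base_mem).1
  have hxR : ∀ x ∈ D, x ≠ R := by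
    rintro x hx rfl
    have := hx.1
    rw [Complex.norm_real, Real.norm_eq_abs] at this
    exact absurd (le_abs_self R) (not_le.2 this)
  have hdiff : ∀ P Q : ℂ → Matrix (Fin n) (Fin n) ℂ, (∀ x ∈ D, DifferentiableAt ℂ P x) →
      (∀ x ∈ D, DifferentiableAt ℂ Q x) → DifferentiableOn ℂ (fun x => adOp (P x) (Q x)) D :=
    fun P Q hP hQ x hx => (differentiableAt_adOp (hP x hx) (hQ x hx)).differentiableWithinAt
  have hB : ∀ x ∈ D, DifferentiableAt ℂ (sys.B R ε) x := fun x hx =>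
    sys.differentiableAt_B hx.2 (hxR x hx)
  have hB' : ∀ x ∈ D, DifferentiableAt ℂ (sys'.B R ε) x := fun x hx =>
    sys'.differentiableAt_B hx.2 (hxR x hx)
  have h0 : ∀ x ∈ D, DifferentiableAt ℂ (fun _ : ℂ => (0 : Matrix (Fin n) (Fin n) ℂ)) x :=
    fun x _ => differentiableAt_const _
  have hDo : IsOpen D := isOpen_puncturedDisk R ε
  suffices key : ∀ γ : ℝ → ℂ, ContinuousOn γ (Icc 0 1) → MapsTo γ (Icc 0 1) D → γ 0 = x₀ →
      γ 1 = x₀ → ∀ Y, IsContinuationOn (fun x => adOp (sys.B R ε x) (sys'.B R ε x)) γ (Icc 0 1) Y →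
      Y 0 = Xm (0 - 1) x₀ * G * (Xm' (0 - 1) x₀)⁻¹ →
      Y 1 = Xm (0 - 1) x₀ * G * (Xm' (0 - 1) x₀)⁻¹ by
    obtain ⟨H, hH0, hH⟩ := exists_global_solution hDo (isPathConnected_puncturedDisk hR ε)
      (hdiff _ _ hB hB') hx₀D key
    exact ⟨H, hH0, fun x hx hp => hH x ⟨hx, hp⟩⟩
  intro γ hγ hγD hγ0 hγ1 Y hY hY0
  have hloop : IsLoop R ε γ := ⟨hγ, hγ0, hγ1, fun t ht => hγD ht⟩
  -- continuations of the solution of the second system and of its inverse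
  obtain ⟨Z, hZ, hZ0⟩ := exists_isContinuationOn hDo (hdiff _ _ hB' h0) hγ hγD (Xm' (0 - 1) x₀)
  obtain ⟨W, hW, hW0⟩ := exists_isContinuationOn hDo (hdiff _ _ h0 hB') hγ hγD (Xm' (0 - 1) x₀)⁻¹
  have h01 : (0 : ℝ) ∈ Icc (0 : ℝ) 1 := by simp
  have h11 : (1 : ℝ) ∈ Icc (0 : ℝ) 1 := by simp
  have huniq : ∀ {P Q : ℂ → Matrix (Fin n) (Fin n) ℂ} {Y₁ Y₂ : ℝ → Matrix (Fin n) (Fin n) ℂ},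
      (∀ x ∈ D, DifferentiableAt ℂ P x) → (∀ x ∈ D, DifferentiableAt ℂ Q x) →
      IsContinuationOn (fun x => adOp (P x) (Q x)) γ (Icc 0 1) Y₁ →
      IsContinuationOn (fun x => adOp (P x) (Q x)) γ (Icc 0 1) Y₂ → Y₁ 0 = Y₂ 0 → Y₁ 1 = Y₂ 1 :=
    fun hP hQ h₁ h₂ h => IsContinuationOn.unique hDo (hdiff _ _ hP hQ).continuousOn
      isPreconnected_Icc hγ hγD h₁ h₂ h01 h h11
  have hWZ : W 1 * Z 1 = 1 := huniq h0 h0 (hW.mul hZ) (isContinuationOn_adOp_one _ γ _)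
    (by rw [hW0, hZ0, Matrix.nonsing_inv_mul _ hX'₀])
  have hZ' : IsContinuationOn (sys'.leftOp R (S'.proj u')) γ (Icc 0 1) Z := by
    rw [hu, leftOp_eq_adOp]
    exact hZ
  have hmono := hconj γ hloop _ (h'.isMonodromy (by rw [hu]; exact hloop) hZ' hZ0)
  obtain ⟨T, hT, hT0, hT1⟩ := h.exists_continuation hloop hmono
  have hTG : IsContinuationOn (fun x => adOp (sys.B R ε x) 0) γ (Icc 0 1) fun t => T t * G := by
    rw [leftOp_eq_adOp] at hT
    refine hT.map (rightMul G) fun z v => ?_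
    change (_ * v - v * 0) * G = _ * (v * G) - (v * G) * 0
    noncomm_ring
  have hfin : Y 1 * Z 1 = T 1 * G := huniq hB h0 (hY.mul hZ) hTG (by
    rw [hY0, hZ0, hT0, Matrix.mul_assoc, Matrix.nonsing_inv_mul _ hX'₀, Matrix.mul_one])
  have hZu : Z 1 * W 1 = 1 := mul_eq_one_comm.1 hWZ
  calc Y 1 = Y 1 * Z 1 * W 1 := by rw [Matrix.mul_assoc, hZu, Matrix.mul_one]
    _ = Xm (0 - 1) x₀ * G * (Xm' (0 - 1) x₀)⁻¹ * (Z 1 * W 1) := by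
      rw [hfin, hT1]
      have := Matrix.nonsing_inv_mul G hG
      simp only [Matrix.mul_assoc]
      rw [← Matrix.mul_assoc G⁻¹ G, this, Matrix.one_mul]
    _ = _ := by rw [hZu, Matrix.mul_one]

end Gauge

/-! ### Extension to the Riemann sphere -/

section Extension

variable {V : Type*} [NormedAddCommGroup V] [NormedSpace ℂ V] [CompleteSpace V]

/-- A solution over the punctured disk of radius `R`, all of whose singular points have absolute
value less than `R / 2`, extends to the complement of the singular points when its continuation
along `loopInfty` is single-valued. -/
theorem exists_extension_of_loopInfty {R : ℝ} (hR : 0 < R) {L : ℂ → V →L[ℂ] V} {Z : Set ℂ}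
    (hZ : ∀ x ∈ Z, ‖x‖ < R / 2)
    (hL : DifferentiableOn ℂ L {x | R / 2 < ‖x‖ ∧ x ≠ R}) {h : ℂ → V}
    (hh : ∀ x : ℂ, ‖x‖ < R → x ∉ Z → HasDerivAt h (L x (h x)) x) {Y : ℝ → V}
    (hY : IsContinuationOn L (loopInfty R) (Icc 0 1) Y)
    (h0 : Y 0 = h ((3 * R / 4 : ℝ) : ℂ)) (h1 : Y 1 = Y 0) :
    ∃ H : ℂ → V, (∀ x : ℂ, ‖x‖ < R → H x = h x) ∧
      ∀ x : ℂ, x ≠ R → x ∉ Z → HasDerivAt H (L x (H x)) x := by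
  have hπ := Real.pi_pos
  have hw₀ := logPoint_re_mem hR 0
  have hexp0 : Complex.exp (logPoint R 0) = ((3 * R / 4 : ℝ) : ℂ) := by
    rw [logPoint_zero hR, Complex.exp_log]
    exact_mod_cast (by positivity : (3 * R / 4 : ℝ) ≠ 0)
  obtain ⟨Φ, hΦ0, hΦ⟩ := exists_logDevelopment hR hL hw₀.1 hw₀.2 (h ((3 * R / 4 : ℝ) : ℂ))
  have hper : ∀ w : ℂ, w.re ∈ Ioi (Real.log R) → Φ (w + 2 * Real.pi * Complex.I) = Φ w :=
    fun w hw => shift_eq_of_loopInfty hR hL hΦ (τ := ContinuousLinearMap.id ℂ V)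
      (fun _ _ => rfl) hY (by rw [h0, ← logPoint_zero hR, hΦ0]) (by rw [h1]; rfl) hw
  -- over the annulus `R / 2 < |x| < R`, the development is the solution `h`
  have hstrip : ∀ w : ℂ, Real.log (R / 2) < w.re → w.re < Real.log R → Φ w = h (Complex.exp w) := by
    intro w hw hw'
    let D₀ : Set ℂ := {w | Real.log (R / 2) < w.re} ∩ {w | w.re < Real.log R}
    have hop := differentiableOn_logOp hL (fun w hw => exp_mem_of_mem_logDomain hR hw)
    have hsub : D₀ ⊆ logDomain R := fun w hw => ⟨hw.1, Or.inl (ne_of_lt hw.2)⟩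
    refine linearODE_unique (g := fun w => h (Complex.exp w)) (U := D₀)
      ((isOpen_lt continuous_const Complex.continuous_re).inter
        (isOpen_lt Complex.continuous_re continuous_const))
      ((convex_halfSpace_re_gt _).inter (convex_halfSpace_re_lt _)).isPreconnected
      (hop.continuousOn.mono hsub) (fun w hw => hΦ w (hsub hw)) (fun w hw => ?_) hw₀
      (by rw [hΦ0, hexp0]) ⟨hw, hw'⟩
    refine hasDerivAt_logOp_of_solution (hh _ ?_ fun hmem => ?_)
    · rw [Complex.norm_exp, ← Real.exp_log hR]
      exact Real.exp_lt_exp.2 hw.2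
    · exact absurd (hZ _ hmem) (not_lt.2 (exp_mem_of_mem_logDomain hR (hsub hw)).1.le)
  -- the branch of the logarithm with imaginary part in `(0, 2π]`
  let β : ℂ → ℂ := fun x => Complex.log (-x) + Real.pi * Complex.I
  have hβexp : ∀ x : ℂ, x ≠ 0 → Complex.exp (β x) = x := fun x hx => by
    simp only [β]
    rw [Complex.exp_add, Complex.exp_log (neg_ne_zero.2 hx), Complex.exp_pi_mul_I, mul_neg_one,
      neg_neg]
  have hβre : ∀ x : ℂ, (β x).re = Real.log ‖x‖ := fun x => by
    simp [β, Complex.log_re]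
  have hnorm0 : ∀ {x : ℂ}, R ≤ ‖x‖ → x ≠ 0 := fun {x} hx => norm_pos_iff.1 (hR.trans_le hx)
  refine ⟨fun x => if ‖x‖ < R then h x else Φ (β x), fun x hx => if_pos hx, fun x hxR hxZ => ?_⟩
  rcases lt_trichotomy ‖x‖ R with hx | hx | hx
  · simp only [if_pos hx]
    refine (hh x hx hxZ).congr_of_eventuallyEq ?_
    filter_upwards [(isOpen_lt continuous_norm continuous_const).mem_nhds hx] with z hz
    exact if_pos hz
  · have hx0 := hnorm0 hx.ge
    simp only [if_neg hx.not_lt]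
    have hslit : -x ∈ Complex.slitPlane := by
      rw [Complex.mem_slitPlane_iff]
      by_contra! hcon
      apply hxR
      have him : x.im = 0 := by simpa using hcon.2
      have hre : 0 ≤ x.re := by simpa using hcon.1
      have hxr : x = (x.re : ℂ) := Complex.ext rfl (by simpa using him)
      rw [hxr, Complex.norm_real, Real.norm_of_nonneg hre] at hx
      rw [hxr, hx]
    have hβd : HasDerivAt β x⁻¹ x := by
      refine (((hasDerivAt_neg x).clog hslit).add_const _).congr_deriv ?_
      rw [neg_div_neg_eq, one_div]
    have hmem : β x ∈ logDomain R := by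
      refine ⟨?_, Or.inr ?_⟩
      · rw [hβre, hx]
        exact log_half_lt_log hR
      · have him : (β x).im = Complex.arg (-x) + Real.pi := by simp [β, Complex.log_im]
        have h1 := Complex.neg_pi_lt_arg (-x)
        have h2 := (Complex.arg_le_pi (-x)).lt_of_ne (Complex.mem_slitPlane_iff_arg.1 hslit).1
        rw [him]
        constructor <;> linarith
    refine (hasDerivAt_comp_of_logOp (hβexp x hx0) hβd (hΦ _ hmem)).congr_of_eventuallyEq ?_
    have hhalf : R / 2 < ‖x‖ := by linarith
    filter_upwards [(isOpen_lt continuous_const continuous_norm).mem_nhds hhalf] with z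
      (hz : R / 2 < ‖z‖)
    split_ifs with hzR
    · have hz0 : z ≠ 0 := norm_pos_iff.1 ((half_pos hR).trans hz)
      rw [hstrip, hβexp z hz0]
      · rw [hβre]
        exact Real.log_lt_log (half_pos hR) hz
      · rw [hβre]
        exact Real.log_lt_log (norm_pos_iff.2 hz0) hzR
    · rfl
  · have hx0 := hnorm0 hx.le
    have hre : (Complex.log x).re ∈ Ioi (Real.log R) := by
      rw [Complex.log_re]
      exact Real.log_lt_log hR hx
    have heq : ∀ z : ℂ, R < ‖z‖ → Φ (β z) = Φ (Complex.log z) := fun z hz =>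
      eq_of_exp_eq_of_periodic hper (by
        rw [Complex.log_re]
        exact Real.log_lt_log hR hz)
        (by rw [hβexp z (hnorm0 hz.le), Complex.exp_log (hnorm0 hz.le)])
    have hmem : Complex.log x ∈ logDomain R :=
      ⟨(log_half_lt_log hR).trans hre, Or.inl (ne_of_gt hre)⟩
    have hd := hasDerivAt_comp_log_of_periodic isOpen_Ioi hper hre (hΦ _ hmem)
    simp only [if_neg hx.not_gt]
    rw [heq x hx]
    rw [Complex.exp_log hx0] at hd
    refine (hd.congr_deriv ?_).congr_of_eventuallyEq ?_
    · change x⁻¹ • (Complex.exp (Complex.log x) • L (Complex.exp (Complex.log x)) _) = _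
      rw [Complex.exp_log hx0, smul_smul, inv_mul_cancel₀ hx0, one_smul]
    · filter_upwards [(isOpen_lt continuous_const continuous_norm).mem_nhds hx] with z
        (hz : R < ‖z‖)
      rw [if_neg hz.not_gt, heq z hz]

/-- **Liouville's theorem for Fuchsian equations**: a single-valued solution of an equation on the
Riemann sphere with simple poles, none of whose residues has a nonzero integer as eigenvalue, is
constant. -/
theorem fuchsian_const [FiniteDimensional ℂ V] {L : ℂ → V →L[ℂ] V} {P : Set ℂ} (hP : P.Finite)
    {H : ℂ → V} (hH : ∀ x ∉ P, HasDerivAt H (L x (H x)) x)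
    (hres : ∀ a ∈ P, ∃ T₀ : V →L[ℂ] V, HasNoIntEigenvalue T₀ ∧
      Tendsto (fun z : ℂ => z • L (a + z)) (𝓝[≠] 0) (𝓝 T₀))
    (hinf : ∃ T₀ : V →L[ℂ] V, HasNoIntEigenvalue T₀ ∧
      Tendsto (fun z : ℂ => -(z⁻¹ • L z⁻¹)) (𝓝[≠] 0) (𝓝 T₀)) :
    ∃ c, ∀ x ∉ P, H x = c := by
  classical
  have hoff : ∀ a, ∀ᶠ x in 𝓝[≠] a, x ∉ P := fun a => by
    have h1 : ∀ᶠ x in 𝓝 a, x ∉ P \ {a} := (hP.subset sdiff_subset).isClosed.isOpen_compl.mem_nhds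
      (fun h => h.2 rfl)
    filter_upwards [h1.filter_mono nhdsWithin_le_nhds, self_mem_nhdsWithin] with x hx hxa hxP
    exact hx ⟨hxP, hxa⟩
  have hlim : ∀ a ∈ P, ∃ l, Tendsto H (𝓝[≠] a) (𝓝 l) := by
    intro a ha
    obtain ⟨T₀, hT₀, hT⟩ := hres a ha
    have hmap : Tendsto (fun z : ℂ => a + z) (𝓝[≠] 0) (𝓝[≠] a) := by
      refine tendsto_nhdsWithin_iff.2 ⟨?_, ?_⟩
      · have : ContinuousAt (fun z : ℂ => a + z) 0 := by fun_prop
        simpa using this.tendsto.mono_left (nhdsWithin_le_nhds (s := {0}ᶜ))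
      · filter_upwards [self_mem_nhdsWithin] with z (hz : z ≠ 0)
        simpa using hz
    obtain ⟨l, hl⟩ := fuchsian_tendsto hT (h := fun z => H (a + z)) (by
      filter_upwards [hmap.eventually (hoff a), self_mem_nhdsWithin] with z hz (hz0 : z ≠ 0)
      refine ((hH _ hz).comp_const_add a z).congr_deriv ?_
      change _ = z⁻¹ • (z • L (a + z) (H (a + z)))
      rw [smul_smul, inv_mul_cancel₀ hz0, one_smul]) hT₀
    refine ⟨l, ?_⟩
    have hmap' : Tendsto (fun x : ℂ => x - a) (𝓝[≠] a) (𝓝[≠] 0) := by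
      refine tendsto_nhdsWithin_iff.2 ⟨?_, ?_⟩
      · have : ContinuousAt (fun x : ℂ => x - a) a := by fun_prop
        simpa using this.tendsto.mono_left (nhdsWithin_le_nhds (s := {a}ᶜ))
      · filter_upwards [self_mem_nhdsWithin] with x (hx : x ≠ a)
        simpa [sub_eq_zero] using hx
    refine (hl.comp hmap').congr fun x => ?_
    simp
  choose! l hl using hlim
  have hFd : Differentiable ℂ fun x => if x ∈ P then l x else H x := by
    intro a
    have hd : ∀ᶠ x in 𝓝[≠] a, DifferentiableAt ℂ (fun x => if x ∈ P then l x else H x) x := by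
      filter_upwards [hoff a] with x hx
      refine (hH x hx).differentiableAt.congr_of_eventuallyEq ?_
      filter_upwards [hP.isClosed.isOpen_compl.mem_nhds hx] with z hz
      exact if_neg hz
    refine (Complex.analyticAt_of_differentiable_on_punctured_nhds_of_continuousAt hd
      ?_).differentiableAt
    rw [continuousAt_iff_punctured_nhds]
    by_cases ha : a ∈ P
    · rw [if_pos ha]
      refine (hl a ha).congr' ?_
      filter_upwards [hoff a] with x hx
      exact (if_neg hx).symm
    · rw [if_neg ha]
      refine ((hH a ha).continuousAt.tendsto.mono_left nhdsWithin_le_nhds).congr' ?_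
      filter_upwards [hoff a] with x hx
      exact (if_neg hx).symm
  obtain ⟨T₀, hT₀, hT⟩ := hinf
  have hinv : Tendsto (fun z : ℂ => z⁻¹) (𝓝[≠] 0) (cocompact ℂ) := by
    rw [← Metric.cobounded_eq_cocompact]
    exact Filter.tendsto_inv₀_nhdsNE_zero (α := ℂ)
  have hoff' : ∀ᶠ x in cocompact ℂ, x ∉ P := hP.isCompact.compl_mem_cocompact
  obtain ⟨c, hc⟩ := fuchsian_tendsto hT (h := fun z => H z⁻¹) (by
    filter_upwards [hinv.eventually hoff', self_mem_nhdsWithin] with z hz (hz0 : z ≠ 0)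
    refine ((hH _ hz).scomp z (hasDerivAt_inv hz0)).congr_deriv ?_
    change _ = z⁻¹ • (-(z⁻¹ • L z⁻¹ (H z⁻¹)))
    rw [smul_neg, smul_smul, neg_smul]
    congr 2
    field_simp) hT₀
  have hcoc : Tendsto (fun x => if x ∈ P then l x else H x) (cocompact ℂ) (𝓝 c) := by
    have h1 : Tendsto (fun x : ℂ => x⁻¹) (cocompact ℂ) (𝓝[≠] 0) := by
      rw [← Metric.cobounded_eq_cocompact]
      exact Filter.tendsto_inv₀_cobounded' (α := ℂ)
    refine (hc.comp h1).congr' ?_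
    filter_upwards [hoff'] with x hx
    simp only [Function.comp_apply, inv_inv]
    exact (if_neg hx).symm
  refine ⟨c, fun x hx => ?_⟩
  have := hFd.apply_eq_of_tendsto_cocompact x hcoc
  rwa [if_neg hx] at this

end Extension

/-! ### Constant gauge transformations -/

theorem RationalSystem.eq_of_coeff_eq {k n : ℕ} {sys sys' : RationalSystem k n}
    (hA : sys.A = sys'.A) (hAhat : sys.Ahat = sys'.Ahat) : sys = sys' := by
  cases sys
  cases sys'
  simp_all

section ConstantGauge

open scoped Matrix.Norms.Operator

variable {k n : ℕ}

theorem hasDerivAt_matrix_inv {X : ℂ → Matrix (Fin n) (Fin n) ℂ} {d : Matrix (Fin n) (Fin n) ℂ}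
    {z : ℂ} (hX : HasDerivAt X d z) (hu : IsUnit (X z).det) :
    HasDerivAt (fun z => (X z)⁻¹) (-((X z)⁻¹ * d * (X z)⁻¹)) z := by
  obtain ⟨x, hx⟩ := (Matrix.isUnit_iff_isUnit_det _).2 hu
  have h1 := hasFDerivAt_ringInverse (𝕜 := ℂ) x
  rw [hx] at h1
  have h2 := h1.comp_hasDerivAt z hX
  have h3 : (↑x⁻¹ : Matrix (Fin n) (Fin n) ℂ) = (X z)⁻¹ := by
    rw [← hx, Matrix.coe_units_inv]
  rw [h3] at h2
  refine (h2.congr_of_eventuallyEq (Eventually.of_forall fun w => ?_)).congr_deriv ?_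
  · exact Matrix.nonsing_inv_eq_ringInverse (X w)
  · simp

/-- The continuation of the inverse of a fundamental solution. -/
theorem RationalSystem.IsContinuation.inv {sys : RationalSystem k n} {R : ℝ}
    {ε : Fin k → ℂ} {γ : ℝ → ℂ} {Y : ℝ → Matrix (Fin n) (Fin n) ℂ}
    (h : sys.IsContinuation R ε γ Y) :
    IsContinuationOn (fun x => adOp 0 (sys.B R ε x)) γ (Icc 0 1) fun t => (Y t)⁻¹ := by
  intro t ht
  obtain ⟨Z, hZ, hY⟩ := h t ht
  refine ⟨fun z => (Z z)⁻¹, ?_, hY.mono fun s hs => by simp only [hs]⟩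
  filter_upwards [hZ] with z hz
  refine (hasDerivAt_matrix_inv hz.hasDerivAt hz.1).congr_deriv ?_
  rw [adOp_apply, Matrix.mul_assoc, Matrix.mul_assoc, Matrix.mul_nonsing_inv _ hz.1,
    Matrix.mul_one, zero_mul, zero_sub]

theorem RationalSystem.IsContinuation.isUnit_det {sys : RationalSystem k n} {R : ℝ}
    {ε : Fin k → ℂ} {γ : ℝ → ℂ} {Y : ℝ → Matrix (Fin n) (Fin n) ℂ}
    (h : sys.IsContinuation R ε γ Y) {t : ℝ} (ht : t ∈ Icc (0 : ℝ) 1) : IsUnit (Y t).det := by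
  obtain ⟨Z, hZ, hY⟩ := h t ht
  rw [hY.self_of_nhdsWithin ht]
  exact hZ.self_of_nhds.1

variable [NeZero k] {R ρ : ℝ} {S : DSDomain k R ρ} {Λ : FormalInvariants k n ρ}
  {CU0 CL0 : Fin k → Matrix (Fin n) (Fin n) ℂ} {C : StokesData S Λ CU0 CL0} {u : S.carrier}
  {sys : RationalSystem k n}

/-- Two systems with conjugate monodromy data, and without resonances between their residues, are
equivalent by a constant gauge transformation. -/
theorem exists_constant_gauge (hR : 0 < R) (hzeros : ∀ x : ℂ, pVal (S.proj u) x = 0 → ‖x‖ < R / 2)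
    {S' : DSDomain k R ρ} {C' : StokesData S' Λ CU0 CL0} {u' : S'.carrier}
    {sys' : RationalSystem k n} {M M' : Matrix (Fin n) (Fin n) ℂ}
    (h : C.IsRealizedBy u sys M) (h' : C'.IsRealizedBy u' sys' M') (hu : S'.proj u' = S.proj u)
    {G : Matrix (Fin n) (Fin n) ℂ} (hG : IsUnit G.det) (hM : M * G = G * M')
    (hconj : ∀ γ, IsLoop R (S.proj u) γ → ∀ M', C'.IsMonodromy u' γ M' →
      C.IsMonodromy u γ (G * M' * G⁻¹))
    (hres : ∀ a, pVal (S.proj u) a = 0 → HasNoIntEigenvalue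
      (adOp (((pPoly (S.proj u)).derivative.eval a)⁻¹ • ∑ m : Fin (k + 1), a ^ (m : ℕ) • sys.A m)
        (((pPoly (S.proj u)).derivative.eval a)⁻¹ • ∑ m : Fin (k + 1), a ^ (m : ℕ) • sys'.A m)))
    (hresR : HasNoIntEigenvalue (adOp sys.Ahat sys'.Ahat))
    (hresI : HasNoIntEigenvalue (adOp (-(sys.A (Fin.last k) + sys.Ahat))
      (-(sys'.A (Fin.last k) + sys'.Ahat)))) :
    ∃ H : Matrix (Fin n) (Fin n) ℂ, IsUnit H.det ∧ ∀ x : ℂ, x ≠ R → pVal (S.proj u) x ≠ 0 →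
      sys.B R (S.proj u) x * H = H * sys'.B R (S.proj u) x := by
  obtain ⟨Xp, Xm, hXp, hXm, -, -, hU, hL, hGt, Y, hY, hY0, hY1⟩ := h
  obtain ⟨Xp', Xm', hXp', hXm', -, -, hU', hL', hGt', Y', hY', hY0', hY1'⟩ := h'
  have hsec : C.IsSectorial u sys Xp Xm := ⟨hXp, hXm, hU, hL, hGt⟩
  have hsec' : C'.IsSectorial u' sys' Xp' Xm' := ⟨hXp', hXm', hU', hL', hGt'⟩
  obtain ⟨H₁, hH₁0, hH₁⟩ := exists_gauge_punctured_disk hR hsec hsec' hu hG hconj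
  rw [hu] at hY'
  set ε := S.proj u with hε
  set x₀ : ℂ := ((3 * R / 4 : ℝ) : ℂ) with hx₀
  have hX₀ : IsUnit (Xm (0 - 1) x₀).det := (hXm _ _ (S.sec u).base_mem).1
  have hX₀' : IsUnit (Xm' (0 - 1) x₀).det := (hXm' _ _ (S'.sec u').base_mem).1
  have hx₀mem := (S.sec u).mem_punctured_of_minus (S.sec u).base_mem
  have hRn : ‖(R : ℂ)‖ = R := by rw [Complex.norm_real, Real.norm_of_nonneg hR.le]
  have hpR : ∀ x : ℂ, R / 2 < ‖x‖ → pVal ε x ≠ 0 := fun x hx h0 =>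
    absurd (hzeros x h0) hx.not_gt
  have hop : DifferentiableOn ℂ (fun x => adOp (sys.B R ε x) (sys'.B R ε x))
      {x | R / 2 < ‖x‖ ∧ x ≠ R} := fun x hx =>
    (differentiableAt_adOp (sys.differentiableAt_B (hpR x hx.1) hx.2)
      (sys'.differentiableAt_B (hpR x hx.1) hx.2)).differentiableWithinAt
  -- the continuation along `loopInfty`
  have hYG : IsContinuationOn (fun x => adOp (sys.B R ε x) 0) (loopInfty R) (Icc 0 1)
      fun t => Y t * G := by
    have := hY.isContinuationOn
    rw [leftOp_eq_adOp] at this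
    refine this.map (rightMul G) fun z v => ?_
    change (_ * v - v * 0) * G = _ * (v * G) - (v * G) * 0
    noncomm_ring
  have hM' : IsUnit M'.det := isUnit_of_eq_mul (hY'.isUnit_det (by simp)) hY1'
  obtain ⟨H, hH₁H, hH⟩ := exists_extension_of_loopInfty (Z := {x | pVal ε x = 0}) hR hzeros hop
    (fun x hx hxZ => hH₁ x hx hxZ) (hYG.mul hY'.inv)
    (by rw [hH₁0, hY0, hY0'])
    (by
      rw [hY1, hY1', hY0, hY0', Matrix.mul_inv_rev, Matrix.mul_assoc (Xm _ _) M G, hM]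
      simp only [Matrix.mul_assoc]
      rw [← Matrix.mul_assoc M' M'⁻¹, Matrix.mul_nonsing_inv _ hM', Matrix.one_mul])
  obtain ⟨c, hc⟩ := fuchsian_const (P := insert (R : ℂ) {x | pVal ε x = 0})
    ((finite_zeros ε).insert _)
    (L := fun x => adOp (sys.B R ε x) (sys'.B R ε x)) (H := H)
    (fun x hx => hH x (fun h0 => hx (Or.inl h0)) (fun h0 => hx (Or.inr h0)))
    (by
      rintro a (rfl | ha)
      · refine ⟨_, hresR, ?_⟩
        refine (tendsto_adOp (sys.tendsto_residue_R (hpR R (by rw [hRn]; linarith)))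
          (sys'.tendsto_residue_R (hpR R (by rw [hRn]; linarith)))).congr fun z => ?_
        exact adOp_smul _ _ _
      · have haR : a ≠ R := by
          rintro rfl
          exact hpR R (by rw [hRn]; linarith) ha
        have ha' : (pPoly ε).derivative.eval a ≠ 0 := by
          have hsep : (pPoly ε).Separable := (S.proj_mem u).1
          have := Polynomial.Separable.aeval_derivative_ne_zero hsep (x := a) ha
          simpa using this
        refine ⟨_, hres a ha, ?_⟩
        refine (tendsto_adOp (sys.tendsto_residue_zero ha ha' haR)
          (sys'.tendsto_residue_zero ha ha' haR)).congr fun z => ?_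
        exact adOp_smul _ _ _)
    ⟨_, hresI, (tendsto_adOp (sys.tendsto_residue_infty R ε)
      (sys'.tendsto_residue_infty R ε)).congr fun z => by
        rw [← neg_smul, ← neg_smul, adOp_smul, neg_smul]⟩
  refine ⟨c, ?_, fun x hxR hx => ?_⟩
  · have hx₀P : x₀ ∉ insert (R : ℂ) {x | pVal ε x = 0} := by
      rintro (h0 | h0)
      · have := hx₀mem.1
        rw [← hx₀, h0, hRn] at this
        exact lt_irrefl _ this
      · exact hx₀mem.2 h0
    rw [← hc x₀ hx₀P, hH₁H x₀ hx₀mem.1, hH₁0, Matrix.det_mul, Matrix.det_mul]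
    exact (hX₀.mul hG).mul (Matrix.isUnit_nonsing_inv_det _ hX₀')
  · have hxP : x ∉ insert (R : ℂ) {x | pVal ε x = 0} := by
      rintro (h0 | h0)
      · exact hxR h0
      · exact hx h0
    have hev : (fun _ => c) =ᶠ[𝓝 x] H := by
      filter_upwards [((finite_zeros ε).insert (R : ℂ)).isClosed.isOpen_compl.mem_nhds hxP]
        with z hz
      exact (hc z hz).symm
    have h1 := ((hH x hxR hx).congr_of_eventuallyEq hev).unique (hasDerivAt_const x c)
    rw [hc x hxP, adOp_apply, sub_eq_zero] at h1
    exact h1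

omit [NeZero k] in
/-- A constant gauge transformation between two systems conjugates all the coefficients, because
`p_ε` does not vanish at `R`. -/
theorem RationalSystem.coeff_gauge {sys sys' : RationalSystem k n} {ε : Fin k → ℂ}
    (hpR : pVal ε R ≠ 0) {H : Matrix (Fin n) (Fin n) ℂ}
    (hH : ∀ x : ℂ, x ≠ R → pVal ε x ≠ 0 → sys.B R ε x * H = H * sys'.B R ε x) :
    (∀ m, sys.A m * H = H * sys'.A m) ∧ sys.Ahat * H = H * sys'.Ahat := by
  have key : ∀ i l, (Polynomial.X - Polynomial.C (R : ℂ)) *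
      (∑ m : Fin (k + 1), Polynomial.C ((sys.A m * H - H * sys'.A m) i l) *
        Polynomial.X ^ (m : ℕ)) +
      pPoly ε * Polynomial.C ((sys.Ahat * H - H * sys'.Ahat) i l) = 0 := by
    intro i l
    refine Polynomial.eq_zero_of_infinite_isRoot _ (Set.Infinite.mono ?_
      (((finite_zeros ε).insert (R : ℂ)).infinite_compl))
    intro x hx
    have hxR : x ≠ R := fun h => hx (Or.inl h)
    have hxp : pVal ε x ≠ 0 := fun h => hx (Or.inr h)
    have h1 := congrFun (congrFun (hH x hxR hxp) i) l
    have h2 : ((pVal ε x)⁻¹ • (∑ m : Fin (k + 1), x ^ (m : ℕ) • (sys.A m * H - H * sys'.A m)) +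
        (x - R)⁻¹ • (sys.Ahat * H - H * sys'.Ahat)) i l = 0 := by
      rw [← sub_eq_zero, ← Matrix.sub_apply] at h1
      rw [← h1]
      refine congrFun (congrFun ?_ i) l
      simp only [RationalSystem.B, add_mul, mul_add, smul_mul_assoc, mul_smul_comm,
        Finset.sum_mul, Finset.mul_sum, smul_sub, Finset.sum_sub_distrib]
      abel
    have hxR' : x - R ≠ 0 := sub_ne_zero.2 hxR
    rw [mem_ofPred_eq, Polynomial.IsRoot.def]
    simp only [Polynomial.eval_add, Polynomial.eval_mul, Polynomial.eval_sub, Polynomial.eval_X,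
      Polynomial.eval_C, Polynomial.eval_finsetSum, Polynomial.eval_pow]
    change (x - R) * _ + pVal ε x * _ = 0
    simp only [Matrix.add_apply, Matrix.smul_apply, Matrix.sum_apply, smul_eq_mul] at h2
    have h3 : ∑ m : Fin (k + 1), (sys.A m * H - H * sys'.A m) i l * x ^ (m : ℕ) =
        ∑ m : Fin (k + 1), x ^ (m : ℕ) * (sys.A m * H - H * sys'.A m) i l :=
      Finset.sum_congr rfl fun m _ => mul_comm _ _
    rw [h3]
    field_simp at h2
    linear_combination h2
  have hhat : ∀ i l, (sys.Ahat * H - H * sys'.Ahat) i l = 0 := by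
    intro i l
    have := congrArg (Polynomial.eval (R : ℂ)) (key i l)
    simp only [Polynomial.eval_add, Polynomial.eval_mul, Polynomial.eval_sub, Polynomial.eval_X,
      Polynomial.eval_C, sub_self, zero_mul, zero_add, Polynomial.eval_zero] at this
    exact (mul_eq_zero.1 this).resolve_left hpR
  constructor
  · intro m
    ext i l
    have h1 := key i l
    rw [hhat, Polynomial.C_0, mul_zero, add_zero] at h1
    have h2 := (mul_eq_zero.1 h1).resolve_left (Polynomial.X_sub_C_ne_zero _)
    have h3 := congrArg (fun q => Polynomial.coeff q (m : ℕ)) h2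
    simp only [Polynomial.finsetSum_coeff, Polynomial.coeff_C_mul, Polynomial.coeff_X_pow,
      Polynomial.coeff_zero] at h3
    rw [Finset.sum_eq_single m] at h3
    · simpa [sub_eq_zero] using h3
    · intro m' _ hm'
      rw [if_neg (fun h => hm' (Fin.ext h.symm)), mul_zero]
    · intro hm
      exact absurd (Finset.mem_univ m) hm
  · ext i l
    have := hhat i l
    rwa [Matrix.sub_apply, sub_eq_zero] at this

omit [NeZero k] in
/-- Normalized systems which are equivalent by a constant gauge transformation `H` are equal, if the
diagonal matrices `A_0` have no common entry in different positions: `H` is then diagonal, and its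
entries are equal by the normalization. -/
theorem RationalSystem.IsNormalized.eq_of_gauge {sys sys' : RationalSystem k n} {ε : Fin k → ℂ}
    {T : NormalizingMonomials k n} (h : sys.IsNormalized R ε T) (h' : sys'.IsNormalized R ε T)
    (hd : ∀ i l, i ≠ l → sys.A 0 i i ≠ sys'.A 0 l l) {H : Matrix (Fin n) (Fin n) ℂ}
    (hH : IsUnit H.det) (hA : ∀ m, sys.A m * H = H * sys'.A m)
    (hAhat : sys.Ahat * H = H * sys'.Ahat) : sys = sys' := by
  have hdiag : H = Matrix.diagonal fun i => H i i := by
    ext i l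
    by_cases hil : i = l
    · rw [hil, Matrix.diagonal_apply_eq]
    · rw [Matrix.diagonal_apply_ne _ hil]
      have h1 := congrFun (congrFun (hA 0) i) l
      rw [← h.1.diagonal_diag, ← h'.1.diagonal_diag, Matrix.diagonal_mul, Matrix.mul_diagonal,
        Matrix.diag_apply, Matrix.diag_apply] at h1
      have h2 : (sys.A 0 i i - sys'.A 0 l l) * H i l = 0 := by linear_combination h1
      exact (mul_eq_zero.1 h2).resolve_left (sub_ne_zero.2 (hd i l hil))
  set d : Fin n → ℂ := fun i => H i i with hdd
  have hd0 : ∀ i, d i ≠ 0 := by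
    rw [hdiag, Matrix.det_diagonal] at hH
    exact fun i => (Finset.prod_ne_zero_iff.1 hH.ne_zero) i (Finset.mem_univ i)
  have hcA : ∀ m i l, sys.A m i l * d l = d i * sys'.A m i l := fun m i l => by
    have h1 := congrFun (congrFun (hA m) i) l
    rwa [hdiag, Matrix.mul_diagonal, Matrix.diagonal_mul] at h1
  have hcAhat : ∀ i l, sys.Ahat i l * d l = d i * sys'.Ahat i l := fun i l => by
    have h1 := congrFun (congrFun hAhat i) l
    rwa [hdiag, Matrix.mul_diagonal, Matrix.diagonal_mul] at h1
  have hnum : ∀ i l, sys.numerator R ε i l * Polynomial.C (d l) =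
      Polynomial.C (d i) * sys'.numerator R ε i l := by
    intro i l
    have h1 : sys.polyA i l * Polynomial.C (d l) = Polynomial.C (d i) * sys'.polyA i l := by
      simp only [RationalSystem.polyA, Finset.sum_mul, Finset.mul_sum]
      refine Finset.sum_congr rfl fun m _ => ?_
      rw [← mul_assoc, ← Polynomial.C_mul, ← hcA, Polynomial.C_mul]
      ring
    have h2 : Polynomial.C (sys.Ahat i l) * Polynomial.C (d l) =
        Polynomial.C (d i) * Polynomial.C (sys'.Ahat i l) := by
      rw [← Polynomial.C_mul, ← Polynomial.C_mul, hcAhat]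
    simp only [RationalSystem.numerator]
    linear_combination (Polynomial.X - Polynomial.C (R : ℂ)) * h1 + pPoly ε * h2
  have hdeq := T.suitable d hd0 fun q => by
    have h1 := congrArg (fun p => Polynomial.coeff p (T.expo q)) (hnum (T.row q) (T.col q))
    simp only [Polynomial.coeff_mul_C, Polynomial.coeff_C_mul] at h1
    rw [h.2 q, h'.2 q, one_mul, mul_one] at h1
    exact h1.symm
  have hA' : sys.A = sys'.A := by
    funext m
    ext i l
    have h1 := hcA m i l
    rw [hdeq l i, mul_comm] at h1
    exact mul_left_cancel₀ (hd0 i) h1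
  have hAhat' : sys.Ahat = sys'.Ahat := by
    ext i l
    have h1 := hcAhat i l
    rw [hdeq l i, mul_comm] at h1
    exact mul_left_cancel₀ (hd0 i) h1
  exact eq_of_coeff_eq hA' hAhat'

end ConstantGauge

/-! ### Scaling of the parameters -/

section Scaling

variable {k n : ℕ}

theorem analyticAt_rescale (ε : Fin k → ℂ) (r : ℝ) : AnalyticAt ℝ (fun r => rescale r ε) r := by
  refine AnalyticAt.pi fun j => ?_
  have h1 : AnalyticAt ℝ (fun r : ℝ => (r : ℂ)) r := Complex.ofRealCLM.analyticAt r
  exact (h1.pow _).mul analyticAt_const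

theorem rescale_zero (ε : Fin k → ℂ) : rescale 0 ε = 0 := by
  funext j
  have : k + 1 - (j : ℕ) ≠ 0 := by omega
  simp [rescale, this]

theorem rescale_mem_polydisk {ρ : ℝ} {ε : Fin k → ℂ} (hε : ε ∈ polydisk k ρ) {r : ℝ}
    (hr : r ∈ Icc (0 : ℝ) 1) : rescale r ε ∈ polydisk k ρ := fun j => by
  refine lt_of_le_of_lt ?_ (hε j)
  rw [rescale, norm_mul, norm_pow, Complex.norm_real, Real.norm_of_nonneg hr.1]
  exact mul_le_of_le_one_left (norm_nonneg _) (pow_le_one₀ hr.1 hr.2)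

theorem pVal_rescale (ε : Fin k → ℂ) (r : ℝ) (x : ℂ) :
    pVal (rescale r ε) (r * x) = r ^ (k + 1) * pVal ε x := by
  rw [pVal_eq, pVal_eq, mul_add, mul_pow, Finset.mul_sum]
  congr 1
  refine Finset.sum_congr rfl fun j _ => ?_
  have : (r : ℂ) ^ (k + 1) = (r : ℂ) ^ (k + 1 - (j : ℕ)) * (r : ℂ) ^ (j : ℕ) := by
    rw [← pow_add]
    congr 1
    omega
  rw [rescale, mul_pow, this]
  ring

theorem derivative_pPoly_rescale (ε : Fin k → ℂ) {r : ℝ} (hr : r ≠ 0) (x : ℂ) :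
    (pPoly (rescale r ε)).derivative.eval (r * x) = r ^ k * (pPoly ε).derivative.eval x := by
  have hr' : (r : ℂ) ≠ 0 := by exact_mod_cast hr
  have h1 : HasDerivAt (fun x : ℂ => pVal (rescale r ε) (r * x))
      ((pPoly (rescale r ε)).derivative.eval (r * x) * r) x := by
    exact ((pPoly (rescale r ε)).hasDerivAt (r * x)).comp x
      (((hasDerivAt_id' x).const_mul (r : ℂ)).congr_deriv (mul_one _))
  have h2 : HasDerivAt (fun x : ℂ => pVal (rescale r ε) (r * x))
      (r ^ (k + 1) * (pPoly ε).derivative.eval x) x := by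
    simp only [pVal_rescale]
    exact ((pPoly ε).hasDerivAt x).const_mul _
  have h3 := h1.unique h2
  rw [pow_succ, mul_right_comm] at h3
  exact mul_right_cancel₀ hr' h3

variable {ρ : ℝ}

theorem FormalInvariants.lam_eq (Λ : FormalInvariants k n ρ) (ε : Fin k → ℂ) (i : Fin n) (x : ℂ) :
    Λ.lam ε i x = ∑ m : Fin (k + 1), Λ.coeff m ε i * x ^ (m : ℕ) := by
  simp [FormalInvariants.lam, FormalInvariants.lamPoly, Polynomial.eval_finsetSum]

theorem FormalInvariants.analyticAt_lam (Λ : FormalInvariants k n ρ) {ε : Fin k → ℂ}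
    (i : Fin n) (a : ℂ) {r : ℝ} (hr : rescale r ε ∈ polydisk k ρ) :
    AnalyticAt ℝ (fun r : ℝ => Λ.lam (rescale r ε) i (r * a)) r := by
  simp only [FormalInvariants.lam_eq]
  refine Finset.analyticAt_fun_sum _ fun m _ => ?_
  have h1 : AnalyticAt ℝ (fun r : ℝ => (r : ℂ)) r := Complex.ofRealCLM.analyticAt r
  have h2 : AnalyticAt ℝ (fun r => Λ.coeff m (rescale r ε) i) r :=
    ((Λ.analytic m i _ hr).restrictScalars (𝕜 := ℝ)).comp
      (f := fun r => rescale r ε) (analyticAt_rescale ε r)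
  exact h2.mul ((h1.mul analyticAt_const).pow _)

/-- The eigenvalues `λ_i(a) / p_ε'(a)` of the residues at the zeroes `a` of `p_ε` do not differ by
nonzero integers. -/
def FormalInvariants.IsNonresonantAt (Λ : FormalInvariants k n ρ) (ε : Fin k → ℂ) : Prop :=
  ∀ a, pVal ε a = 0 → ∀ m : ℤ, m ≠ 0 → ∀ i l,
    Λ.lam ε l a + m * (pPoly ε).derivative.eval a ≠ Λ.lam ε i a

/-- On a ray, the resonant parameters are isolated: for `i ≠ l`, the difference
`λ_i(r a) - λ_l(r a)` does not vanish at `r = 0`, whereas the derivative `r ^ k p_ε'(a)` of the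
polynomial at `r a` does. -/
theorem FormalInvariants.eventually_isNonresonantAt [NeZero k] (Λ : FormalInvariants k n ρ)
    {ε : Fin k → ℂ} (hε : ε ∈ polydisk k ρ) (hsep : ε ∈ sigmaZero k) {r₁ : ℝ}
    (hr₁ : r₁ ∈ Ioo (0 : ℝ) 1) : ∀ᶠ r in 𝓝[≠] r₁, Λ.IsNonresonantAt (rescale r ε) := by
  have hk : k ≠ 0 := NeZero.ne k
  have hder : ∀ a, pVal ε a = 0 → (pPoly ε).derivative.eval a ≠ 0 := fun a ha => by
    have := Polynomial.Separable.aeval_derivative_ne_zero (show (pPoly ε).Separable from hsep)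
      (x := a) ha
    simpa using this
  have hIcc : Icc (0 : ℝ) 1 ∈ 𝓝 r₁ := Icc_mem_nhds hr₁.1 hr₁.2
  -- a single integer `m`
  have hone : ∀ a, pVal ε a = 0 → ∀ m : ℤ, m ≠ 0 → ∀ i l, ∀ᶠ r : ℝ in 𝓝[≠] r₁,
      Λ.lam (rescale r ε) l (r * a) + m * (r ^ k * (pPoly ε).derivative.eval a) ≠
        Λ.lam (rescale r ε) i (r * a) := by
    intro a ha m hm i l
    by_cases hil : i = l
    · subst hil
      have h0 : ∀ᶠ r : ℝ in 𝓝[≠] r₁, r ≠ 0 :=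
        (eventually_ne_nhds hr₁.1.ne').filter_mono nhdsWithin_le_nhds
      filter_upwards [h0] with r hr h
      have hr' : (r : ℂ) ≠ 0 := by exact_mod_cast hr
      have hm' : (m : ℂ) ≠ 0 := by exact_mod_cast hm
      exact mul_ne_zero hm' (mul_ne_zero (pow_ne_zero _ hr') (hder a ha)) (by simpa using h)
    · have han : AnalyticOnNhd ℝ (fun r : ℝ => Λ.lam (rescale r ε) l (r * a) +
          m * (r ^ k * (pPoly ε).derivative.eval a) - Λ.lam (rescale r ε) i (r * a))
          (Icc 0 1) := by
        intro r hr
        have h1 : AnalyticAt ℝ (fun r : ℝ => (r : ℂ)) r := Complex.ofRealCLM.analyticAt r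
        exact ((Λ.analyticAt_lam l a (rescale_mem_polydisk hε hr)).add
          (analyticAt_const.mul ((h1.pow _).mul analyticAt_const))).sub
            (Λ.analyticAt_lam i a (rescale_mem_polydisk hε hr))
      by_contra hcon
      have hfreq : ∃ᶠ r : ℝ in 𝓝[≠] r₁, Λ.lam (rescale r ε) l (r * a) +
          m * (r ^ k * (pPoly ε).derivative.eval a) - Λ.lam (rescale r ε) i (r * a) = 0 := by
        refine (not_eventually.1 hcon).mono fun r hr => ?_
        rw [sub_eq_zero]
        exact not_not.1 hr
      have hzero := han.eqOn_zero_of_preconnected_of_frequently_eq_zero isPreconnected_Icc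
        ⟨hr₁.1.le, hr₁.2.le⟩ hfreq (show (0 : ℝ) ∈ Icc (0 : ℝ) 1 by simp)
      have hlam0 : ∀ i, Λ.lam 0 i 0 = Λ.coeff 0 0 i := fun i => by
        rw [FormalInvariants.lam_eq, Finset.sum_eq_single 0]
        · simp
        · intro m _ hm
          have : (m : ℕ) ≠ 0 := fun h => hm (Fin.ext h)
          simp [this]
        · simp
      simp only [Complex.ofReal_zero, zero_mul, rescale_zero, ne_eq, hk, not_false_eq_true,
        zero_pow, mul_zero, add_zero, hlam0, Pi.zero_apply, sub_eq_zero] at hzero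
      exact hil (Λ.ordered.injective (congrArg Complex.re hzero)).symm
  -- only finitely many integers matter near `r₁`
  have hall : ∀ a, pVal ε a = 0 → ∀ i l, ∀ᶠ r : ℝ in 𝓝[≠] r₁, ∀ m : ℤ, m ≠ 0 →
      Λ.lam (rescale r ε) l (r * a) + m * (r ^ k * (pPoly ε).derivative.eval a) ≠
        Λ.lam (rescale r ε) i (r * a) := by
    intro a ha i l
    let q : ℝ → ℂ := fun r => (Λ.lam (rescale r ε) i (r * a) - Λ.lam (rescale r ε) l (r * a)) /
      (r ^ k * (pPoly ε).derivative.eval a)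
    have hq : ContinuousAt q r₁ := by
      have hmem := rescale_mem_polydisk hε ⟨hr₁.1.le, hr₁.2.le⟩
      refine ((Λ.analyticAt_lam i a hmem).continuousAt.sub
        (Λ.analyticAt_lam l a hmem).continuousAt).div (by fun_prop) ?_
      have hr' : (r₁ : ℂ) ≠ 0 := by exact_mod_cast hr₁.1.ne'
      exact mul_ne_zero (pow_ne_zero _ hr') (hder a ha)
    obtain ⟨N, hN⟩ := exists_nat_gt ‖q r₁‖
    have hbound : ∀ᶠ r in 𝓝[≠] r₁, ‖q r‖ < N :=
      (hq.norm.eventually (gt_mem_nhds hN)).filter_mono nhdsWithin_le_nhds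
    have h0 : ∀ᶠ r : ℝ in 𝓝[≠] r₁, r ≠ 0 :=
      (eventually_ne_nhds hr₁.1.ne').filter_mono nhdsWithin_le_nhds
    have hfin : ∀ᶠ r : ℝ in 𝓝[≠] r₁, ∀ m ∈ (Finset.Icc (-(N : ℤ)) N).filter (· ≠ 0),
        Λ.lam (rescale r ε) l (r * a) + m * (r ^ k * (pPoly ε).derivative.eval a) ≠
        Λ.lam (rescale r ε) i (r * a) :=
      (Finset.eventually_all _).2 fun m hm => hone a ha m (Finset.mem_filter.1 hm).2 i l
    filter_upwards [hbound, h0, hfin] with r hrN hr0 hr m hm heq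
    refine hr m (Finset.mem_filter.2 ⟨Finset.mem_Icc.2 (abs_le.1 ?_), hm⟩) heq
    have hr' : (r : ℂ) ≠ 0 := by exact_mod_cast hr0
    have hqm : q r = m := by
      simp only [q]
      rw [← heq, add_sub_cancel_left,
        mul_div_cancel_right₀ _ (mul_ne_zero (pow_ne_zero _ hr') (hder a ha))]
    rw [hqm, Complex.norm_intCast] at hrN
    exact_mod_cast hrN.le
  have hall' : ∀ᶠ r : ℝ in 𝓝[≠] r₁, ∀ a ∈ (finite_zeros ε).toFinset, ∀ i l, ∀ m : ℤ, m ≠ 0 →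
      Λ.lam (rescale r ε) l (r * a) + m * (r ^ k * (pPoly ε).derivative.eval a) ≠
        Λ.lam (rescale r ε) i (r * a) := by
    refine (Finset.eventually_all _).2 fun a ha => ?_
    rw [eventually_all]
    intro i
    rw [eventually_all]
    intro l
    exact hall a ((finite_zeros ε).mem_toFinset.1 ha) i l
  have h0 : ∀ᶠ r : ℝ in 𝓝[≠] r₁, r ≠ 0 :=
    (eventually_ne_nhds hr₁.1.ne').filter_mono nhdsWithin_le_nhds
  filter_upwards [hall', h0] with r hr hr0 b hb m hm i l
  have hr' : (r : ℂ) ≠ 0 := by exact_mod_cast hr0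
  obtain ⟨a, rfl⟩ : ∃ a, b = r * a := ⟨b / r, by field_simp⟩
  rw [pVal_rescale] at hb
  have ha := (mul_eq_zero.1 hb).resolve_left (pow_ne_zero _ hr')
  rw [derivative_pPoly_rescale ε hr0]
  exact hr a ((finite_zeros ε).mem_toFinset.2 ha) i l m hm

/-- At a zero `a` of `p_ε`, the eigenvalues of `A(a)` are the `λ_i(a)`. -/
theorem RationalSystem.HasFormalNormalForm.exists_of_isRoot {sys : RationalSystem k n}
    {Λ : FormalInvariants k n ρ} {ε : Fin k → ℂ} (h : sys.HasFormalNormalForm Λ ε) {a : ℂ}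
    (ha : pVal ε a = 0) {μ : ℂ}
    (hμ : (∑ m : Fin (k + 1), a ^ (m : ℕ) • sys.A m).charpoly.IsRoot μ) :
    ∃ i, μ = Λ.lam ε i a := by
  have hmap : sys.polyA.map (Polynomial.evalRingHom a) =
      ∑ m : Fin (k + 1), a ^ (m : ℕ) • sys.A m := by
    ext i l
    simp only [Matrix.map_apply, RationalSystem.polyA, Polynomial.coe_evalRingHom,
      Polynomial.eval_finsetSum, Polynomial.eval_mul, Polynomial.eval_C, Polynomial.eval_pow,
      Polynomial.eval_X, Matrix.sum_apply, Matrix.smul_apply, smul_eq_mul]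
    exact Finset.sum_congr rfl fun m _ => mul_comm _ _
  have hchar : (∑ m : Fin (k + 1), a ^ (m : ℕ) • sys.A m).charpoly =
      ∏ i, (Polynomial.X - Polynomial.C (Λ.lam ε i a)) := by
    rw [← hmap, Matrix.charpoly_map]
    have : (∏ i, (Polynomial.X - Polynomial.C (Λ.lam ε i a)) : Polynomial ℂ) =
        (∏ i, (Polynomial.X - Polynomial.C (Λ.lamPoly ε i))).map (Polynomial.evalRingHom a) := by
      rw [Polynomial.map_prod]
      simp [FormalInvariants.lam]
    rw [this]
    ext c
    obtain ⟨q, hq⟩ := h c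
    have h1 := congrArg (Polynomial.eval a) hq
    rw [Polynomial.eval_mul, show (pPoly ε).eval a = 0 from ha, zero_mul, Polynomial.coeff_sub,
      Polynomial.eval_sub, sub_eq_zero] at h1
    rw [Polynomial.coeff_map, Polynomial.coeff_map]
    exact h1
  rw [hchar, Polynomial.IsRoot.def, Polynomial.eval_prod, Finset.prod_eq_zero_iff] at hμ
  obtain ⟨i, -, hi⟩ := hμ
  exact ⟨i, by simpa [sub_eq_zero] using hi⟩

end Scaling

section Radial

variable {k n : ℕ} [NeZero k] {R ρ : ℝ}

theorem DSDomain.IsAnalytic.continuous_entry {S : DSDomain k R ρ}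
    {f : S.carrier → Matrix (Fin n) (Fin n) ℂ} (hf : S.IsAnalytic f) (i l : Fin n) :
    Continuous fun u => f u i l := by
  rw [continuous_iff_continuousAt]
  intro u
  obtain ⟨g, hg, hfg⟩ := hf u i l
  have h1 : ContinuousAt (fun v => g (S.proj v)) u :=
    ContinuousAt.comp (f := S.proj) hg.continuousAt S.isLocalHomeomorph.continuous.continuousAt
  exact h1.congr_of_eventuallyEq hfg

theorem DSDomain.IsAnalytic.analyticAt_radial {S : DSDomain k R ρ}
    {f : S.carrier → Matrix (Fin n) (Fin n) ℂ} (hf : S.IsAnalytic f) (i l : Fin n)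
    {ε : Fin k → ℂ} {c : ℝ → S.carrier} (hc : ContinuousOn c (Ioc 0 1))
    (hp : ∀ r ∈ Ioc (0 : ℝ) 1, S.proj (c r) = rescale r ε) {r : ℝ} (hr : r ∈ Ioo (0 : ℝ) 1) :
    AnalyticAt ℝ (fun r => f (c r) i l) r := by
  obtain ⟨g, hg, hfg⟩ := hf (c r) i l
  have hnhds : Ioc (0 : ℝ) 1 ∈ 𝓝 r := Ioc_mem_nhds hr.1 hr.2
  rw [hp r ⟨hr.1, hr.2.le⟩] at hg
  have h1 : AnalyticAt ℝ (fun r => g (rescale r ε)) r :=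
    (hg.restrictScalars (𝕜 := ℝ)).comp
      (f := fun r => rescale r ε) (analyticAt_rescale ε r)
  refine h1.congr ?_
  have hcr : ContinuousAt c r := hc.continuousAt hnhds
  filter_upwards [hcr.eventually hfg, hnhds] with s hs hs'
  rw [hs, hp s hs']

/-- Two analytic functions which agree close to a point of a ray agree at the end of the ray. -/
theorem DSDomain.IsAnalytic.eq_of_eventually_eq {S S' : DSDomain k R ρ}
    {f : S.carrier → Matrix (Fin n) (Fin n) ℂ} {f' : S'.carrier → Matrix (Fin n) (Fin n) ℂ}
    (hf : S.IsAnalytic f) (hf' : S'.IsAnalytic f') {ε : Fin k → ℂ} {c : ℝ → S.carrier}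
    {c' : ℝ → S'.carrier} (hc : ContinuousOn c (Ioc 0 1)) (hc' : ContinuousOn c' (Ioc 0 1))
    (hp : ∀ r ∈ Ioc (0 : ℝ) 1, S.proj (c r) = rescale r ε)
    (hp' : ∀ r ∈ Ioc (0 : ℝ) 1, S'.proj (c' r) = rescale r ε) {r₁ : ℝ}
    (hr₁ : r₁ ∈ Ioo (0 : ℝ) 1) (h : ∀ᶠ r in 𝓝[≠] r₁, f (c r) = f' (c' r)) :
    f (c 1) = f' (c' 1) := by
  ext i l
  have hEq : EqOn (fun r => f (c r) i l) (fun r => f' (c' r) i l) (Ioo 0 1) :=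
    AnalyticOnNhd.eqOn_of_preconnected_of_frequently_eq
      (fun r hr => hf.analyticAt_radial i l hc hp hr)
      (fun r hr => hf'.analyticAt_radial i l hc' hp' hr) isPreconnected_Ioo hr₁
      (h.frequently.mono fun r hr => by simp only [hr])
  have hlim : ∀ {T : DSDomain k R ρ} {g : T.carrier → Matrix (Fin n) (Fin n) ℂ}
      {d : ℝ → T.carrier},
      T.IsAnalytic g → ContinuousOn d (Ioc 0 1) →
      Tendsto (fun r => g (d r) i l) (𝓝[Ioo 0 1] 1) (𝓝 (g (d 1) i l)) := by
    intro T g d hg hd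
    have h1 := ((hd 1 (by simp)).mono Ioo_subset_Ioc_self).tendsto
    exact (((hg.continuous_entry i l).tendsto _).comp h1)
  have hne : (𝓝[Ioo (0 : ℝ) 1] 1).NeBot := by
    rw [← mem_closure_iff_nhdsWithin_neBot, closure_Ioo (by norm_num)]
    simp
  refine tendsto_nhds_unique (hlim hf hc) ((hlim hf' hc').congr' ?_)
  filter_upwards [self_mem_nhdsWithin] with r hr
  exact (hEq hr).symm

theorem DSDomain.tendsto_radial {S : DSDomain k R ρ} {ε : Fin k → ℂ} {c : ℝ → S.carrier}
    (hp : ∀ r ∈ Ioc (0 : ℝ) 1, S.proj (c r) = rescale r ε) :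
    Tendsto c (𝓝[>] 0) S.nearZero := by
  rw [DSDomain.nearZero, tendsto_comap_iff]
  have h1 := ((analyticAt_rescale ε 0).continuousAt.tendsto).mono_left
    (nhdsWithin_le_nhds (s := Ioi 0))
  rw [rescale_zero] at h1
  refine h1.congr' ?_
  filter_upwards [Ioc_mem_nhdsGT (zero_lt_one (α := ℝ))] with r hr
  exact (hp r hr).symm

end Radial

/-! ### Uniqueness of normalized realizations -/

section Rigidity

open scoped Matrix.Norms.Operator

variable {k n : ℕ}

theorem FormalInvariants.IsNonresonantAt.hasNoIntEigenvalue {ρ : ℝ} {Λ : FormalInvariants k n ρ}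
    {ε : Fin k → ℂ} (hΛ : Λ.IsNonresonantAt ε) (hε : ε ∈ sigmaZero k)
    {sys sys' : RationalSystem k n} (h : sys.HasFormalNormalForm Λ ε)
    (h' : sys'.HasFormalNormalForm Λ ε) {a : ℂ} (ha : pVal ε a = 0) :
    HasNoIntEigenvalue
      (adOp (((pPoly ε).derivative.eval a)⁻¹ • ∑ m : Fin (k + 1), a ^ (m : ℕ) • sys.A m)
        (((pPoly ε).derivative.eval a)⁻¹ • ∑ m : Fin (k + 1), a ^ (m : ℕ) • sys'.A m)) := by
  intro m hm H hH
  have hder : (pPoly ε).derivative.eval a ≠ 0 := by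
    have := Polynomial.Separable.aeval_derivative_ne_zero (show (pPoly ε).Separable from hε)
      (x := a) ha
    simpa using this
  rw [adOp_smul] at hH
  refine eq_zero_of_adOp_eq_smul (c := m * (pPoly ε).derivative.eval a)
    (A := ∑ m : Fin (k + 1), a ^ (m : ℕ) • sys.A m)
    (B := ∑ m : Fin (k + 1), a ^ (m : ℕ) • sys'.A m) ?_ ?_
  · intro μ h1 h2
    obtain ⟨l, rfl⟩ := h'.exists_of_isRoot ha h1
    obtain ⟨i, hi⟩ := h.exists_of_isRoot ha h2
    exact hΛ a ha m hm i l hi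
  · have h3 := congrArg (fun X => (pPoly ε).derivative.eval a • X) hH
    rw [smul_smul, mul_comm] at h3
    rw [← h3]
    exact (smul_inv_smul₀ hder _).symm

/-- Nonresonance is an open condition: it is inherited by the operators `adOp P Q` for `P`, `Q`
close to a nonresonant matrix. -/
theorem IsNonresonant.eventually {X : Type*} {l : Filter X} {A : Matrix (Fin n) (Fin n) ℂ}
    (hA : IsNonresonant A) {P Q : X → Matrix (Fin n) (Fin n) ℂ} (hP : Tendsto P l (𝓝 A))
    (hQ : Tendsto Q l (𝓝 A)) : ∀ᶠ x in l, HasNoIntEigenvalue (adOp (P x) (Q x)) :=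
  (tendsto_adOp hP hQ).eventually hA.hasNoIntEigenvalue.eventually

theorem HasNoIntEigenvalue.neg {P Q : Matrix (Fin n) (Fin n) ℂ}
    (h : HasNoIntEigenvalue (adOp P Q)) : HasNoIntEigenvalue (adOp (-P) (-Q)) := by
  intro m hm H hH
  refine h (-m) (neg_ne_zero.2 hm) H ?_
  change P * H - H * Q = _
  have h1 : -P * H - H * -Q = (m : ℂ) • H := hH
  push_cast
  rw [neg_smul, ← h1]
  noncomm_ring

variable [NeZero k] {R ρ : ℝ}

/-- Normalized realizations over the same nonresonant parameter, with the same Stokes data up to the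
Compatibility Condition, are equal. -/
theorem IsNormalizedRealization.eq_of_nonresonant (hR : 0 < R)
    (hzeros : ∀ ε ∈ polydisk k ρ, ∀ x : ℂ, pVal ε x = 0 → ‖x‖ < R / 2)
    {Λ : FormalInvariants k n ρ} {CU0 CL0 : Fin k → Matrix (Fin n) (Fin n) ℂ}
    {Minf : Matrix (Fin n) (Fin n) ℂ} {T : NormalizingMonomials k n} {E0 : RationalSystem k n}
    {ι : Type*} {S : ι → DSDomain k R ρ} {C : ∀ s, StokesData (S s) Λ CU0 CL0}
    {Γ : ∀ s, (S s).carrier → Matrix (Fin n) (Fin n) ℂ} (hcomp : CompatibilityCondition S C Γ)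
    {s s' : ι} {E : (S s).carrier → RationalSystem k n}
    (hE : IsNormalizedRealization (C s) (Γ s) Minf T E0 E)
    {E' : (S s').carrier → RationalSystem k n}
    (hE' : IsNormalizedRealization (C s') (Γ s') Minf T E0 E')
    {u : (S s).carrier} {u' : (S s').carrier} (huu' : (S s).proj u = (S s').proj u')
    (hΛ : Λ.IsNonresonantAt ((S s).proj u))
    (hresR : HasNoIntEigenvalue (adOp (E u).Ahat (E' u').Ahat))
    (hresI : HasNoIntEigenvalue (adOp ((E u).A (Fin.last k) + (E u).Ahat)
      ((E' u').A (Fin.last k) + (E' u').Ahat)))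
    (hd : ∀ i l, i ≠ l → (E u).A 0 i i ≠ (E' u').A 0 l l) : E u = E' u' := by
  have hΓ := hcomp.invertible s u
  have hΓ' := hcomp.invertible s' u'
  have hnf' := hE'.formal u'
  have hnorm' := hE'.normalized u'
  rw [← huu'] at hnf' hnorm'
  have hz := hzeros _ ((S s).proj_mem u).2
  obtain ⟨H, hH, hB⟩ := exists_constant_gauge hR hz
    (hE.realized u) (hE'.realized u') huu'.symm (G := (Γ s u)⁻¹ * Γ s' u')
    (by
      rw [Matrix.det_mul]
      exact (Matrix.isUnit_nonsing_inv_det _ hΓ).mul hΓ')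
    (by
      simp only [Matrix.mul_assoc]
      rw [Matrix.mul_nonsing_inv_cancel_left _ _ hΓ, Matrix.mul_nonsing_inv_cancel_left _ _ hΓ'])
    (hcomp.conj s s' u u' huu')
    (fun a ha => hΛ.hasNoIntEigenvalue ((S s).proj_mem u).1 (hE.formal u) hnf' ha) hresR hresI.neg
  have hpR : pVal ((S s).proj u) R ≠ 0 := fun h0 => by
    have := hz R h0
    rw [Complex.norm_real, Real.norm_of_nonneg hR.le] at this
    linarith
  obtain ⟨hA, hAhat⟩ := RationalSystem.coeff_gauge hpR hB
  exact (hE.normalized u).eq_of_gauge hnorm' hd hH hA hAhat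

end Rigidity

end UnfoldedSystems

theorem theorem3p9 {k n : ℕ} [NeZero k] {R ρ : ℝ} (hR : 0 < R) (hρ : 0 < ρ)
    (hzeros : ∀ ε ∈ UnfoldedSystems.polydisk k ρ, ∀ x : ℂ,
      UnfoldedSystems.pVal ε x = 0 → ‖x‖ < R / 2)
    (Λ : UnfoldedSystems.FormalInvariants k n ρ)
    (CU0 CL0 : Fin k → Matrix (Fin n) (Fin n) ℂ)
    (Minf : Matrix (Fin n) (Fin n) ℂ)
    (hMinf_entries : ∀ i l, Minf i l ≠ 0)
    (hMinf : UnfoldedSystems.HasDistinctEigenvalues Minf)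
    (hMR : UnfoldedSystems.HasDistinctEigenvalues
      (Minf * (UnfoldedSystems.totalMonodromy CU0 CL0)⁻¹))
    (T : UnfoldedSystems.NormalizingMonomials k n)
    (E0 : UnfoldedSystems.RationalSystem k n)
    (hE0 : UnfoldedSystems.IsRealizationAtZero R Λ CU0 CL0 Minf T E0)
    {ι : Type*} (S : ι → UnfoldedSystems.DSDomain k R ρ)
    (C : ∀ s, UnfoldedSystems.StokesData (S s) Λ CU0 CL0)
    (Γ : ∀ s, (S s).carrier → Matrix (Fin n) (Fin n) ℂ)
    (hcomp : UnfoldedSystems.CompatibilityCondition S C Γ)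
    (s s' : ι)
    (E : (S s).carrier → UnfoldedSystems.RationalSystem k n)
    (hE : UnfoldedSystems.IsNormalizedRealization (C s) (Γ s) Minf T E0 E)
    (E' : (S s').carrier → UnfoldedSystems.RationalSystem k n)
    (hE' : UnfoldedSystems.IsNormalizedRealization (C s') (Γ s') Minf T E0 E')
    (u : (S s).carrier) (u' : (S s').carrier) (huu' : (S s).proj u = (S s').proj u') :
    E u = E' u' := by
  obtain ⟨hresR, hresI⟩ := hE0.isNonresonant hR hMinf hMR
  obtain ⟨c, hc, hc1, hcp⟩ := (S s).radial u
  obtain ⟨c', hc', hc1', hcp'⟩ := (S s').radial u'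
  rw [← huu'] at hcp'
  have hlim := UnfoldedSystems.DSDomain.tendsto_radial hcp
  have hlim' := UnfoldedSystems.DSDomain.tendsto_radial hcp'
  -- close to the origin the systems are close to `E0`
  have hdist : ∀ᶠ r in 𝓝[>] (0 : ℝ), ∀ i l, i ≠ l → (E (c r)).A 0 i i ≠ (E' (c' r)).A 0 l l := by
    have hentry : ∀ (M : Matrix (Fin n) (Fin n) ℂ) (f : ℝ → Matrix (Fin n) (Fin n) ℂ),
        Tendsto f (𝓝[>] 0) (𝓝 M) → ∀ i, Tendsto (fun r => f r i i) (𝓝[>] 0) (𝓝 (M i i)) :=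
      fun M f hf i => (tendsto_pi_nhds.1 ((tendsto_pi_nhds.1 hf) i)) i
    refine eventually_all.2 fun i => eventually_all.2 fun l => ?_
    by_cases hil : i = l
    · exact Eventually.of_forall fun r h => absurd hil h
    have h1 := (hentry _ _ ((hE.tendsto_A 0).comp hlim) i).sub
      (hentry _ _ ((hE'.tendsto_A 0).comp hlim') l)
    rw [hE0.leading, Matrix.diagonal_apply_eq, Matrix.diagonal_apply_eq] at h1
    filter_upwards [h1.eventually_ne (sub_ne_zero.2 fun h =>
      hil (Λ.ordered.injective (congrArg Complex.re h)))] with r hr _ h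
    exact hr (sub_eq_zero.2 h)
  have hgood := hdist.and (((hresR.eventually ((hE.tendsto_Ahat).comp hlim)
    ((hE'.tendsto_Ahat).comp hlim')).and (hresI.eventually
      (((hE.tendsto_A (Fin.last k)).add hE.tendsto_Ahat).comp hlim)
      (((hE'.tendsto_A (Fin.last k)).add hE'.tendsto_Ahat).comp hlim'))))
  obtain ⟨δ, hδ, hδgood⟩ := mem_nhdsGT_iff_exists_Ioo_subset.1 hgood
  have hδ : 0 < δ := hδ
  set r₁ : ℝ := min δ 1 / 2 with hr₁
  have hm : 0 < min δ 1 := lt_min hδ one_pos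
  have hr₁' : r₁ ∈ Ioo (0 : ℝ) 1 := ⟨by positivity, by linarith [min_le_right δ 1]⟩
  have hr₁δ : r₁ ∈ Ioo 0 δ := ⟨hr₁'.1, by linarith [min_le_left δ 1]⟩
  -- close to `r₁`, resonances at the zeroes occur at most at `r₁`
  have heq : ∀ᶠ r in 𝓝[≠] r₁, E (c r) = E' (c' r) := by
    filter_upwards [Λ.eventually_isNonresonantAt ((S s).proj_mem u).2 ((S s).proj_mem u).1 hr₁',
      nhdsWithin_le_nhds (Ioo_mem_nhds hr₁δ.1 hr₁δ.2),
      nhdsWithin_le_nhds (Ioo_mem_nhds hr₁'.1 hr₁'.2)] with r hΛ hrδ hr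
    have hr' : r ∈ Ioc (0 : ℝ) 1 := ⟨hr.1, hr.2.le⟩
    obtain ⟨h1, h2, h3⟩ := hδgood hrδ
    exact hE.eq_of_nonresonant hR hzeros hcomp hE' (by rw [hcp r hr', hcp' r hr'])
      (by rw [hcp r hr']; exact hΛ) h2 h3 h1
  refine UnfoldedSystems.RationalSystem.eq_of_coeff_eq ?_ ?_
  · funext m
    have := (hE.analytic_A m).eq_of_eventually_eq (hE'.analytic_A m) hc hc' hcp hcp' hr₁'
      (heq.mono fun r hr => by simp only [hr])
    rwa [hc1, hc1'] at this
  · have := hE.analytic_Ahat.eq_of_eventually_eq hE'.analytic_Ahat hc hc' hcp hcp' hr₁'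
      (heq.mono fun r hr => by simp only [hr])
    rwa [hc1, hc1'] at this
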